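/- Let $M$ be a connected, paracompact, Hausdorff smooth manifold of dimension $m$, let $\eta=\mathrm{diag}(-1,1,\dots,1)$, let $\tau:LM\to M$ be the frame bundle, $J^1\tau$ the bundle of 1-jets of its sections, with fibre coordinates $(x^\mu,e^\mu_k,e^\mu_{k\sigma})$ over a chart of $M$ and $(e^k_\mu)$ the inverse matrix of $(e^\mu_k)$, and let $T_0\subset J^1\tau$ be the submanifold $e^\mu_{i\nu}e^i_\sigma=e^\mu_{i\sigma}e^i_\nu$ of torsionless jets, with projection $\tau_1:T_0\to M$. On $T_0$ consider the forms $$\theta^k=e^k_\mu\,dx^\mu,\qquad \omega^i_j=e^i_\mu(de^\mu_j-e^\mu_{j\sigma}dx^\sigma),\qquad \Omega^i_j=d\omega^i_j+\omega^i_k\wedge\omega^k_j,\qquad \Omega^{ij}=\eta^{jq}\Omega^i_q,$$ $$(\omega_{\mathfrak p})^i_j=\tfrac12(\omega^i_j+\eta_{jp}\omega^p_q\eta^{qi}),\qquad \theta_{i_1\dots i_p}=\tfrac1{(m-p)!}\varepsilon_{i_1\dots i_m}\theta^{i_{p+1}}\wedge\dots\wedge\theta^{i_m}.$$ For $1\le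 r<[m/2]$ let $$\lambda_L=\theta_{i_1\dots i_rj_1\dots j_r}\wedge\Omega^{i_1j_1}\wedge\dots\wedge\Omega^{i_rj_r}$$ be the homogeneous Lovelock Lagrangian of order $r$. Let $\Sigma:M\to T_0$ be a smooth section of $\tau_1$ such that $\Sigma^*\omega_{\mathfrak p}=0$ (metricity) and, for all $i,k$, $$\Sigma^*\Big[\Big(\eta^{kq}\theta_{i_1\dots i_r\,i\,j_2\dots j_r}-\tfrac1{2r}\eta^{j_1q}\delta^k_i\,\theta_{i_1\dots i_rj_1\dots j_r}\Big)\wedge\Omega^{i_1}_q\wedge\Omega^{i_2j_2}\wedge\dots\wedge\Omega^{i_rj_r}\Big]=0 .$$ Then $\Sigma^*(Z\lrcorner d\lambda_L)=0$ for every (local) $\tau_1$-vertical vector field $Z$ on $T_0$. Consequently $\Sigma$ is an extremal of the Griffiths variational problem $(T_0,\lambda_L,\mathcal I_L)$, where $\mathcal I_L$ is the differential ideal generated by $\omega_{\mathfrak p}$. That is, $\Sigma$ is an integral of $\mathcal I_L$, and for every smooth family $(\Sigma_t)_{|t|<\epsilon}$ of sections of $T_0\to M$ that are integrals of $\mathcal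 I_L$, with $\Sigma_0=\Sigma$ and with $\Sigma_t=\Sigma$ outside a compact set $K\subset M$ independent of $t$, one has $\frac{d}{dt}\big|_{t=0}\int_K\Sigma_t^*\lambda_L=0$. Here $M$ is oriented by the global frame $\tau_{10}\circ\Sigma$, with $\tau_{10}:J^1\tau\to LM$ the projection. -/

import Mathlib

open Set Filter Topology MeasureTheory
open scoped Manifold ContDiff

noncomputable section

namespace Lovelock

/-! ### Exterior algebra of real-valued forms on a real normed space -/

section Forms

variable {V : Type*} [NormedAddCommGroup V] [NormedSpace ℝ V]

/-- Alternating `k`-linear forms on `V`. -/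
abbrev Form (V : Type*) [NormedAddCommGroup V] [NormedSpace ℝ V] (k : ℕ) : Type _ :=
  V [⋀^Fin k]→L[ℝ] ℝ

/-- The (non-alternating) product `v ↦ a (v₁, …, v_k) * b (v_{k+1}, …, v_{k+l})`. -/
def preWedge {k l : ℕ} (a : Form V k) (b : Form V l) :
    ContinuousMultilinearMap ℝ (fun _ : Fin (k + l) => V) ℝ where
  toFun v := a (fun i => v (Fin.castAdd l i)) * b (fun i => v (Fin.natAdd k i))
  map_update_add' := by
    classical
    intro inst v i x y
    obtain rfl : inst = instDecidableEqFin (k + l) := Subsingleton.elim _ _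
    refine Fin.addCases (fun i => ?_) (fun i => ?_) i
    · have h1 : ∀ z : V, (fun j => Function.update v (Fin.castAdd l i) z (Fin.castAdd l j))
          = Function.update (fun j => v (Fin.castAdd l j)) i z := by
        intro z; ext j
        by_cases h : j = i
        · subst h; simp
        · rw [Function.update_of_ne h, Function.update_of_ne]
          simpa using h
      have h2 : ∀ z : V, (fun j => Function.update v (Fin.castAdd l i) z (Fin.natAdd k j))
          = (fun j => v (Fin.natAdd k j)) := by
        intro z; ext j
        rw [Function.update_of_ne]
        intro h; have := congrArg Fin.val h; simp at this; omega
      simp only [h1, h2, ContinuousAlternatingMap.map_update_add, add_mul]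
    · have h1 : ∀ z : V, (fun j => Function.update v (Fin.natAdd k i) z (Fin.natAdd k j))
          = Function.update (fun j => v (Fin.natAdd k j)) i z := by
        intro z; ext j
        by_cases h : j = i
        · subst h; simp
        · rw [Function.update_of_ne h, Function.update_of_ne]
          simpa using h
      have h2 : ∀ z : V, (fun j => Function.update v (Fin.natAdd k i) z (Fin.castAdd l j))
          = (fun j => v (Fin.castAdd l j)) := by
        intro z; ext j
        rw [Function.update_of_ne]
        intro h; have := congrArg Fin.val h; simp at this; omega
      simp only [h1, h2, ContinuousAlternatingMap.map_update_add, mul_add]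
  map_update_smul' := by
    classical
    intro inst v i c x
    obtain rfl : inst = instDecidableEqFin (k + l) := Subsingleton.elim _ _
    refine Fin.addCases (fun i => ?_) (fun i => ?_) i
    · have h1 : ∀ z : V, (fun j => Function.update v (Fin.castAdd l i) z (Fin.castAdd l j))
          = Function.update (fun j => v (Fin.castAdd l j)) i z := by
        intro z; ext j
        by_cases h : j = i
        · subst h; simp
        · rw [Function.update_of_ne h, Function.update_of_ne]
          simpa using h
      have h2 : ∀ z : V, (fun j => Function.update v (Fin.castAdd l i) z (Fin.natAdd k j))
          = (fun j => v (Fin.natAdd k j)) := by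
        intro z; ext j
        rw [Function.update_of_ne]
        intro h; have := congrArg Fin.val h; simp at this; omega
      simp only [h1, h2, ContinuousAlternatingMap.map_update_smul, smul_eq_mul, mul_assoc]
    · have h1 : ∀ z : V, (fun j => Function.update v (Fin.natAdd k i) z (Fin.natAdd k j))
          = Function.update (fun j => v (Fin.natAdd k j)) i z := by
        intro z; ext j
        by_cases h : j = i
        · subst h; simp
        · rw [Function.update_of_ne h, Function.update_of_ne]
          simpa using h
      have h2 : ∀ z : V, (fun j => Function.update v (Fin.natAdd k i) z (Fin.castAdd l j))
          = (fun j => v (Fin.castAdd l j)) := by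
        intro z; ext j
        rw [Function.update_of_ne]
        intro h; have := congrArg Fin.val h; simp at this; omega
      simp only [h1, h2, ContinuousAlternatingMap.map_update_smul, smul_eq_mul]
      ring
  cont := by
    exact (a.cont.comp (by fun_prop)).mul (b.cont.comp (by fun_prop))

/-- The wedge product
`(a ∧ b)(v) = 1/(k! l!) ∑_σ sgn(σ) a(v_{σ(1)}, …, v_{σ(k)}) b(v_{σ(k+1)}, …, v_{σ(k+l)})`. -/
def wedge {k l : ℕ} (a : Form V k) (b : Form V l) :
    Form V (k + l) :=
  (1 / ((k.factorial : ℝ) * (l.factorial : ℝ))) • ContinuousMultilinearMap.alternatization (preWedge a b)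

/-- The wedge product `W₁ ∧ ⋯ ∧ W_k` of `k` one-forms. -/
def wedgeOne : (k : ℕ) → (Fin k → Form V 1) → Form V k
  | 0, _ => ContinuousAlternatingMap.constOfIsEmpty ℝ V (Fin 0) 1
  | k + 1, W => wedge (wedgeOne k fun a => W a.castSucc) (W (Fin.last k))

/-- The wedge product `W₁ ∧ ⋯ ∧ W_k` of `k` two-forms. -/
def wedgeTwo : (k : ℕ) → (Fin k → Form V 2) → Form V (2 * k)
  | 0, _ => ContinuousAlternatingMap.constOfIsEmpty ℝ V (Fin 0) 1
  | k + 1, W => wedge (wedgeTwo k fun a => W a.castSucc) (W (Fin.last k))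

/-- The pullback `f^* α` of a differential form. -/
def pullback {U : Type*} [NormedAddCommGroup U] [NormedSpace ℝ U] {k : ℕ}
    (f : U → V) (α : V → Form V k) (z : U) : Form U k :=
  (α (f z)).compContinuousLinearMap (fderiv ℝ f z)

/-- The contraction `Z ⌟ α` of a differential form with a vector field. -/
def contract {k : ℕ} (Z : V → V) (α : V → Form V (k + 1)) (q : V) :
    Form V k :=
  (α q).curryLeft (Z q)

end Forms

/-- The Levi-Civita symbol `ε_{i₁ … i_m}`. -/
def leviCivita {m : ℕ} (f : Fin m → Fin m) : ℝ :=
  open Classical in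
  if h : Function.Bijective f then
    ((Equiv.Perm.sign (Equiv.ofBijective f h) : ℤ) : ℝ) else 0

/-- The concatenated multi-index `i₁ … i_p s₁ … s_{m-p}`. -/
def concat {m p : ℕ} (I : Fin p → Fin m) (s : Fin (m - p) → Fin m) : Fin m → Fin m :=
  fun a => if h : (a : ℕ) < p then I ⟨a, h⟩ else s ⟨a - p, by omega⟩

/-- The matrix `η = diag(-1, 1, …, 1)`. -/
def eta (m : ℕ) : Matrix (Fin m) (Fin m) ℝ :=
  Matrix.diagonal fun i => if (i : ℕ) = 0 then -1 else 1

/-- `η` is its own inverse, so that `eta m i j` stands for both `η_{ij}` and `η^{ij}`. -/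
theorem eta_mul_eta (m : ℕ) : eta m * eta m = 1 := by
  rw [eta, Matrix.diagonal_mul_diagonal, ← Matrix.diagonal_one]
  congr 1
  ext i
  split_ifs <;> norm_num

/-- The model space `ℝ^m`. -/
abbrev E (m : ℕ) : Type := EuclideanSpace ℝ (Fin m)

/-- The canonical basis vector `𝐞_k` of `ℝ^m`. -/
def basisVec {m : ℕ} (k : Fin m) : E m := EuclideanSpace.single k 1

/-! ### Canonical forms on the jet bundle, in coordinates

Over a chart of `M`, the jet bundle `J¹τ ≃ C(LM) ×_M LM` has the coordinates `(x, e, Γ)`: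
`x` is the base point, `e` is the frame (`e 𝐞_k = e^μ_k ∂_μ`, invertible), and `Γ` is the bilinear
map with components `Γ^μ_{νσ} = -e^k_ν e^μ_{kσ}`, here `Γ (∂_σ) (∂_ν) = Γ^μ_{νσ} ∂_μ`.
In these coordinates the submanifold `T₀` is given by `Γ^μ_{νσ} = Γ^μ_{σν}`. -/

/-- The coordinate space of `J¹τ` over a chart of `M`. -/
def J (m : ℕ) : Type := E m × (E m →L[ℝ] E m) × (E m →L[ℝ] E m →L[ℝ] E m)

instance (m : ℕ) : NormedAddCommGroup (J m) :=
  inferInstanceAs (NormedAddCommGroup (E m × (E m →L[ℝ] E m) × (E m →L[ℝ] E m →L[ℝ] E m)))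

instance (m : ℕ) : NormedSpace ℝ (J m) :=
  inferInstanceAs (NormedSpace ℝ (E m × (E m →L[ℝ] E m) × (E m →L[ℝ] E m →L[ℝ] E m)))

/-- The points `(x, e, Γ)` of the coordinate space that belong to `T₀`. -/
def T0Coord (m : ℕ) : Set (J m) :=
  {q | IsUnit q.2.1 ∧ ∀ v w, q.2.2 v w = q.2.2 w v}

/-- The coordinate expressions of the `τ₁`-vertical vectors tangent to `T₀` (the equation of `T₀`
is linear in the coordinates `(x, e, Γ)`). -/
def verticalT0 (m : ℕ) : Set (J m) :=
  {Z | Z.1 = 0 ∧ ∀ v w, Z.2.2 v w = Z.2.2 w v}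

/-- A linear functional as an alternating one-form. -/
def oneForm {m : ℕ} (f : J m →L[ℝ] ℝ) : Form (J m) 1 :=
  ContinuousAlternatingMap.ofSubsingleton ℝ (J m) ℝ (0 : Fin 1) f

/-- The `i`-th coordinate functional of `ℝ^m`. -/
def coordFn {m : ℕ} (i : Fin m) : E m →L[ℝ] ℝ := EuclideanSpace.proj i

/-- The vector-valued constant one-form `dx`. -/
def dx (m : ℕ) : J m →L[ℝ] E m :=
  (ContinuousLinearMap.fst ℝ (E m) ((E m →L[ℝ] E m) × (E m →L[ℝ] E m →L[ℝ] E m)) :)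

/-- The endomorphism-valued constant one-form `de`. -/
def de (m : ℕ) : J m →L[ℝ] (E m →L[ℝ] E m) :=
  ((ContinuousLinearMap.fst ℝ (E m →L[ℝ] E m) (E m →L[ℝ] E m →L[ℝ] E m)).comp
    (ContinuousLinearMap.snd ℝ (E m) ((E m →L[ℝ] E m) × (E m →L[ℝ] E m →L[ℝ] E m))) :)

/-- The canonical forms `θ^i = e^i_μ dx^μ`. -/
def theta {m : ℕ} (i : Fin m) (q : J m) : Form (J m) 1 :=
  oneForm ((coordFn i).comp ((Ring.inverse q.2.1).comp (dx m)))

/-- The universal connection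
`ω^i_j = e^i_μ (de^μ_j - e^μ_{jσ} dx^σ) = e^i_μ (de^μ_j + Γ^μ_{νσ} e^ν_j dx^σ)`. -/
def omega {m : ℕ} (i j : Fin m) (q : J m) : Form (J m) 1 :=
  oneForm ((coordFn i).comp ((Ring.inverse q.2.1).comp
    ((ContinuousLinearMap.apply ℝ (E m) (basisVec j)).comp (de m)
      + (ContinuousLinearMap.apply ℝ (E m) (q.2.1 (basisVec j))).comp (q.2.2.comp (dx m)))))

/-- The components `(ω_𝔭)^i_j = (ω^i_j + η_{jp} ω^p_q η^{qi}) / 2` of the projection of `ω` to the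
second summand of the Cartan decomposition `𝔤𝔩(m) = 𝔨 ⊕ 𝔭` defined by `η`. -/
def omegaP {m : ℕ} (i j : Fin m) (q : J m) : Form (J m) 1 :=
  (1 / 2 : ℝ) • (omega i j q
    + ∑ p : Fin m, ∑ l : Fin m, (eta m j p * eta m l i) • omega p l q)

/-- The universal curvature `Ω^i_j = dω^i_j + ω^i_k ∧ ω^k_j`. -/
def curv {m : ℕ} (i j : Fin m) (q : J m) : Form (J m) 2 :=
  extDeriv (omega i j) q + ∑ k : Fin m, wedge (omega i k q) (omega k j q)

/-- `Ω^{ij} = η^{jq} Ω^i_q`. -/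
def curvUp {m : ℕ} (i j : Fin m) (q : J m) : Form (J m) 2 :=
  ∑ l : Fin m, eta m j l • curv i l q

/-- The Sparling forms
`θ_{i₁ … i_p} = 1/(m-p)! ε_{i₁ … i_p s₁ … s_{m-p}} θ^{s₁} ∧ ⋯ ∧ θ^{s_{m-p}}`. -/
def sparling {m p : ℕ} (I : Fin p → Fin m) (q : J m) : Form (J m) (m - p) :=
  (1 / ((m - p).factorial : ℝ)) • ∑ s : Fin (m - p) → Fin m,
    leviCivita (concat I s) • wedgeOne (m - p) fun a => theta (s a) q

/-- The Lovelock Lagrangian of order `r = n + 1`,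
`λ_L = θ_{i₁ … i_r j₁ … j_r} ∧ Ω^{i₁ j₁} ∧ ⋯ ∧ Ω^{i_r j_r}`,
a form of degree `(m - 2r) + 2r`, which is `m` if `2r ≤ m`. -/
def lagrangian {m : ℕ} (n : ℕ) (q : J m) :
    Form (J m) ((m - (n + 1 + (n + 1))) + 2 * (n + 1)) :=
  ∑ I : Fin (n + 1) → Fin m, ∑ K : Fin (n + 1) → Fin m,
    wedge (sparling (Fin.append I K) q) (wedgeTwo (n + 1) fun a => curvUp (I a) (K a) q)

/-- The form `θ_{i₁ … i_r j j₂ … j_r} ∧ Ω^{i₁}_q ∧ Ω^{i₂ j₂} ∧ ⋯ ∧ Ω^{i_r j_r}` with `r = n + 1`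
(summed over the repeated indices `i₁, …, i_r, j₂, …, j_r`; the indices `j` and `q` are free). -/
def fieldForm {m : ℕ} (n : ℕ) (j l : Fin m) (q : J m) :
    Form (J m) ((m - (n + 1 + (n + 1))) + 2 * (n + 1)) :=
  ∑ I : Fin (n + 1) → Fin m, ∑ K : Fin n → Fin m,
    wedge (sparling (Fin.append I (Fin.cons j K : Fin (n + 1) → Fin m)) q)
      (wedgeTwo (n + 1) (Fin.cons (curv (I 0) l q) fun a => curvUp (I a.succ) (K a) q))

/-- The form
`(η^{kq} θ_{I i j₂ … j_r} - 1/(2r) η^{j₁ q} δ^k_i θ_{I J}) ∧ Ω^{i₁}_q ∧ Ω^{I' J'}`, `r = n + 1`. -/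
def equationForm {m : ℕ} (n : ℕ) (k i : Fin m) (q : J m) :
    Form (J m) ((m - (n + 1 + (n + 1))) + 2 * (n + 1)) :=
  (∑ l : Fin m, eta m k l • fieldForm n i l q)
    - (1 / (2 * ((n : ℝ) + 1)) * (if k = i then 1 else 0)) •
        ∑ j : Fin m, ∑ l : Fin m, eta m j l • fieldForm n j l q

/-! ### The frame bundle, its first jet bundle and the submanifold `T₀` -/

section Bundles

variable (m : ℕ) (M : Type*) [TopologicalSpace M] [ChartedSpace (E m) M]

/-- The smooth charts of `M`. -/
abbrev Chart : Type _ :=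
  {φ : OpenPartialHomeomorph M (E m) // φ ∈ IsManifold.maximalAtlas (𝓡 m) ∞ M}

variable {m M}

/-- The fibre of the frame bundle `LM`: linear isomorphisms `ℝ^m → T_x M`. -/
abbrev Frame (x : M) : Type := E m ≃L[ℝ] TangentSpace (𝓡 m) x

/-- The coordinate expression `e` of a frame at `x` in a chart: `e 𝐞_k = e^μ_k ∂_μ`. -/
def frameCoord (φ : Chart m M) {x : M} (u : Frame (m := m) x) : E m →L[ℝ] E m :=
  ContinuousLinearMap.comp (M₂ := TangentSpace (𝓡 m) x) (M₃ := TangentSpace (𝓡 m) (φ.1 x))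
    (mfderiv (𝓡 m) (𝓡 m) φ.1 x) (u : E m →L[ℝ] TangentSpace (𝓡 m) x)

/-- The coordinate expression of a field of frames in a chart. -/
def frameRep (φ : Chart m M) (s : (y : M) → Frame (m := m) y) (z : E m) : E m →L[ℝ] E m :=
  frameCoord φ (s (φ.1.symm z))

/-- A local smooth section of the frame bundle around `x` (the values of `frame` outside `dom` are
irrelevant). -/
structure LocalFrame (x : M) where
  dom : Set M
  isOpen_dom : IsOpen dom
  mem_dom : x ∈ dom
  frame : (y : M) → Frame (m := m) y
  smooth : ∀ φ : Chart m M,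
    ContDiffOn ℝ ∞ (frameRep φ frame) (φ.1.target ∩ φ.1.symm ⁻¹' dom)

/-- Contact equivalence of first order at `x`: the sections agree at `x`, and so do their first
derivatives in charts. -/
instance jetSetoid (x : M) : Setoid (LocalFrame (m := m) x) where
  r s s' := s.frame x = s'.frame x ∧ ∀ φ : Chart m M, x ∈ φ.1.source →
    fderiv ℝ (frameRep φ s.frame) (φ.1 x) = fderiv ℝ (frameRep φ s'.frame) (φ.1 x)
  iseqv :=
    { refl := fun _ => ⟨rfl, fun _ _ => rfl⟩
      symm := fun h => ⟨h.1.symm, fun φ hx => (h.2 φ hx).symm⟩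
      trans := fun h h' => ⟨h.1.trans h'.1, fun φ hx => (h.2 φ hx).trans (h'.2 φ hx)⟩ }

/-- The fibre over `x` of the bundle `J¹τ` of 1-jets of sections of the frame bundle. -/
def Jet (x : M) : Type _ := Quotient (jetSetoid (m := m) x)

/-- The projection `τ₁₀ : J¹τ → LM`. -/
def Jet.frame {x : M} : Jet (m := m) x → Frame (m := m) x :=
  Quotient.lift (fun s => s.frame x) fun _ _ h => h.1

/-- The jet coordinates `e^μ_{kσ}` in a chart around `x`: `j.deriv φ ∂_σ 𝐞_k = e^μ_{kσ} ∂_μ`. -/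
def Jet.deriv (φ : Chart m M) {x : M} : Jet (m := m) x → (E m →L[ℝ] E m →L[ℝ] E m) :=
  open Classical in
  Quotient.lift
    (fun s => if x ∈ φ.1.source then fderiv ℝ (frameRep φ s.frame) (φ.1 x) else 0)
    fun _ _ h => by
      by_cases hx : x ∈ φ.1.source
      · simp only [hx, if_true]; exact h.2 φ hx
      · simp only [hx, if_false]

/-- The coordinates `(x, e, Γ)` of a jet, with `Γ^μ_{νσ} = -e^k_ν e^μ_{kσ}`. -/
def Jet.coord (φ : Chart m M) {x : M} (j : Jet (m := m) x) : J m :=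
  (φ.1 x, frameCoord φ j.frame,
    -(((ContinuousLinearMap.compL ℝ (E m) (E m) (E m)).flip
      (Ring.inverse (frameCoord φ j.frame))).comp (j.deriv φ)))

/-- The equations `e^μ_{iν} e^i_σ - e^μ_{iσ} e^i_ν = 0`. -/
def Jet.TorsionFree {x : M} (j : Jet (m := m) x) : Prop :=
  ∀ φ : Chart m M, x ∈ φ.1.source → ∀ v w : E m,
    j.deriv φ v (Ring.inverse (frameCoord φ j.frame) w)
      = j.deriv φ w (Ring.inverse (frameCoord φ j.frame) v)

/-- The fibre over `x` of the bundle `T₀ → M`. -/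
def T0 (x : M) : Type _ := {j : Jet (m := m) x // j.TorsionFree}

/-- The coordinate expression of a section of `T₀ → M` in a chart. -/
def sectionRep (φ : Chart m M) (s : (x : M) → T0 (m := m) x) (z : E m) : J m :=
  (s (φ.1.symm z)).1.coord φ

variable (m M)

/-- Smooth sections `M → T₀`. -/
structure T0Section where
  toFun : (x : M) → T0 (m := m) x
  smooth : ∀ φ : Chart m M, ContDiffOn ℝ ∞ (sectionRep φ toFun) φ.1.target

variable {m M}

/-- The coordinate expression of a smooth section of `T₀ → M` in a chart. -/
def T0Section.rep (s : T0Section m M) (φ : Chart m M) : E m → J m := sectionRep φ s.toFun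

/-! ### The field equations and the variational problem -/

/-- `Σ^* α = 0`, for a form `α` on `T₀` given by the same coordinate expression in all charts. -/
def T0Section.Kills {k : ℕ} (s : T0Section m M) (α : J m → Form (J m) k) : Prop :=
  ∀ φ : Chart m M, ∀ z ∈ φ.1.target, pullback (s.rep φ) α z = 0

/-- Metricity: `Σ^* ω_𝔭 = 0`. Since pullbacks commute with `∧` and `d`, this says that `Σ` is an
integral of the differential ideal `I_L` generated by the components of `ω_𝔭`. -/
def T0Section.Metric (s : T0Section m M) : Prop :=
  ∀ i j : Fin m, s.Kills (omegaP i j)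

/-- The equations
`Σ^* [(η^{kq} θ_{I i j₂ … j_r} - 1/(2r) η^{j₁ q} δ^k_i θ_{I J}) ∧ Ω^{i₁}_q ∧ Ω^{I' J'}] = 0`,
with `r = n + 1`. -/
def T0Section.LovelockEquations (s : T0Section m M) (n : ℕ) : Prop :=
  ∀ k i : Fin m, s.Kills (equationForm n k i)

/-- The vectors `∂_1, ∂_2, …` of the coordinate frame of `ℝ^m`. -/
def coordFrame (m k : ℕ) (a : Fin k) : E m :=
  WithLp.toLp 2 fun i => if (i : ℕ) = a then 1 else 0

/-- The action `∫_K Σ^* λ_L` over a compact set `K ⊆ M`, computed with a smooth partition of unity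
that is subordinate to the domains of the charts. The orientation of `M` is the one for which the
frames `τ₁₀ ∘ Σ` are positive. -/
def T0Section.action (s : T0Section m M) (n : ℕ)
    (ρ : SmoothPartitionOfUnity (Chart m M) (𝓡 m) M univ) (K : Set M) : ℝ :=
  ∑ᶠ φ : Chart m M, ∫ z in φ.1.target ∩ φ.1.symm ⁻¹' K,
    ρ φ (φ.1.symm z) * Real.sign (s.rep φ z).2.1.det
      * pullback (s.rep φ) (lagrangian n) z (coordFrame m _)

/-- Extremals of the Griffiths variational problem `(T₀, λ_L, I_L)`: sections that are integral for
`I_L` and at which the action is stationary with respect to the smooth compactly supported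
variations through sections that are integral for `I_L`. -/
def T0Section.IsExtremal (s : T0Section m M) (n : ℕ) : Prop :=
  s.Metric ∧
  ∀ (ε : ℝ) (S : ℝ → T0Section m M) (K : Set M), 0 < ε → S 0 = s → IsCompact K →
    (∀ φ : Chart m M, ContDiffOn ℝ ∞ (fun p : ℝ × E m => (S p.1).rep φ p.2)
      (Ioo (-ε) ε ×ˢ φ.1.target)) →
    (∀ t ∈ Ioo (-ε) ε, (S t).Metric) →
    (∀ t ∈ Ioo (-ε) ε, ∀ x ∉ K, (S t).toFun x = s.toFun x) →
    ∀ ρ : SmoothPartitionOfUnity (Chart m M) (𝓡 m) M univ,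
      ρ.IsSubordinate (fun φ => φ.1.source) →
      HasDerivAt (fun t => (S t).action n ρ K) 0 0

end Bundles

end Lovelock

end

/-! The first assertion is pointwise and is proved in a gauge where the connection vanishes. Since
jets in `T₀` have symmetric `Γ`, a quadratic change of coordinates kills `Γ` at a given point. At a
jet with `Γ = 0`, move along a line `q + t v` and put `X = e⁻¹ δe`, `g = 1 + tX`. The coframe is
multiplied by `g⁻¹`. The curvature is conjugated by `g` and otherwise changes only at order `t²`,
because `Γ ∧ Γ` is quadratic. Invariance of the Levi-Civita symbol then gives `λ_L(q + t v) =
det(g)⁻¹` times the Lovelock form with the original coframe and with `η` replaced by `g η gᵀ`, up to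
order `t²` (`lagrangian_add_smul`). Differentiation gives a combination of the equation forms whose
coefficients are linear in `Xη + ηXᵀ` (`fderiv_lagrangian`). In this gauge `X` is the value of `ω`
on `v`, so the derivative vanishes along vectors tangent to the image of `Σ` by metricity. In the
expansion of `dλ_L(Z, u₁, …)` on such vectors `u_a`, only the derivative along `Z` survives, and it
is a combination of equation forms evaluated on the `u_a`, hence zero.

The passage to the gauge does not lift coordinate changes to the jet bundle. Two maps into jet
coordinates that pull `θ` and `ω` back to the same forms also pull back alike everything built from
these by `∧` and `d`, in particular `λ_L` and `dλ_L` (`SameCanonicalForms`). The comparison is made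
for the map `(t, z) ↦ Σ(z) + tZ` and its transform. The same criterion later handles changes of
chart.

For stationarity, let `Λ` be the pullback of `λ_L` along `(t, z) ↦ Σ_t(z)`. The velocity `∂_t Σ_t`
is vertical, so `ι_{∂_t} dΛ` vanishes on spatial vectors at `t = 0`, and the time derivative of the
Lagrangian density is the spatial divergence of `ι_{∂_t} Λ`, which vanishes off `K`. After
localization with `ρ_φ` each chart contributes the integral of an exact term, which is zero, and a
remainder `dρ_φ ∧ ι_{∂_t} Λ`. The remainders are densities on `M`, once the sign of the frame
determinant turns Jacobians into absolute values, and they cancel in the sum because `∑ dρ_φ = 0`.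
-/

noncomputable section

namespace Lovelock

/-! ### Bilinearity, naturality and commutation of wedge products -/

section Forms

variable {V : Type*} [NormedAddCommGroup V] [NormedSpace ℝ V]
variable {U : Type*} [NormedAddCommGroup U] [NormedSpace ℝ U]

theorem preWedge_apply {k l : ℕ} (a : Form V k) (b : Form V l) (v : Fin (k + l) → V) :
    preWedge a b v = a (fun i => v (Fin.castAdd l i)) * b (fun i => v (Fin.natAdd k i)) := rfl

theorem wedge_apply {k l : ℕ} (a : Form V k) (b : Form V l) (v : Fin (k + l) → V) :
    wedge a b v = (1 / ((k.factorial : ℝ) * (l.factorial : ℝ))) *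
      ∑ σ : Equiv.Perm (Fin (k + l)), ((Equiv.Perm.sign σ : ℤ) : ℝ) *
        (a (fun i => v (σ (Fin.castAdd l i))) * b (fun i => v (σ (Fin.natAdd k i)))) := by
  simp only [wedge, ContinuousAlternatingMap.smul_apply,
    ContinuousMultilinearMap.alternatization_apply_apply, preWedge_apply, smul_eq_mul,
    Function.comp_apply]
  congr 1
  refine Finset.sum_congr rfl fun σ _ => ?_
  rw [Units.smul_def, zsmul_eq_mul]

theorem wedge_add_left {k l : ℕ} (a a' : Form V k) (b : Form V l) :
    wedge (a + a') b = wedge a b + wedge a' b := by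
  ext v
  simp only [wedge_apply, ContinuousAlternatingMap.add_apply, add_mul, mul_add,
    Finset.sum_add_distrib]

theorem wedge_add_right {k l : ℕ} (a : Form V k) (b b' : Form V l) :
    wedge a (b + b') = wedge a b + wedge a b' := by
  ext v
  simp only [wedge_apply, ContinuousAlternatingMap.add_apply, mul_add,
    Finset.sum_add_distrib]

theorem wedge_smul_left {k l : ℕ} (c : ℝ) (a : Form V k) (b : Form V l) :
    wedge (c • a) b = c • wedge a b := by
  ext v
  simp only [wedge_apply, ContinuousAlternatingMap.smul_apply, smul_eq_mul, Finset.mul_sum]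
  exact Finset.sum_congr rfl fun σ _ => by ring

theorem wedge_smul_right {k l : ℕ} (c : ℝ) (a : Form V k) (b : Form V l) :
    wedge a (c • b) = c • wedge a b := by
  ext v
  simp only [wedge_apply, ContinuousAlternatingMap.smul_apply, smul_eq_mul, Finset.mul_sum]
  exact Finset.sum_congr rfl fun σ _ => by ring

/-- Every one of the `(k + l)!` terms of the alternatization obeys the same bound. The estimate
makes the wedge a continuous bilinear map, from which smoothness and the Leibniz rule follow. -/
theorem norm_wedge_le {k l : ℕ} (a : Form V k) (b : Form V l) :
    ‖wedge a b‖ ≤ (1 / ((k.factorial : ℝ) * (l.factorial : ℝ)) * (k + l).factorial) *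
      ‖a‖ * ‖b‖ := by
  refine ContinuousAlternatingMap.opNorm_le_bound _ (by positivity) fun v => ?_
  rw [wedge_apply, norm_mul, Real.norm_of_nonneg (by positivity)]
  have key : ‖∑ σ : Equiv.Perm (Fin (k + l)), ((Equiv.Perm.sign σ : ℤ) : ℝ) *
        (a (fun i => v (σ (Fin.castAdd l i))) * b (fun i => v (σ (Fin.natAdd k i))))‖
      ≤ ∑ σ : Equiv.Perm (Fin (k + l)), ‖a‖ * ‖b‖ * ∏ i, ‖v i‖ := by
    refine (norm_sum_le _ _).trans (Finset.sum_le_sum fun σ _ => ?_)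
    have hs : ‖((Equiv.Perm.sign σ : ℤ) : ℝ)‖ = 1 := by
      rcases Int.units_eq_one_or (Equiv.Perm.sign σ) with h | h <;> simp [h]
    rw [norm_mul, hs, one_mul, norm_mul, ← Equiv.prod_comp σ, Fin.prod_univ_add]
    calc _ ≤ (‖a‖ * ∏ i, ‖v (σ (Fin.castAdd l i))‖) * (‖b‖ * ∏ i, ‖v (σ (Fin.natAdd k i))‖) :=
          mul_le_mul (a.le_opNorm _) (b.le_opNorm _) (norm_nonneg _) (by positivity)
      _ = _ := by ring
  rw [Finset.sum_const, Finset.card_univ, Fintype.card_perm, Fintype.card_fin, nsmul_eq_mul] at key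
  calc _ ≤ 1 / ((k.factorial : ℝ) * (l.factorial : ℝ)) *
        (((k + l).factorial : ℝ) * (‖a‖ * ‖b‖ * ∏ i, ‖v i‖)) := by gcongr
    _ = _ := by ring

/-- The wedge product as a continuous bilinear map. -/
def wedgeL (V : Type*) [NormedAddCommGroup V] [NormedSpace ℝ V] (k l : ℕ) :
    Form V k →L[ℝ] Form V l →L[ℝ] Form V (k + l) :=
  LinearMap.mkContinuous₂
    (LinearMap.mk₂ ℝ wedge wedge_add_left wedge_smul_left wedge_add_right
      (fun c a b => wedge_smul_right c a b)) _ norm_wedge_le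

@[simp] theorem wedgeL_apply {k l : ℕ} (a : Form V k) (b : Form V l) :
    wedgeL V k l a b = wedge a b := rfl

theorem wedge_sum_left {ι : Type*} {k l : ℕ} (s : Finset ι) (a : ι → Form V k) (b : Form V l) :
    wedge (∑ i ∈ s, a i) b = ∑ i ∈ s, wedge (a i) b := by
  simp only [← wedgeL_apply, map_sum, _root_.sum_apply]

theorem wedge_sum_right {ι : Type*} {k l : ℕ} (s : Finset ι) (a : Form V k) (b : ι → Form V l) :
    wedge a (∑ i ∈ s, b i) = ∑ i ∈ s, wedge a (b i) := by
  simp only [← wedgeL_apply, map_sum]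

/-! ### Pullback along a linear map -/

theorem wedge_comp {k l : ℕ} (a : Form V k) (b : Form V l) (f : U →L[ℝ] V) :
    (wedge a b).compContinuousLinearMap f =
      wedge (a.compContinuousLinearMap f) (b.compContinuousLinearMap f) := by
  ext v
  simp only [ContinuousAlternatingMap.compContinuousLinearMap_apply, wedge_apply,
    Function.comp_def]

theorem wedgeOne_comp : ∀ (k : ℕ) (W : Fin k → Form V 1) (f : U →L[ℝ] V),
    (wedgeOne k W).compContinuousLinearMap f =
      wedgeOne k fun a => (W a).compContinuousLinearMap f
  | 0, _, _ => by ext v; rfl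
  | k + 1, W, f => by
    rw [wedgeOne, wedge_comp, wedgeOne_comp k, wedgeOne]

theorem wedgeTwo_comp : ∀ (k : ℕ) (W : Fin k → Form V 2) (f : U →L[ℝ] V),
    (wedgeTwo k W).compContinuousLinearMap f =
      wedgeTwo k fun a => (W a).compContinuousLinearMap f
  | 0, _, _ => by ext v; rfl
  | k + 1, W, f => by
    rw [wedgeTwo, wedge_comp, wedgeTwo_comp k, wedgeTwo]

theorem form_add_comp {k : ℕ} (a b : Form V k) (f : U →L[ℝ] V) :
    (a + b).compContinuousLinearMap f =
      a.compContinuousLinearMap f + b.compContinuousLinearMap f := rfl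

theorem form_smul_comp {k : ℕ} (c : ℝ) (a : Form V k) (f : U →L[ℝ] V) :
    (c • a).compContinuousLinearMap f = c • a.compContinuousLinearMap f := rfl

theorem form_sum_comp {ι : Type*} {k : ℕ} (s : Finset ι) (a : ι → Form V k) (f : U →L[ℝ] V) :
    (∑ i ∈ s, a i).compContinuousLinearMap f = ∑ i ∈ s, (a i).compContinuousLinearMap f := by
  ext v
  simp [ContinuousAlternatingMap.compContinuousLinearMap_apply]

/-! ### Multilinear expansions -/

theorem wedgeOne_sum {ι : Type*} [Fintype ι] : ∀ (k : ℕ) (c : Fin k → ι → ℝ)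
    (W : Fin k → ι → Form V 1),
    wedgeOne k (fun a => ∑ i, c a i • W a i) =
      ∑ s : Fin k → ι, (∏ a, c a (s a)) • wedgeOne k fun a => W a (s a)
  | 0, c, W => by simp [wedgeOne]
  | k + 1, c, W => by
    rw [wedgeOne, wedgeOne_sum k, wedge_sum_left,
      ← (Fin.snocEquiv fun _ : Fin (k + 1) => ι).sum_comp, Fintype.sum_prod_type_right]
    refine Finset.sum_congr rfl fun s _ => ?_
    rw [wedge_sum_right]
    refine Finset.sum_congr rfl fun i _ => ?_
    rw [wedge_smul_left, wedge_smul_right, smul_smul, Fin.prod_univ_castSucc]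
    simp [Fin.snocEquiv, wedgeOne]

theorem wedgeTwo_sum {ι : Type*} [Fintype ι] : ∀ (k : ℕ) (c : Fin k → ι → ℝ)
    (W : Fin k → ι → Form V 2),
    wedgeTwo k (fun a => ∑ i, c a i • W a i) =
      ∑ s : Fin k → ι, (∏ a, c a (s a)) • wedgeTwo k fun a => W a (s a)
  | 0, c, W => by simp [wedgeTwo]
  | k + 1, c, W => by
    rw [wedgeTwo, wedgeTwo_sum k, wedge_sum_left,
      ← (Fin.snocEquiv fun _ : Fin (k + 1) => ι).sum_comp, Fintype.sum_prod_type_right]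
    refine Finset.sum_congr rfl fun s _ => ?_
    rw [wedge_sum_right]
    refine Finset.sum_congr rfl fun i _ => ?_
    rw [wedge_smul_left, wedge_smul_right, smul_smul, Fin.prod_univ_castSucc]
    simp [Fin.snocEquiv, wedgeTwo]

/-! ### Commutation of two-forms -/

/-- Permutations `τ` of the first `k + l` positions extend to all positions. Absorbing the extension
into the outer permutation makes the summand independent of `τ`, so the inner sum only contributes
`(k + l)!`, which cancels the outer normalization. -/
theorem wedge_wedge_apply {k l p : ℕ} (a : Form V k) (b : Form V l) (c : Form V p)
    (v : Fin (k + l + p) → V) :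
    wedge (wedge a b) c v =
      (1 / ((k.factorial : ℝ) * (l.factorial : ℝ) * (p.factorial : ℝ))) *
      ∑ σ : Equiv.Perm (Fin (k + l + p)), ((Equiv.Perm.sign σ : ℤ) : ℝ) *
        (a (fun i => v (σ (Fin.castAdd p (Fin.castAdd l i)))) *
          b (fun i => v (σ (Fin.castAdd p (Fin.natAdd k i)))) *
          c (fun i => v (σ (Fin.natAdd (k + l) i)))) := by
  set T : Equiv.Perm (Fin (k + l + p)) → ℝ := fun σ => ((Equiv.Perm.sign σ : ℤ) : ℝ) *
        (a (fun i => v (σ (Fin.castAdd p (Fin.castAdd l i)))) *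
          b (fun i => v (σ (Fin.castAdd p (Fin.natAdd k i)))) *
          c (fun i => v (σ (Fin.natAdd (k + l) i)))) with hT
  -- The extension of `τ` that fixes the last `p` positions.
  let ex : Equiv.Perm (Fin (k + l)) → Equiv.Perm (Fin (k + l + p)) := fun τ =>
    finSumFinEquiv.permCongr (Equiv.Perm.sumCongr τ 1)
  have ex1 : ∀ τ i, ex τ (Fin.castAdd p i) = Fin.castAdd p (τ i) := fun τ i => by
    simp [ex, Equiv.permCongr_apply]
  have ex2 : ∀ τ i, ex τ (Fin.natAdd (k + l) i) = Fin.natAdd (k + l) i := fun τ i => by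
    simp [ex, Equiv.permCongr_apply]
  have exs : ∀ τ, Equiv.Perm.sign (ex τ) = Equiv.Perm.sign τ := fun τ => by
    simp [ex, Equiv.Perm.sign_permCongr]
  have h1 : wedge (wedge a b) c v =
      (1 / (((k + l).factorial : ℝ) * (p.factorial : ℝ))) *
        ((1 / ((k.factorial : ℝ) * (l.factorial : ℝ))) *
        ∑ τ : Equiv.Perm (Fin (k + l)), ∑ σ, T (σ * ex τ)) := by
    rw [wedge_apply, Finset.sum_comm]
    congr 1
    rw [Finset.mul_sum]
    refine Finset.sum_congr rfl fun σ _ => ?_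
    rw [wedge_apply, Finset.mul_sum, Finset.sum_mul, Finset.mul_sum, Finset.mul_sum]
    refine Finset.sum_congr rfl fun τ _ => ?_
    simp only [hT, Equiv.Perm.sign_mul, exs, Equiv.Perm.mul_apply, ex1, ex2, Units.val_mul,
      Int.cast_mul]
    ring
  have h2 : ∀ τ : Equiv.Perm (Fin (k + l)), ∑ σ, T (σ * ex τ) = ∑ σ, T σ := fun τ =>
    Equiv.sum_comp (Equiv.mulRight (ex τ)) T
  rw [h1, Finset.sum_congr rfl fun τ _ => h2 τ, Finset.sum_const, Finset.card_univ,
    Fintype.card_perm, Fintype.card_fin, nsmul_eq_mul]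
  have : ((k + l).factorial : ℝ) ≠ 0 := by positivity
  field_simp

/-- In the symmetric triple formula, `b` and `c` trade places under the permutation exchanging their
blocks of two arguments. It is a product of two transpositions, hence even. -/
theorem wedge_wedge_swap {k : ℕ} (a : Form V k) (b c : Form V 2) :
    wedge (wedge a b) c = wedge (wedge a c) b := by
  ext v
  rw [wedge_wedge_apply, wedge_wedge_apply]
  congr 1
  let π : Equiv.Perm (Fin (k + 2 + 2)) :=
    Equiv.swap (Fin.castAdd 2 (Fin.natAdd k 0)) (Fin.natAdd (k + 2) 0) *
      Equiv.swap (Fin.castAdd 2 (Fin.natAdd k 1)) (Fin.natAdd (k + 2) 1)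
  have hsign : Equiv.Perm.sign π = 1 := by
    rw [Equiv.Perm.sign_mul, Equiv.Perm.sign_swap, Equiv.Perm.sign_swap]
    · simp
    · intro h; have := congrArg Fin.val h; simp at this
    · intro h; have := congrArg Fin.val h; simp at this
  have hA : ∀ i : Fin k, π (Fin.castAdd 2 (Fin.castAdd 2 i)) = Fin.castAdd 2 (Fin.castAdd 2 i) := by
    intro i
    have hi := i.isLt
    rw [Equiv.Perm.mul_apply,
      Equiv.swap_apply_of_ne_of_ne (x := Fin.castAdd 2 (Fin.castAdd 2 i)),
      Equiv.swap_apply_of_ne_of_ne (x := Fin.castAdd 2 (Fin.castAdd 2 i))] <;>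
      (intro h; have := congrArg Fin.val h; simp only [Fin.val_castAdd, Fin.val_natAdd] at this; omega)
  have hB : ∀ i : Fin 2, π (Fin.castAdd 2 (Fin.natAdd k i)) = Fin.natAdd (k + 2) i := by
    intro i
    fin_cases i
    · simp only [π, Equiv.Perm.mul_apply]
      rw [Equiv.swap_apply_of_ne_of_ne (a := Fin.castAdd 2 (Fin.natAdd k 1))]
      · exact Equiv.swap_apply_left _ _
      all_goals (intro h; have := congrArg Fin.val h; simp at this)
      omega
    · simp only [π, Equiv.Perm.mul_apply]
      refine (congrArg _ (Equiv.swap_apply_left _ _)).trans ?_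
      rw [Equiv.swap_apply_of_ne_of_ne]
      · rfl
      all_goals (intro h; have := congrArg Fin.val h; simp at this)
      try omega
  have hC : ∀ i : Fin 2, π (Fin.natAdd (k + 2) i) = Fin.castAdd 2 (Fin.natAdd k i) := by
    intro i
    fin_cases i
    · simp only [π, Equiv.Perm.mul_apply]
      rw [Equiv.swap_apply_of_ne_of_ne (a := Fin.castAdd 2 (Fin.natAdd k 1))]
      · exact Equiv.swap_apply_right _ _
      all_goals (intro h; have := congrArg Fin.val h; simp at this)
      try omega
    · simp only [π, Equiv.Perm.mul_apply]
      refine (congrArg _ (Equiv.swap_apply_right _ _)).trans ?_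
      rw [Equiv.swap_apply_of_ne_of_ne]
      · rfl
      all_goals (intro h; have := congrArg Fin.val h; simp at this)
      try omega
  rw [← Equiv.sum_comp (Equiv.mulRight π)]
  refine Finset.sum_congr rfl fun σ _ => ?_
  simp only [Equiv.coe_mulRight, Equiv.Perm.sign_mul, hsign, mul_one, Equiv.Perm.mul_apply, hA,
    hB, hC]
  ring

/-- Since `wedgeTwo` is built from the right, an exchange of the last two factors is
`wedge_wedge_swap`; any other adjacent exchange leaves the last factor alone and is covered by
induction. -/
theorem wedgeTwo_comp_swap_adjacent : ∀ (k : ℕ) (i : Fin k) (W : Fin (k + 1) → Form V 2),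
    wedgeTwo (k + 1) (fun a => W (Equiv.swap i.castSucc i.succ a)) = wedgeTwo (k + 1) W
  | k + 1, i, W => by
    induction i using Fin.lastCases with
    | last =>
      have h0 : ∀ a : Fin k, Equiv.swap (Fin.last k).castSucc (Fin.last k).succ
          a.castSucc.castSucc = a.castSucc.castSucc := fun a => by
        have ha := a.isLt
        rw [Equiv.swap_apply_of_ne_of_ne] <;> simp [Fin.ext_iff] <;> omega
      have h1 : Equiv.swap (Fin.last k).castSucc (Fin.last k).succ (Fin.last (k + 1)) =
          (Fin.last k).castSucc := by
        rw [← Fin.succ_last]; exact Equiv.swap_apply_right _ _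
      have h2 : Equiv.swap (Fin.last k).castSucc (Fin.last k).succ (Fin.last k).castSucc =
          Fin.last (k + 1) := by
        rw [← Fin.succ_last]; exact Equiv.swap_apply_left _ _
      simp only [wedgeTwo, h0, h1, h2]
      exact wedge_wedge_swap _ _ _
    | cast i =>
      have h0 : ∀ a : Fin (k + 1), Equiv.swap i.castSucc.castSucc i.castSucc.succ a.castSucc =
          (Equiv.swap i.castSucc i.succ a).castSucc := fun a => by
        rw [← Fin.castSucc_succ]
        exact (Fin.castSucc_injective _).swap_apply _ _ _
      have h1 : Equiv.swap i.castSucc.castSucc i.castSucc.succ (Fin.last (k + 1)) =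
          Fin.last (k + 1) := by
        have hi := i.isLt
        rw [Equiv.swap_apply_of_ne_of_ne] <;> simp [Fin.ext_iff] <;> omega
      rw [wedgeTwo]
      simp only [h0, h1]
      rw [wedgeTwo_comp_swap_adjacent k i fun a => W a.castSucc]
      rfl

/-- Two-forms commute. -/
theorem wedgeTwo_comp_perm : ∀ (k : ℕ) (σ : Equiv.Perm (Fin k)) (W : Fin k → Form V 2),
    wedgeTwo k (fun a => W (σ a)) = wedgeTwo k W
  | 0, σ, W => rfl
  | k + 1, σ, W => by
    -- Adjacent transpositions generate the symmetric group, even as a monoid.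
    have hσ : σ ∈ Submonoid.closure
        (Set.range fun i : Fin k => Equiv.swap i.castSucc i.succ) := by
      rw [Equiv.Perm.mclosure_swap_castSucc_succ]; trivial
    induction hσ using Submonoid.closure_induction generalizing W with
    | mem x hx =>
      obtain ⟨i, rfl⟩ := hx
      exact wedgeTwo_comp_swap_adjacent k i W
    | one => rfl
    | mul x y _ _ hx hy => exact (hy fun a => W (x a)).trans (hx W)

/-! ### Differentiation -/

theorem hasDerivAt_wedge {k l : ℕ} {a : ℝ → Form V k} {b : ℝ → Form V l} {a' : Form V k}
    {b' : Form V l} {t : ℝ} (ha : HasDerivAt a a' t) (hb : HasDerivAt b b' t) :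
    HasDerivAt (fun t => wedge (a t) (b t)) (wedge a' (b t) + wedge (a t) b') t := by
  have := ((wedgeL V k l).isBoundedBilinearMap.hasFDerivAt (a t, b t)).comp_hasDerivAt t
    (ha.prodMk hb)
  exact this.congr_deriv (add_comm _ _)

theorem hasDerivAt_wedgeTwo : ∀ (k : ℕ) {W : ℝ → Fin k → Form V 2} {W' : Fin k → Form V 2}
    {t : ℝ}, (∀ a, HasDerivAt (fun t => W t a) (W' a) t) →
    HasDerivAt (fun t => wedgeTwo k (W t))
      (∑ a, wedgeTwo k (Function.update (W t) a (W' a))) t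
  | 0, W, W', t, _ => by
    rw [Finset.univ_eq_empty, Finset.sum_empty]
    exact hasDerivAt_const t (wedgeTwo 0 (W t))
  | k + 1, W, W', t, h => by
    have := hasDerivAt_wedge (hasDerivAt_wedgeTwo k (W := fun t a => W t a.castSucc)
      (fun a => h a.castSucc)) (h (Fin.last k))
    rw [wedge_sum_left] at this
    rw [Fin.sum_univ_castSucc]
    refine this.congr_deriv ?_
    congr 1
    · refine Finset.sum_congr rfl fun a _ => ?_
      symm
      rw [wedgeTwo, Function.update_of_ne (Fin.castSucc_lt_last a).ne']
      congr 2
      ext1 b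
      by_cases hb : b = a
      · subst hb; simp
      · rw [Function.update_of_ne hb, Function.update_of_ne]
        exact fun hh => hb (Fin.castSucc_injective _ hh)
    · symm
      rw [wedgeTwo, Function.update_self]
      congr 2
      ext1 b
      rw [Function.update_of_ne (Fin.castSucc_lt_last b).ne]

theorem contDiffAt_wedge {k l : ℕ} {a : U → Form V k} {b : U → Form V l} {x : U}
    {p : WithTop ℕ∞} (ha : ContDiffAt ℝ p a x) (hb : ContDiffAt ℝ p b x) :
    ContDiffAt ℝ p (fun x => wedge (a x) (b x)) x :=
  ((wedgeL V k l).isBoundedBilinearMap.contDiff.contDiffAt (x := (a x, b x))).comp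
    (f := fun x => (a x, b x)) x (ha.prodMk hb)

theorem contDiffAt_wedgeOne {x : U} {p : WithTop ℕ∞} : ∀ (k : ℕ) {W : U → Fin k → Form V 1},
    (∀ a, ContDiffAt ℝ p (fun x => W x a) x) → ContDiffAt ℝ p (fun x => wedgeOne k (W x)) x
  | 0, _, _ => contDiffAt_const
  | k + 1, _, h =>
    contDiffAt_wedge (contDiffAt_wedgeOne k fun a => h a.castSucc) (h (Fin.last k))

theorem contDiffAt_wedgeTwo {x : U} {p : WithTop ℕ∞} : ∀ (k : ℕ) {W : U → Fin k → Form V 2},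
    (∀ a, ContDiffAt ℝ p (fun x => W x a) x) → ContDiffAt ℝ p (fun x => wedgeTwo k (W x)) x
  | 0, _, _ => contDiffAt_const
  | k + 1, _, h =>
    contDiffAt_wedge (contDiffAt_wedgeTwo k fun a => h a.castSucc) (h (Fin.last k))

theorem wedge_one_one_apply (a b : Form V 1) (v : Fin 2 → V) :
    wedge a b v = a (fun _ => v 0) * b (fun _ => v 1) - a (fun _ => v 1) * b (fun _ => v 0) := by
  rw [wedge_apply, show (Finset.univ : Finset (Equiv.Perm (Fin (1 + 1)))) =
    {1, Equiv.swap (0 : Fin 2) 1} from by decide, Finset.sum_pair (by decide)]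
  have e0 : ∀ i : Fin 1, Fin.castAdd 1 i = (0 : Fin 2) := by decide
  have e1 : ∀ i : Fin 1, Fin.natAdd 1 i = (1 : Fin 2) := by decide
  simp only [e0, e1]
  simp
  ring

end Forms

/-! ### Algebra of the Lovelock forms -/

/-! ### The Levi-Civita symbol and its concatenated indices -/

section LeviCivita

variable {m : ℕ}

theorem leviCivita_perm (σ : Equiv.Perm (Fin m)) :
    leviCivita σ = ((Equiv.Perm.sign σ : ℤ) : ℝ) := by
  have h : Equiv.ofBijective σ σ.bijective = σ := by ext; rfl
  rw [leviCivita, dif_pos σ.bijective, h]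

theorem leviCivita_of_not_bijective {f : Fin m → Fin m} (hf : ¬ Function.Bijective f) :
    leviCivita f = 0 := by
  rw [leviCivita, dif_neg hf]

theorem sum_leviCivita (G : (Fin m → Fin m) → ℝ) :
    ∑ f, leviCivita f * G f =
      ∑ σ : Equiv.Perm (Fin m), ((Equiv.Perm.sign σ : ℤ) : ℝ) * G σ := by
  symm
  refine Fintype.sum_of_injective (fun σ : Equiv.Perm (Fin m) => (σ : Fin m → Fin m))
    DFunLike.coe_injective _ _ (fun f hf => ?_) fun σ => by rw [leviCivita_perm]
  rw [leviCivita_of_not_bijective, zero_mul]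
  exact fun h => hf ⟨Equiv.ofBijective f h, rfl⟩

theorem leviCivita_comp_perm (f : Fin m → Fin m) (π : Equiv.Perm (Fin m)) :
    leviCivita (f ∘ π) = ((Equiv.Perm.sign π : ℤ) : ℝ) * leviCivita f := by
  by_cases hf : Function.Bijective f
  · obtain ⟨τ, rfl⟩ : ∃ τ : Equiv.Perm (Fin m), f = τ := ⟨Equiv.ofBijective f hf, rfl⟩
    rw [← Equiv.Perm.coe_mul, leviCivita_perm, leviCivita_perm, Equiv.Perm.sign_mul]
    push_cast
    ring
  · rw [leviCivita_of_not_bijective hf, leviCivita_of_not_bijective, mul_zero]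
    intro h
    apply hf
    have := h.comp π.symm.bijective
    rwa [Function.comp_assoc, Equiv.self_comp_symm, Function.comp_id] at this

/-- The left side is the determinant of `h` with its columns chosen by `g`: a permutation of columns
costs a sign, a repeated column gives zero. -/
theorem sum_leviCivita_mul_prod (h : Fin m → Fin m → ℝ) (g : Fin m → Fin m) :
    ∑ f : Fin m → Fin m, leviCivita f * ∏ x, h (f x) (g x) = (Matrix.of h).det * leviCivita g := by
  rw [sum_leviCivita]
  have h1 : ∑ σ : Equiv.Perm (Fin m), ((Equiv.Perm.sign σ : ℤ) : ℝ) * ∏ x, h (σ x) (g x) =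
      ((Matrix.of h).submatrix id g).det := by
    rw [Matrix.det_apply']; rfl
  rw [h1]
  by_cases hg : Function.Bijective g
  · obtain ⟨τ, rfl⟩ : ∃ τ : Equiv.Perm (Fin m), g = τ := ⟨Equiv.ofBijective g hg, rfl⟩
    rw [Matrix.det_permute', leviCivita_perm, mul_comm]
  · rw [leviCivita_of_not_bijective hg, mul_zero]
    have hg' : ¬ Function.Injective g := fun h => hg (Finite.injective_iff_bijective.1 h)
    simp only [Function.Injective, not_forall] at hg'
    obtain ⟨i, j, hij, hne⟩ := hg'
    exact Matrix.det_zero_of_column_eq hne fun k => by simp [hij]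

/-- The positions in a multi-index `i₁ … i_r j₁ … j_r s₁ … s_{m-2r}`. -/
def indexEquiv {r : ℕ} (hr : r + r ≤ m) : (Fin r ⊕ Fin r) ⊕ Fin (m - (r + r)) ≃ Fin m :=
  (Equiv.sumCongr finSumFinEquiv (Equiv.refl _)).trans
    (finSumFinEquiv.trans (finCongr (Nat.add_sub_cancel' hr)))

/-- Passing from positions in `Fin m` to a sum of three blocks lets sums, products and permutations
of indices be treated blockwise. -/
theorem concat_append {r : ℕ} (hr : r + r ≤ m) (I K : Fin r → Fin m)
    (s : Fin (m - (r + r)) → Fin m) :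
    concat (Fin.append I K) s = Sum.elim (Sum.elim I K) s ∘ (indexEquiv hr).symm := by
  rw [← (indexEquiv hr).symm.comp_symm_eq]
  ext x
  congr 1
  rcases x with (x | x) | x
  · have hx : (x : ℕ) < r + r := by omega
    have : (⟨x, hx⟩ : Fin (r + r)) = Fin.castAdd r x := rfl
    simp [concat, indexEquiv, hx, this]
  · have : ∀ h, Fin.append I K ⟨x + r, h⟩ = K x := fun h => by
      have e : (⟨x + r, h⟩ : Fin (r + r)) = Fin.natAdd r x := by ext; simp [add_comm]
      rw [e, Fin.append_right]
    simpa [concat, indexEquiv] using this (by omega)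
  · simp [concat, indexEquiv]

end LeviCivita

/-! ### The Lovelock form of an arbitrary coframe and curvature: invariance and derivative -/

section Lagrangian

variable {V : Type*} [NormedAddCommGroup V] [NormedSpace ℝ V] {m : ℕ}

/-- The Sparling forms of a coframe. -/
def sparlingForm {p : ℕ} (θ : Fin m → Form V 1) (I : Fin p → Fin m) : Form V (m - p) :=
  (1 / ((m - p).factorial : ℝ)) • ∑ s : Fin (m - p) → Fin m,
    leviCivita (concat I s) • wedgeOne (m - p) fun a => θ (s a)

/-- The Lovelock form `θ_{I J} ∧ W^{i₁ j₁} ∧ ⋯ ∧ W^{i_r j_r}`. -/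
def lagForm (r : ℕ) (θ : Fin m → Form V 1) (W : Fin m → Fin m → Form V 2) :
    Form V ((m - (r + r)) + 2 * r) :=
  ∑ I : Fin r → Fin m, ∑ K : Fin r → Fin m,
    wedge (sparlingForm θ (Fin.append I K)) (wedgeTwo r fun a => W (I a) (K a))

/-- The polarized Lovelock form `θ_{I J} ∧ D^{i₁ j₁} ∧ W^{i₂ j₂} ∧ ⋯ ∧ W^{i_r j_r}`. -/
def lagFormPolar (n : ℕ) (θ : Fin m → Form V 1) (W D : Fin m → Fin m → Form V 2) :
    Form V ((m - (n + 1 + (n + 1))) + 2 * (n + 1)) :=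
  ∑ I : Fin (n + 1) → Fin m, ∑ K : Fin (n + 1) → Fin m,
    wedge (sparlingForm θ (Fin.append I K))
      (wedgeTwo (n + 1) (Fin.cons (D (I 0) (K 0)) fun a => W (I a.succ) (K a.succ)))

/-- The form `θ_{i₁ … i_r j j₂ … j_r} ∧ C^{i₁}_l ∧ W^{i₂ j₂} ∧ ⋯ ∧ W^{i_r j_r}`. -/
def fieldFormOf (n : ℕ) (θ : Fin m → Form V 1) (W C : Fin m → Fin m → Form V 2) (j l : Fin m) :
    Form V ((m - (n + 1 + (n + 1))) + 2 * (n + 1)) :=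
  ∑ I : Fin (n + 1) → Fin m, ∑ K : Fin n → Fin m,
    wedge (sparlingForm θ (Fin.append I (Fin.cons j K : Fin (n + 1) → Fin m)))
      (wedgeTwo (n + 1) (Fin.cons (C (I 0) l) fun a => W (I a.succ) (K a)))

theorem lagForm_eq_polar (n : ℕ) (θ : Fin m → Form V 1) (W : Fin m → Fin m → Form V 2) :
    lagForm (n + 1) θ W = lagFormPolar n θ W W := by
  refine Finset.sum_congr rfl fun I _ => Finset.sum_congr rfl fun K _ => ?_
  congr 2
  ext1 a
  induction a using Fin.cases <;> rfl

/-- Linearity in the first factor. As the product is built from the right, the first factor is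
reached by induction on the number of factors after it. -/
theorem wedgeTwo_cons_sum {ι : Type*} {n : ℕ} (s : Finset ι) (c : ι → ℝ) (D : ι → Form V 2)
    (W : Fin n → Form V 2) :
    wedgeTwo (n + 1) (Fin.cons (∑ i ∈ s, c i • D i) W) =
      ∑ i ∈ s, c i • wedgeTwo (n + 1) (Fin.cons (D i) W) := by
  induction n with
  | zero =>
    simp only [wedgeTwo]
    have e : Fin.last 0 = 0 := rfl
    simp only [e, Fin.cons_zero, wedge_sum_right, wedge_smul_right]
  | succ n ih =>
    have key : ∀ x : Form V 2, wedgeTwo (n + 1 + 1) (Fin.cons x W) =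
        wedge (wedgeTwo (n + 1) (Fin.cons x fun a : Fin n => W a.castSucc)) (W (Fin.last n)) := by
      intro x
      have : (fun a : Fin (n + 1) => (Fin.cons x W : Fin (n + 2) → Form V 2) a.castSucc) =
          Fin.cons x fun a => W a.castSucc := by
        ext1 a
        induction a using Fin.cases <;> rfl
      exact congrArg₂ wedge (congrArg _ this) rfl
    simp only [key, ih, wedge_sum_left, wedge_smul_left]

/-- Isolates the index `j₁` and expands the first factor, so that the polarized form becomes a
combination of the forms that occur in the field equations. -/
theorem lagFormPolar_eq_sum (n : ℕ) (θ : Fin m → Form V 1) (W C : Fin m → Fin m → Form V 2)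
    (Y : Fin m → Fin m → ℝ) :
    lagFormPolar n θ W (fun i j => ∑ l, Y l j • C i l) =
      ∑ j, ∑ l, Y l j • fieldFormOf n θ W C j l := by
  simp only [lagFormPolar, fieldFormOf, wedgeTwo_cons_sum, wedge_sum_right, wedge_smul_right,
    Finset.smul_sum]
  have h1 : ∀ T : (Fin (n + 1) → Fin m) → Form V
      ((m - (n + 1 + (n + 1))) + 2 * (n + 1)), ∑ K, T K =
      ∑ j : Fin m, ∑ K : Fin n → Fin m, T (Fin.cons j K) := by
    intro T
    rw [← (Fin.consEquiv fun _ : Fin (n + 1) => Fin m).sum_comp, Fintype.sum_prod_type]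
    rfl
  rw [Finset.sum_congr rfl fun I _ => h1 _, Finset.sum_comm]
  apply Finset.sum_congr rfl
  intro j _
  conv_rhs => rw [Finset.sum_comm]
  apply Finset.sum_congr rfl
  intro I _
  conv_rhs => rw [Finset.sum_comm]
  rfl

/-- The Lovelock form is a relative invariant of the general linear group. -/
theorem lagForm_transform {r : ℕ} (hr : r + r ≤ m) (θ : Fin m → Form V 1)
    (W : Fin m → Fin m → Form V 2) (h : Fin m → Fin m → ℝ) :
    lagForm r (fun i => ∑ b, h i b • θ b)
      (fun i j => ∑ p : Fin m × Fin m, (h i p.1 * h j p.2) • W p.1 p.2) =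
      (Matrix.of h).det • lagForm r θ W := by
  let B : (Fin r → Fin m) → (Fin r → Fin m) → (Fin (m - (r + r)) → Fin m) →
      Form V ((m - (r + r)) + 2 * r) := fun I K s =>
    wedge (wedgeOne (m - (r + r)) fun a => θ (s a)) (wedgeTwo r fun a => W (I a) (K a))
  let c : ℝ := 1 / ((m - (r + r)).factorial : ℝ)
  have hR : lagForm r θ W = c • ∑ I, ∑ K, ∑ s, leviCivita (concat (Fin.append I K) s) • B I K s := by
    simp only [lagForm, sparlingForm, wedge_smul_left, wedge_sum_left, Finset.smul_sum, B, c]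
  have e2 : ∀ T : (Fin r → Fin m × Fin m) → Form V (2 * r),
      ∑ P, T P = ∑ I : Fin r → Fin m, ∑ K : Fin r → Fin m, T fun a => (I a, K a) := by
    intro T
    rw [← (Equiv.arrowProdEquivProdArrow (Fin r) (fun _ => Fin m) fun _ => Fin m).symm.sum_comp,
      Fintype.sum_prod_type]
    rfl
  -- Every factor is expanded in the old basis; the primed indices label the old forms.
  have hL : lagForm r (fun i => ∑ b, h i b • θ b)
      (fun i j => ∑ p : Fin m × Fin m, (h i p.1 * h j p.2) • W p.1 p.2) =
      c • ∑ I, ∑ K, ∑ s, ∑ I', ∑ K', ∑ s', (leviCivita (concat (Fin.append I K) s) *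
        ((∏ a, h (I a) (I' a)) * (∏ a, h (K a) (K' a)) * ∏ a, h (s a) (s' a))) • B I' K' s' := by
    simp only [lagForm, sparlingForm, wedge_smul_left, wedge_sum_left, Finset.smul_sum, B, c]
    refine Finset.sum_congr rfl fun I _ => Finset.sum_congr rfl fun K _ =>
      Finset.sum_congr rfl fun s _ => ?_
    rw [wedgeOne_sum, wedgeTwo_sum _ (fun a (p : Fin m × Fin m) => h (I a) p.1 * h (K a) p.2)
      (fun _ p => W p.1 p.2), e2]
    simp only [wedge_sum_left, wedge_sum_right, wedge_smul_left, wedge_smul_right,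
      Finset.smul_sum, smul_smul]
    refine Finset.sum_congr rfl fun I' _ => Finset.sum_congr rfl fun K' _ =>
      Finset.sum_congr rfl fun s' _ => ?_
    congr 1
    rw [Finset.prod_mul_distrib]
  rw [hL, hR, smul_comm]
  congr 1
  have h3 : ∀ (T : (Fin r → Fin m) → (Fin r → Fin m) →
      (Fin (m - (r + r)) → Fin m) → Form V ((m - (r + r)) + 2 * r)), ∑ I, ∑ K, ∑ s, T I K s =
      ∑ P : ((Fin r → Fin m) × (Fin r → Fin m)) × (Fin (m - (r + r)) → Fin m),
        T P.1.1 P.1.2 P.2 := by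
    intro T
    rw [Fintype.sum_prod_type, Fintype.sum_prod_type]
  simp only [h3, Finset.smul_sum, smul_smul]
  -- With the old indices fixed, what remains is a scalar identity: the sum over the new indices,
  -- merged into one map `Fin m → Fin m`, is `det h` times the symbol of the old ones.
  rw [Finset.sum_comm]
  refine Finset.sum_congr rfl fun P' _ => ?_
  rw [← Finset.sum_smul]
  congr 1
  obtain ⟨⟨I', K'⟩, s'⟩ := P'
  rw [← sum_leviCivita_mul_prod]
  let E : ((Fin r → Fin m) × (Fin r → Fin m)) × (Fin (m - (r + r)) → Fin m) ≃ (Fin m → Fin m) :=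
    ((Equiv.prodCongr (Equiv.sumArrowEquivProdArrow _ _ _).symm (Equiv.refl _)).trans
      (Equiv.sumArrowEquivProdArrow _ _ _).symm).trans
      (Equiv.arrowCongr (indexEquiv hr) (Equiv.refl _))
  have hE : ∀ P, E P = concat (Fin.append P.1.1 P.1.2) P.2 := by
    intro P
    rw [concat_append hr]
    rfl
  rw [← E.sum_comp]
  refine Finset.sum_congr rfl fun P _ => ?_
  rw [hE]
  congr 1
  rw [concat_append hr, concat_append hr, ← (indexEquiv hr).prod_comp]
  simp [Fintype.prod_sum_type]

/-- The permutation acts once on the block `I` and once on the block `K`, so its sign enters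
squared. -/
theorem sparlingForm_append_perm {r : ℕ} (hr : r + r ≤ m) (θ : Fin m → Form V 1)
    (I K : Fin r → Fin m) (σ : Equiv.Perm (Fin r)) :
    sparlingForm θ (Fin.append (I ∘ σ) (K ∘ σ)) = sparlingForm θ (Fin.append I K) := by
  simp only [sparlingForm]
  congr 1
  refine Finset.sum_congr rfl fun s _ => ?_
  congr 1
  let π : Equiv.Perm (Fin m) := (indexEquiv hr).permCongr
    (Equiv.Perm.sumCongr (Equiv.Perm.sumCongr σ σ) 1)
  have hπ : concat (Fin.append (I ∘ σ) (K ∘ σ)) s = concat (Fin.append I K) s ∘ π := by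
    rw [concat_append hr, concat_append hr]
    ext y
    obtain ⟨x, rfl⟩ := (indexEquiv hr).surjective y
    rcases x with (x | x) | x <;> simp [π, Equiv.permCongr_apply]
  have hs : Equiv.Perm.sign π = 1 := by
    simp only [π, Equiv.Perm.sign_permCongr, Equiv.Perm.sign_sumCongr, Int.units_mul_self,
      map_one, mul_one]
  rw [hπ, leviCivita_comp_perm, hs]
  simp

/-- Renaming the summation indices by the transposition of `0` and `a` brings the distinguished slot
to the front. The Sparling form is unchanged because both blocks are permuted alike, and the wedge
product because two-forms commute. -/
theorem lagForm_slot (n : ℕ) (hr : n + 1 + (n + 1) ≤ m) (θ : Fin m → Form V 1)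
    (W D : Fin m → Fin m → Form V 2) (a : Fin (n + 1)) :
    ∑ I : Fin (n + 1) → Fin m, ∑ K : Fin (n + 1) → Fin m,
      wedge (sparlingForm θ (Fin.append I K))
        (wedgeTwo (n + 1) (Function.update (fun b => W (I b) (K b)) a (D (I a) (K a)))) =
      lagFormPolar n θ W D := by
  let σ : Equiv.Perm (Fin (n + 1)) := Equiv.swap 0 a
  let e : (Fin (n + 1) → Fin m) ≃ (Fin (n + 1) → Fin m) := Equiv.arrowCongr σ (Equiv.refl _)
  have he : ∀ I, e I = I ∘ σ := fun I => by
    ext b; simp [e, σ, Equiv.arrowCongr]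
  rw [← e.sum_comp, lagFormPolar]
  refine Finset.sum_congr rfl fun I _ => ?_
  rw [← e.sum_comp]
  refine Finset.sum_congr rfl fun K _ => ?_
  rw [he, he, sparlingForm_append_perm hr]
  congr 1
  refine Eq.trans ?_ (wedgeTwo_comp_perm (n + 1) σ _)
  congr 1
  ext1 b
  by_cases hb : b = a
  · subst hb
    simp [σ]
  · rw [Function.update_of_ne hb]
    have h0 : σ b ≠ 0 := fun h => hb (by
      have := congrArg σ h
      simpa [σ] using this)
    obtain ⟨k, hk⟩ := Fin.exists_succ_eq.2 h0
    rw [← hk, Fin.cons_succ, hk]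
    rfl

/-- By the Leibniz rule there is one term per curvature factor, and `lagForm_slot` makes the `n + 1`
terms equal. -/
theorem hasDerivAt_lagForm (n : ℕ) (hr : n + 1 + (n + 1) ≤ m) (θ : Fin m → Form V 1)
    {W : ℝ → Fin m → Fin m → Form V 2} {W' : Fin m → Fin m → Form V 2} {t : ℝ}
    (h : ∀ i j, HasDerivAt (fun t => W t i j) (W' i j) t) :
    HasDerivAt (fun t => lagForm (n + 1) θ (W t))
      (((n : ℝ) + 1) • lagFormPolar n θ (W t) W') t := by
  have key : HasDerivAt (fun t => lagForm (n + 1) θ (W t))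
      (∑ I : Fin (n + 1) → Fin m, ∑ K : Fin (n + 1) → Fin m,
        wedge (sparlingForm θ (Fin.append I K)) (∑ a, wedgeTwo (n + 1)
          (Function.update (fun b => W t (I b) (K b)) a (W' (I a) (K a))))) t := by
    refine HasDerivAt.fun_sum fun I _ => HasDerivAt.fun_sum fun K _ => ?_
    exact (wedgeL V _ _ (sparlingForm θ (Fin.append I K))).hasFDerivAt.comp_hasDerivAt t
      (hasDerivAt_wedgeTwo (n + 1) (W := fun t b => W t (I b) (K b)) fun a => h (I a) (K a))
  refine key.congr_deriv ?_
  simp only [wedge_sum_right]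
  simp_rw [Finset.sum_comm (s := (Finset.univ : Finset (Fin (n + 1) → Fin m)))
    (t := (Finset.univ : Finset (Fin (n + 1))))]
  rw [Finset.sum_congr rfl fun a _ => lagForm_slot n hr θ (W t) W' a, Finset.sum_const,
    Finset.card_univ, Fintype.card_fin, ← Nat.cast_smul_eq_nsmul ℝ]
  push_cast
  rfl

end Lagrangian

/-! ### The canonical forms in coordinates -/

section Coordinates

variable {m : ℕ}

/-- The `(i, j)` matrix entry of an endomorphism of `ℝ^m`. -/
def entry (i j : Fin m) : (E m →L[ℝ] E m) →L[ℝ] ℝ :=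
  (coordFn i).comp (ContinuousLinearMap.apply ℝ (E m) (basisVec j))

theorem entry_apply (i j : Fin m) (A : E m →L[ℝ] E m) :
    entry i j A = coordFn i (A (basisVec j)) := rfl

theorem coordFn_basisVec (i j : Fin m) : coordFn i (basisVec j) = if i = j then 1 else 0 := by
  simp [coordFn, basisVec]

theorem sum_coordFn_smul (v : E m) : ∑ k, coordFn k v • basisVec k = v := by
  ext i
  simp [coordFn, basisVec, Pi.single_apply]

theorem sum_entry_mul_coordFn (i : Fin m) (A : E m →L[ℝ] E m) (v : E m) :
    ∑ k, entry i k A * coordFn k v = coordFn i (A v) := by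
  conv_rhs => rw [← sum_coordFn_smul v]
  simp [entry_apply, mul_comm]

theorem sum_entry_mul_entry (i j : Fin m) (A B : E m →L[ℝ] E m) :
    ∑ k, entry i k A * entry k j B = entry i j (A * B) :=
  sum_entry_mul_coordFn i A (B (basisVec j))

/-- The matrix of an endomorphism of `ℝ^m`. -/
def mat (A : E m →L[ℝ] E m) : Matrix (Fin m) (Fin m) ℝ := Matrix.of fun i j => entry i j A

theorem mat_apply (A : E m →L[ℝ] E m) (i j : Fin m) : mat A i j = entry i j A := rfl

theorem mat_mul (A B : E m →L[ℝ] E m) : mat (A * B) = mat A * mat B := by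
  ext i j
  rw [Matrix.mul_apply]
  exact (sum_entry_mul_entry i j A B).symm

theorem mat_one : mat (1 : E m →L[ℝ] E m) = 1 := by
  ext i j
  rw [mat_apply, entry_apply, one_apply_eq_self, coordFn_basisVec, Matrix.one_apply]

theorem mat_add (A B : E m →L[ℝ] E m) : mat (A + B) = mat A + mat B := by
  ext i j
  simp [mat_apply]

theorem mat_smul (c : ℝ) (A : E m →L[ℝ] E m) : mat (c • A) = c • mat A := by
  ext i j
  simp [mat_apply]

theorem eq_of_mat_eq {A B : E m →L[ℝ] E m} (h : mat A = mat B) : A = B := by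
  ext v i
  have h1 := sum_entry_mul_coordFn i A v
  have h2 := sum_entry_mul_coordFn i B v
  have h3 : ∀ k, entry i k A = entry i k B := fun k => congrFun (congrFun h i) k
  simp only [h3] at h1
  exact h1.symm.trans h2

theorem eta_transpose : (eta m).transpose = eta m := Matrix.diagonal_transpose _

theorem eta_symm (i j : Fin m) : eta m i j = eta m j i :=
  congrFun (congrFun eta_transpose j) i

/-- The connection form with values in the endomorphisms of `ℝ^m`. -/
def omegaEnd (q v : J m) : E m →L[ℝ] E m :=
  Ring.inverse q.2.1 * (v.2.1 + q.2.2 v.1 * q.2.1)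

theorem theta_apply (i : Fin m) (q : J m) (v : Fin 1 → J m) :
    theta i q v = coordFn i (Ring.inverse q.2.1 (v 0).1) := rfl

theorem omega_apply (i j : Fin m) (q : J m) (v : Fin 1 → J m) :
    omega i j q v = entry i j (omegaEnd q (v 0)) := rfl

/-- The curvature of the connection with coefficients `Γ`. -/
def curvEnd (q u v : J m) : E m →L[ℝ] E m :=
  u.2.2 v.1 - v.2.2 u.1 + (q.2.2 u.1 * q.2.2 v.1 - q.2.2 v.1 * q.2.2 u.1)

/-- The coordinate `Γ` as a linear functional. -/
def dGamma (m : ℕ) : J m →L[ℝ] (E m →L[ℝ] E m →L[ℝ] E m) :=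
  ((ContinuousLinearMap.snd ℝ (E m →L[ℝ] E m) (E m →L[ℝ] E m →L[ℝ] E m)).comp
    (ContinuousLinearMap.snd ℝ (E m) ((E m →L[ℝ] E m) × (E m →L[ℝ] E m →L[ℝ] E m))) :)

theorem de_apply (q : J m) : de m q = q.2.1 := rfl
theorem dGamma_apply (q : J m) : dGamma m q = q.2.2 := rfl

theorem contDiffAt_inverse_frame {q : J m} (hq : IsUnit q.2.1) {p : WithTop ℕ∞} :
    ContDiffAt ℝ p (fun q : J m => Ring.inverse q.2.1) q := by
  obtain ⟨u, hu⟩ := hq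
  have h1 : ContDiffAt ℝ p Ring.inverse (de m q) := by
    rw [de_apply, ← hu]; exact contDiffAt_ringInverse ℝ u
  exact h1.comp q (de m).contDiff.contDiffAt

theorem contDiffAt_oneForm {W : Type*} [NormedAddCommGroup W] [NormedSpace ℝ W] {p : WithTop ℕ∞}
    {f : W → (J m →L[ℝ] ℝ)} {x : W} (hf : ContDiffAt ℝ p f x) :
    ContDiffAt ℝ p (fun x => oneForm (f x)) x :=
  (ContinuousAlternatingMap.ofSubsingletonLIE (𝕜 := ℝ) (E := J m) (F := ℝ)
    (0 : Fin 1)).toContinuousLinearEquiv.contDiff.contDiffAt.comp x hf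

theorem contDiffAt_theta (i : Fin m) {q : J m} (hq : IsUnit q.2.1) {p : WithTop ℕ∞} :
    ContDiffAt ℝ p (theta i) q :=
  contDiffAt_oneForm <| contDiffAt_const.clm_comp <|
    (contDiffAt_inverse_frame hq).clm_comp contDiffAt_const

theorem contDiffAt_omega (i j : Fin m) {q : J m} (hq : IsUnit q.2.1) {p : WithTop ℕ∞} :
    ContDiffAt ℝ p (omega i j) q := by
  refine contDiffAt_oneForm <| contDiffAt_const.clm_comp <|
    (contDiffAt_inverse_frame hq).clm_comp <| contDiffAt_const.add ?_
  have h : ContDiffAt ℝ p (fun q : J m => q.2.1 (basisVec j)) q :=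
    (de m).contDiff.contDiffAt.clm_apply contDiffAt_const
  have h' : ContDiffAt ℝ p (fun q : J m => q.2.2.comp (dx m)) q :=
    (dGamma m).contDiff.contDiffAt.clm_comp contDiffAt_const
  exact ((ContinuousLinearMap.flipₗᵢ ℝ (J m) (E m)
    (E m)).toContinuousLinearEquiv.contDiff.contDiffAt.comp q h').clm_apply h

theorem contDiffAt_extDeriv {V : Type*} [NormedAddCommGroup V] [NormedSpace ℝ V] {k : ℕ}
    {α : V → Form V k} {x : V} (h : ContDiffAt ℝ ∞ α x) :
    ContDiffAt ℝ ∞ (extDeriv α) x :=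
  ContDiffAt.comp (g := ContinuousAlternatingMap.alternatizeUncurryFinCLM ℝ V ℝ (n := k)) x
    (ContinuousLinearMap.contDiff _).contDiffAt (h.fderiv_right (m := ∞) (by simp))

theorem contDiffAt_curv (i j : Fin m) {q : J m} (hq : IsUnit q.2.1) :
    ContDiffAt ℝ ∞ (curv i j) q :=
  (contDiffAt_extDeriv (contDiffAt_omega i j hq)).add <| ContDiffAt.sum fun k _ =>
    contDiffAt_wedge (contDiffAt_omega i k hq) (contDiffAt_omega k j hq)

theorem contDiffAt_curvUp (i j : Fin m) {q : J m} (hq : IsUnit q.2.1) :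
    ContDiffAt ℝ ∞ (curvUp i j) q :=
  ContDiffAt.sum fun l _ => (contDiffAt_const (c := eta m j l)).smul (contDiffAt_curv i l hq)

theorem contDiffAt_sparling {p : ℕ} (I : Fin p → Fin m) {q : J m} (hq : IsUnit q.2.1) :
    ContDiffAt ℝ ∞ (sparling I) q :=
  (contDiffAt_const (c := (1 / ((m - p).factorial : ℝ)))).smul <| ContDiffAt.sum fun s _ =>
    (contDiffAt_const (c := leviCivita (concat I s))).smul <|
    contDiffAt_wedgeOne _ fun a => contDiffAt_theta (s a) hq

theorem contDiffAt_lagrangian (n : ℕ) {q : J m} (hq : IsUnit q.2.1) :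
    ContDiffAt ℝ ∞ (lagrangian (m := m) n) q :=
  ContDiffAt.sum fun I _ => ContDiffAt.sum fun K _ =>
    contDiffAt_wedge (contDiffAt_sparling _ hq)
      (contDiffAt_wedgeTwo _ fun a => contDiffAt_curvUp (I a) (K a) hq)

/-- The first term comes from `d(e⁻¹) = -e⁻¹ de e⁻¹`, the second from the product rule for `Γ e`.
The vector `v` is held constant, as the coordinate formula for `dω` requires. -/
theorem hasFDerivAt_omegaEnd {q : J m} (hq : IsUnit q.2.1) (v : J m) :
    ∃ D : J m →L[ℝ] (E m →L[ℝ] E m), HasFDerivAt (fun q => omegaEnd q v) D q ∧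
      ∀ u, D u = -(Ring.inverse q.2.1 * u.2.1 * omegaEnd q v) +
        Ring.inverse q.2.1 * (u.2.2 v.1 * q.2.1 + q.2.2 v.1 * u.2.1) := by
  obtain ⟨e, he⟩ := hq
  have hinv : Ring.inverse q.2.1 = ↑e⁻¹ := by rw [← he, Ring.inverse_unit]
  obtain ⟨D, h1, h6⟩ : ∃ D : (E m →L[ℝ] E m) →L[ℝ] (E m →L[ℝ] E m),
      HasFDerivAt Ring.inverse D q.2.1 ∧
        ∀ A, D A = -(Ring.inverse q.2.1 * A * Ring.inverse q.2.1) := by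
    refine ⟨_, he ▸ hasFDerivAt_ringInverse (𝕜 := ℝ) e, fun A => ?_⟩
    rw [hinv]; rfl
  have h2 : HasFDerivAt (fun q : J m => Ring.inverse q.2.1) _ q :=
    HasFDerivAt.comp q (f := de m) h1 (de m).hasFDerivAt
  have h3 : HasFDerivAt (fun q : J m => q.2.2 v.1)
      ((ContinuousLinearMap.apply ℝ _ v.1).comp (dGamma m)) q :=
    ((ContinuousLinearMap.apply ℝ _ v.1).comp (dGamma m)).hasFDerivAt
  have h4 : HasFDerivAt (fun q : J m => q.2.1) (de m) q := (de m).hasFDerivAt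
  have h5 := h2.clm_comp ((h3.clm_comp h4).const_add v.2.1)
  refine ⟨_, h5, fun u => ?_⟩
  simp only [_root_.add_apply, ContinuousLinearMap.comp_apply, ContinuousLinearMap.compL_apply,
    ContinuousLinearMap.flip_apply, h6, de_apply, dGamma_apply, ContinuousLinearMap.apply_apply,
    ← ContinuousLinearMap.mul_def]
  rw [omegaEnd, neg_mul, add_comm, mul_assoc _ (Ring.inverse q.2.1), add_comm (_ * u.2.1)]

/-- The structure equation: in `dω + ω ∧ ω` all terms containing `de` cancel, and what is left is
`e⁻¹ (dΓ + Γ ∧ Γ) e`. Hence the curvature depends on the frame only by conjugation. -/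
theorem curv_apply (i j : Fin m) {q : J m} (hq : IsUnit q.2.1) (v : Fin 2 → J m) :
    curv i j q v =
      entry i j (Ring.inverse q.2.1 * curvEnd q (v 0) (v 1) * q.2.1) := by
  have hd : DifferentiableAt ℝ (omega i j) q :=
    (contDiffAt_omega i j hq (p := 1)).differentiableAt one_ne_zero
  have h1 : ∀ (w : Fin 1 → J m) (u : J m), fderiv ℝ (fun q => omega i j q w) q u =
      entry i j (-(Ring.inverse q.2.1 * u.2.1 * omegaEnd q (w 0)) +
        Ring.inverse q.2.1 * (u.2.2 (w 0).1 * q.2.1 + q.2.2 (w 0).1 * u.2.1)) := by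
    intro w u
    obtain ⟨D, hD, hD'⟩ := hasFDerivAt_omegaEnd hq (w 0)
    have : HasFDerivAt (fun q => omega i j q w) ((entry i j).comp D) q :=
      (entry i j).hasFDerivAt.comp q hD
    rw [this.fderiv, ContinuousLinearMap.comp_apply, hD']
  have h2 : ∀ k, wedge (omega i k q) (omega k j q) v =
      entry i k (omegaEnd q (v 0)) * entry k j (omegaEnd q (v 1)) -
        entry i k (omegaEnd q (v 1)) * entry k j (omegaEnd q (v 0)) := by
    intro k
    rw [wedge_one_one_apply]; rfl
  have h3 : (∑ k : Fin m, wedge (omega i k q) (omega k j q)) v =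
      ∑ k : Fin m, wedge (omega i k q) (omega k j q) v := by
    simp
  rw [curv, ContinuousAlternatingMap.add_apply, h3, Finset.sum_congr rfl fun k _ => h2 k,
    Finset.sum_sub_distrib, sum_entry_mul_entry, sum_entry_mul_entry, extDeriv_apply hd,
    Fin.sum_univ_two, h1, h1]
  have r0 : Fin.removeNth 0 v 0 = v 1 := rfl
  have r1 : Fin.removeNth 1 v 0 = v 0 := rfl
  rw [r0, r1]
  simp only [Fin.val_zero, pow_zero, one_smul, Fin.val_one, pow_one, neg_smul, ← map_neg, ← map_add,
    ← map_sub]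
  congr 1
  have e1 : q.2.1 * Ring.inverse q.2.1 = 1 := Ring.mul_inverse_cancel _ hq
  have e2 : ∀ A : E m →L[ℝ] E m, q.2.1 * (Ring.inverse q.2.1 * A) = A := fun A => by
    rw [← mul_assoc, e1, one_mul]
  simp only [omegaEnd, curvEnd, mul_add, add_mul, mul_assoc, mul_sub, sub_mul, e2, neg_add]
  abel

end Coordinates

/-! ### The derivative of the Lagrangian where the connection coefficients vanish -/

section Derivative

variable {m : ℕ}

theorem inverse_mul_of_isUnit {R : Type*} [Ring R] {a b : R} (ha : IsUnit a) (hb : IsUnit b) :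
    Ring.inverse (a * b) = Ring.inverse b * Ring.inverse a := by
  obtain ⟨u, rfl⟩ := ha
  obtain ⟨w, rfl⟩ := hb
  rw [← Units.val_mul, Ring.inverse_unit, Ring.inverse_unit, Ring.inverse_unit, mul_inv_rev,
    Units.val_mul]

theorem frame_add_smul {R : Type*} [Ring R] [Algebra ℝ R] {e : R} (he : IsUnit e) (v : R) (t : ℝ) :
    e + t • v = e * (1 + t • (Ring.inverse e * v)) := by
  rw [mul_add, mul_one, mul_smul_comm, ← mul_assoc, Ring.mul_inverse_cancel _ he, one_mul]

theorem zero_add_smul {W : Type*} [AddCommGroup W] [Module ℝ W] {a : W} (ha : a = 0) (b : W)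
    (t : ℝ) : a + t • b = t • b := by rw [ha, zero_add]

theorem quadratic_curvature_identity {R : Type*} [Ring R] [Algebra ℝ R] (f e P a b : R) (t : ℝ) :
    f * P * e + t ^ 2 • (f * (P + (a * b - b * a)) * e - f * P * e) =
      f * (P + ((t • a) * (t • b) - (t • b) * (t • a))) * e := by
  simp only [mul_add, add_mul, add_sub_cancel_left, ← smul_sub, mul_smul_comm, smul_mul_assoc,
    pow_two, mul_smul]

theorem eventually_isUnit_one_add_smul {R : Type*} [NormedRing R] [NormedAlgebra ℝ R]
    [CompleteSpace R] (x : R) : ∀ᶠ t : ℝ in 𝓝 0, IsUnit (1 + t • x) := by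
  have hc : ContinuousAt (fun t : ℝ => 1 + t • x) 0 := by fun_prop
  exact hc.eventually_mem (Units.isOpen.mem_nhds (by simp))

theorem lagrangian_eq_lagForm (n : ℕ) (q : J m) :
    lagrangian n q = lagForm (n + 1) (fun i => theta i q) fun i j => curvUp i j q := rfl

theorem fieldForm_eq_fieldFormOf (n : ℕ) (q : J m) (j l : Fin m) :
    fieldForm n j l q =
      fieldFormOf n (fun i => theta i q) (fun i j => curvUp i j q) (fun i j => curv i j q) j l :=
  rfl

theorem hasDerivAt_inv_det (A : Matrix (Fin m) (Fin m) ℝ) :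
    HasDerivAt (fun t : ℝ => (1 + t • A).det⁻¹) (-A.trace) 0 := by
  have h : HasDerivAt (fun t : ℝ => (1 + t • A).det) A.trace 0 := by
    -- `det(1 + tA) = 1 + t tr A + O(t²)`, with the remainder an explicit polynomial multiple of
    -- `t²`.
    have h1 := (((hasDerivAt_id (0 : ℝ)).const_mul A.trace).const_add 1).add
      (((Matrix.det (1 + (Polynomial.X : Polynomial ℝ) • A.map Polynomial.C)).divX.divX.hasDerivAt
        0).mul ((hasDerivAt_id (0 : ℝ)).pow 2))
    refine (h1.congr_deriv ?_).congr_of_eventuallyEq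
      (Eventually.of_forall fun t => Matrix.det_one_add_smul t A)
    simp
  refine (h.inv (by simp)).congr_deriv ?_
  simp

/-- The equations contracted with a symmetric matrix. -/
theorem sum_equation_eq {M : Type*} [AddCommGroup M] [Module ℝ M] (r : ℝ) (hr : r ≠ 0)
    (X : Matrix (Fin m) (Fin m) ℝ) (F : Fin m → Fin m → M) :
    -X.trace • (∑ j, ∑ l, eta m j l • F j l) +
        r • ∑ j, ∑ l, (X * eta m + eta m * X.transpose) l j • F j l =
      r • ∑ k, ∑ i, (eta m * (X * eta m + eta m * X.transpose)) k i •
        ((∑ l, eta m k l • F i l) - (1 / (2 * r) * (if k = i then 1 else 0)) •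
          ∑ j, ∑ l, eta m j l • F j l) := by
  set Y := X * eta m + eta m * X.transpose with hY
  have h1 : ∑ k, ∑ i, (eta m * Y) k i • ∑ l, eta m k l • F i l = ∑ j, ∑ l, Y l j • F j l := by
    rw [Finset.sum_comm]
    refine Finset.sum_congr rfl fun j _ => ?_
    simp only [Finset.smul_sum, smul_smul]
    rw [Finset.sum_comm]
    refine Finset.sum_congr rfl fun l _ => ?_
    rw [← Finset.sum_smul]
    congr 1
    have : (eta m * (eta m * Y)) l j = Y l j := by
      rw [← mul_assoc, eta_mul_eta, one_mul]
    rw [← this, Matrix.mul_apply]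
    exact Finset.sum_congr rfl fun k _ => by rw [mul_comm, eta_symm]
  -- The factor 2 here, one contribution from each summand of `Y`, matches the coefficient `1/(2r)`
  -- in the field equations: after multiplication by `r` the trace part is exactly `tr X`, the
  -- contribution of `det(g)⁻¹`.
  have htr : (eta m * Y).trace = 2 * X.trace := by
    have h3 : (eta m * (X * eta m)).trace = X.trace := by
      rw [Matrix.trace_mul_comm, mul_assoc, eta_mul_eta, mul_one]
    have h4 : (eta m * (eta m * X.transpose)).trace = X.trace := by
      rw [← mul_assoc, eta_mul_eta, one_mul, Matrix.trace_transpose]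
    rw [hY, mul_add, Matrix.trace_add, h3, h4]
    ring
  have h2 : ∀ L : M, ∑ k, ∑ i, (eta m * Y) k i • (1 / (2 * r) * (if k = i then (1 : ℝ) else 0)) • L
      = (1 / r * X.trace) • L := by
    intro L
    have : ∀ k, ∑ i, (eta m * Y) k i • (1 / (2 * r) * (if k = i then (1 : ℝ) else 0)) • L =
        ((eta m * Y) k k * (1 / (2 * r))) • L := by
      intro k
      rw [Finset.sum_eq_single k]
      · rw [if_pos rfl, mul_one, smul_smul]
      · intro i _ hi
        rw [if_neg (Ne.symm hi)]
        simp
      · simp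
    rw [Finset.sum_congr rfl fun k _ => this k, ← Finset.sum_smul, ← Finset.sum_mul]
    change ((eta m * Y).trace * (1 / (2 * r))) • L = _
    rw [htr]
    congr 1
    field_simp
  simp only [smul_sub, Finset.sum_sub_distrib]
  rw [h1, h2, smul_smul]
  rw [show r * (1 / r * X.trace) = X.trace by field_simp]
  rw [neg_smul]
  abel

/-- With `g = 1 + tX` and `h = g⁻¹`, the coframe becomes `h θ` and the curvature `h C g`, where `C`
is written in the old frame. Raising the second index gives `h C g η = h (C g η gᵀ) hᵀ`, so both the
coframe and the raised curvature are transforms by the single matrix `h`, and `lagForm_transform`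
extracts `det h = det(g)⁻¹`. -/
theorem lagrangian_add_smul {n : ℕ} (hr : n + 1 + (n + 1) ≤ m) {q : J m} (hq : IsUnit q.2.1)
    (hΓ : q.2.2 = 0) (v : J m) {t : ℝ}
    (ht : IsUnit (1 + t • (Ring.inverse q.2.1 * v.2.1))) :
    lagrangian n (q + t • v) =
      ((1 + t • mat (Ring.inverse q.2.1 * v.2.1)).det)⁻¹ •
        lagForm (n + 1) (fun i => theta i q) fun i j =>
          ∑ l, ((1 + t • mat (Ring.inverse q.2.1 * v.2.1)) * eta m *
            (1 + t • mat (Ring.inverse q.2.1 * v.2.1)).transpose) l j •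
            (curv i l q + t ^ 2 • (curv i l ((q.1, q.2.1, v.2.2) : J m) - curv i l q)) := by
  set X : E m →L[ℝ] E m := Ring.inverse q.2.1 * v.2.1 with hX
  set g : E m →L[ℝ] E m := 1 + t • X with hg
  have hG : 1 + t • mat X = mat g := by rw [hg, mat_add, mat_one, mat_smul]
  rw [hG]
  set h : E m →L[ℝ] E m := Ring.inverse g with hh
  have hframe : (q + t • v).2.1 = q.2.1 * g := by
    exact frame_add_smul hq v.2.1 t
  have hunit : IsUnit (q + t • v).2.1 := by rw [hframe]; exact hq.mul ht
  have hinv : Ring.inverse (q + t • v).2.1 = h * Ring.inverse q.2.1 := by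
    rw [hframe, inverse_mul_of_isUnit hq ht]
  have hGH : mat g * mat h = 1 := by
    rw [← mat_mul, hh, Ring.mul_inverse_cancel _ ht, mat_one]
  have hdet : (mat g).det⁻¹ = (Matrix.of fun i b => entry i b h).det := by
    rw [inv_eq_iff_eq_inv]
    refine eq_inv_of_mul_eq_one_left ?_
    change (mat g).det * (mat h).det = 1
    rw [← Matrix.det_mul, hGH, Matrix.det_one]
  have hθ : ∀ i, theta i (q + t • v) = ∑ b, entry i b h • theta b q := by
    intro i
    ext w
    rw [theta_apply, hinv]
    simp only [ContinuousAlternatingMap.sum_apply, ContinuousAlternatingMap.smul_apply,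
      theta_apply, smul_eq_mul, sum_entry_mul_coordFn]
    rfl
  -- Here `C` is identified. At `Γ = 0` the curvature reduces to its `dΓ` part, and along the line
  -- `Γ ∧ Γ` is `t²` times its value at the coefficients `v.2.2`. The difference of the curvatures
  -- at `(x, e, v.2.2)` and at `q` isolates that value.
  have hC : ∀ i l (w : Fin 2 → J m),
      (curv i l q + t ^ 2 • (curv i l ((q.1, q.2.1, v.2.2) : J m) - curv i l q)) w =
        mat (Ring.inverse q.2.1 * curvEnd (q + t • v) (w 0) (w 1) * q.2.1) i l := by
    intro i l w
    have hq' : IsUnit ((q.1, q.2.1, v.2.2) : J m).2.1 := hq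
    simp only [ContinuousAlternatingMap.add_apply, ContinuousAlternatingMap.smul_apply,
      ContinuousAlternatingMap.sub_apply, curv_apply i l hq, curv_apply i l hq', mat_apply]
    rw [← map_sub, ← map_smul, ← map_add]
    congr 1
    have e1 : (q + t • v).2.2 = t • v.2.2 := zero_add_smul hΓ v.2.2 t
    have e2 : curvEnd q (w 0) (w 1) = (w 0).2.2 (w 1).1 - (w 1).2.2 (w 0).1 := by
      rw [curvEnd, hΓ]
      change _ + ((0 : E m →L[ℝ] E m) * 0 - 0 * 0) = _
      rw [sub_self, add_zero]
    have e3 : curvEnd (q + t • v) (w 0) (w 1) = (w 0).2.2 (w 1).1 - (w 1).2.2 (w 0).1 +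
        ((t • v.2.2 (w 0).1) * (t • v.2.2 (w 1).1) - (t • v.2.2 (w 1).1) * (t • v.2.2 (w 0).1)) := by
      rw [curvEnd, e1]
      rfl
    rw [e2, e3]
    exact quadratic_curvature_identity _ _ _ _ _ t
  have hΩ : ∀ i j, curvUp i j (q + t • v) = ∑ p : Fin m × Fin m, (entry i p.1 h * entry j p.2 h) •
      ∑ l, (mat g * eta m * (mat g).transpose) l p.2 •
        (curv p.1 l q + t ^ 2 • (curv p.1 l ((q.1, q.2.1, v.2.2) : J m) - curv p.1 l q)) := by
    intro i j
    ext w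
    set c := mat (Ring.inverse q.2.1 * curvEnd (q + t • v) (w 0) (w 1) * q.2.1) with hc
    have e1 : curvUp i j (q + t • v) w = ∑ l, eta m j l * curv i l (q + t • v) w := by
      simp [curvUp]
    have e2 : ∀ l, curv i l (q + t • v) w = (mat h * c * mat g) i l := by
      intro l
      rw [curv_apply i l hunit, hinv, hframe, hc, ← mat_mul, ← mat_mul, mat_apply]
      simp only [mul_assoc]
    have e3 : ∀ k p, (∑ l, (mat g * eta m * (mat g).transpose) l p •
        (curv k l q + t ^ 2 • (curv k l ((q.1, q.2.1, v.2.2) : J m) - curv k l q))) w =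
          (c * (mat g * eta m * (mat g).transpose)) k p := by
      intro k p
      rw [ContinuousAlternatingMap.sum_apply, Matrix.mul_apply]
      refine Finset.sum_congr rfl fun l _ => ?_
      rw [ContinuousAlternatingMap.smul_apply, hC, smul_eq_mul, mul_comm]
    rw [e1, Finset.sum_congr rfl fun l _ => by rw [e2 l]]
    rw [ContinuousAlternatingMap.sum_apply]
    simp only [ContinuousAlternatingMap.smul_apply, e3]
    have e4 : ∑ l, eta m j l * (mat h * c * mat g) i l = (mat h * c * mat g * eta m) i j := by
      rw [Matrix.mul_apply]
      exact Finset.sum_congr rfl fun l _ => by rw [mul_comm, eta_symm]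
    -- Insertion of `gᵀ hᵀ = 1` on the right.
    have e5 : mat h * c * mat g * eta m =
        mat h * (c * (mat g * eta m * (mat g).transpose)) * (mat h).transpose := by
      have : (mat g).transpose * (mat h).transpose = 1 := by
        rw [← Matrix.transpose_mul, ← mat_mul, hh, Ring.inverse_mul_cancel _ ht, mat_one,
          Matrix.transpose_one]
      simp only [mul_assoc, this, mul_one]
    rw [e4, e5, Matrix.mul_apply, Fintype.sum_prod_type_right]
    refine Finset.sum_congr rfl fun p _ => ?_
    rw [Matrix.mul_apply, Finset.sum_mul]
    refine Finset.sum_congr rfl fun k _ => ?_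
    simp only [Matrix.transpose_apply, mat_apply, smul_eq_mul]
    ring
  rw [lagrangian_eq_lagForm, hdet, ← lagForm_transform hr]
  congr 1
  · exact funext hθ
  · exact funext fun i => funext fun j => hΩ i j

theorem hasDerivAt_metric (X : Matrix (Fin m) (Fin m) ℝ) (l j : Fin m) :
    HasDerivAt (fun t : ℝ => ((1 + t • X) * eta m * (1 + t • X).transpose) l j)
      ((X * eta m + eta m * X.transpose) l j) 0 := by
  have e : ∀ t : ℝ, ((1 + t • X) * eta m * (1 + t • X).transpose) l j =
      eta m l j + t * (X * eta m + eta m * X.transpose) l j +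
        t ^ 2 * (X * eta m * X.transpose) l j := by
    intro t
    have : (1 + t • X) * eta m * (1 + t • X).transpose =
        eta m + t • (X * eta m + eta m * X.transpose) + t ^ 2 • (X * eta m * X.transpose) := by
      rw [Matrix.transpose_add, Matrix.transpose_one, Matrix.transpose_smul]
      simp only [add_mul, mul_add, one_mul, mul_one, smul_mul_assoc, mul_smul_comm, smul_smul,
        smul_add, pow_two]
      abel
    rw [this]
    rfl
  simp only [e]
  have := (((hasDerivAt_id (0 : ℝ)).mul_const ((X * eta m + eta m * X.transpose) l j)).const_add
    (eta m l j)).add (((hasDerivAt_id (0 : ℝ)).pow 2).mul_const ((X * eta m * X.transpose) l j))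
  refine this.congr_deriv ?_
  simp

/-- The correction of order `t²` in the curvature does not reach the first derivative. -/
theorem hasDerivAt_metric_smul {F : Type*} [NormedAddCommGroup F] [NormedSpace ℝ F]
    (X : Matrix (Fin m) (Fin m) ℝ) (l j : Fin m) (a b : F) :
    HasDerivAt (fun t : ℝ => ((1 + t • X) * eta m * (1 + t • X).transpose) l j • (a + t ^ 2 • b))
      ((X * eta m + eta m * X.transpose) l j • a) 0 := by
  have h2 : HasDerivAt (fun t : ℝ => a + t ^ 2 • b) 0 0 := by
    have := (((hasDerivAt_id (0 : ℝ)).pow 2).smul_const b).const_add a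
    refine this.congr_deriv ?_
    simp
  refine ((hasDerivAt_metric X l j).smul h2).congr_deriv ?_
  simp

theorem lagForm_eq_sum_fieldForm (n : ℕ) (q : J m) :
    lagForm (n + 1) (fun i => theta i q) (fun i j => curvUp i j q) =
      ∑ j, ∑ l, eta m j l • fieldForm n j l q := by
  rw [lagForm_eq_polar]
  exact lagFormPolar_eq_sum n (fun i => theta i q) (fun i j => curvUp i j q)
    (fun i j => curv i j q) (fun l j => eta m j l)

/-- The derivative of the Lovelock Lagrangian at a point where the connection coefficients
vanish. -/
theorem fderiv_lagrangian {n : ℕ} (hr : n + 1 + (n + 1) ≤ m) {q : J m} (hq : IsUnit q.2.1)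
    (hΓ : q.2.2 = 0) (v : J m) :
    fderiv ℝ (lagrangian n) q v = ((n : ℝ) + 1) • ∑ k, ∑ i,
      (eta m * (mat (Ring.inverse q.2.1 * v.2.1) * eta m +
        eta m * (mat (Ring.inverse q.2.1 * v.2.1)).transpose)) k i • equationForm n k i q := by
  set X := mat (Ring.inverse q.2.1 * v.2.1) with hX
  have hd : DifferentiableAt ℝ (lagrangian (m := m) n) q :=
    (contDiffAt_lagrangian n hq).differentiableAt (by simp)
  have hline : HasDerivAt (fun t : ℝ => q + t • v) v 0 := by
    simpa using ((hasDerivAt_id (0 : ℝ)).smul_const v).const_add q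
  have h1 : HasDerivAt (fun t : ℝ => lagrangian n (q + t • v)) (fderiv ℝ (lagrangian n) q v) 0 := by
    have hd' : HasFDerivAt (lagrangian n) (fderiv ℝ (lagrangian n) q) (q + (0 : ℝ) • v) := by
      simpa using hd.hasFDerivAt
    exact hd'.comp_hasDerivAt 0 hline
  have hev : ∀ᶠ t : ℝ in 𝓝 0, IsUnit (1 + t • (Ring.inverse q.2.1 * v.2.1)) :=
    eventually_isUnit_one_add_smul _
  have hW : ∀ i j, HasDerivAt (fun t : ℝ => ∑ l, ((1 + t • X) * eta m * (1 + t • X).transpose) l j •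
      (curv i l q + t ^ 2 • (curv i l ((q.1, q.2.1, v.2.2) : J m) - curv i l q)))
      (∑ l, (X * eta m + eta m * X.transpose) l j • curv i l q) 0 := fun i j =>
    HasDerivAt.fun_sum fun l _ => hasDerivAt_metric_smul X l j _ _
  -- The factor `det(g)⁻¹` yields the trace term; the factor `g η gᵀ` yields the polarized form with
  -- `Xη + ηXᵀ`.
  have h3 := (hasDerivAt_inv_det X).smul (hasDerivAt_lagForm n hr (fun i => theta i q) hW)
  have h4 := h1.unique (h3.congr_of_eventuallyEq
    (hev.mono fun t ht => lagrangian_add_smul hr hq hΓ v ht))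
  rw [h4]
  have hW0 : (fun i j => ∑ l, ((1 + (0 : ℝ) • X) * eta m * (1 + (0 : ℝ) • X).transpose) l j •
      (curv i l q + (0 : ℝ) ^ 2 • (curv i l ((q.1, q.2.1, v.2.2) : J m) - curv i l q))) =
      fun i j => curvUp i j q := by
    funext i j
    refine Finset.sum_congr rfl fun l _ => ?_
    simp [eta_symm l j]
  have hfin := sum_equation_eq ((n : ℝ) + 1) (by positivity) X fun j l => fieldForm n j l q
  refine Eq.trans ?_ hfin
  rw [hW0, lagForm_eq_sum_fieldForm, lagFormPolar_eq_sum n (fun i => theta i q)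
    (fun i j => curvUp i j q) (fun i j => curv i j q)
    (fun l j => (X * eta m + eta m * X.transpose) l j)]
  rw [zero_smul, add_zero, Matrix.det_one, inv_one, one_smul]
  exact add_comm _ _

end Derivative

/-! ### Naturality of the Lovelock forms -/

section Naturality

variable {m : ℕ} {W : Type*} [NormedAddCommGroup W] [NormedSpace ℝ W]

theorem sparlingForm_comp {V U : Type*} [NormedAddCommGroup V] [NormedSpace ℝ V]
    [NormedAddCommGroup U] [NormedSpace ℝ U] {p : ℕ} (θ : Fin m → Form V 1) (I : Fin p → Fin m)
    (f : U →L[ℝ] V) :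
    (sparlingForm θ I).compContinuousLinearMap f =
      sparlingForm (fun i => (θ i).compContinuousLinearMap f) I := by
  simp only [sparlingForm, form_smul_comp, form_sum_comp, wedgeOne_comp]

theorem lagForm_comp {V U : Type*} [NormedAddCommGroup V] [NormedSpace ℝ V]
    [NormedAddCommGroup U] [NormedSpace ℝ U] (r : ℕ) (θ : Fin m → Form V 1)
    (Ω : Fin m → Fin m → Form V 2) (f : U →L[ℝ] V) :
    (lagForm r θ Ω).compContinuousLinearMap f =
      lagForm r (fun i => (θ i).compContinuousLinearMap f)
        fun i j => (Ω i j).compContinuousLinearMap f := by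
  simp only [lagForm, form_sum_comp, wedge_comp, sparlingForm_comp, wedgeTwo_comp]

theorem fieldFormOf_comp {V U : Type*} [NormedAddCommGroup V] [NormedSpace ℝ V]
    [NormedAddCommGroup U] [NormedSpace ℝ U] (n : ℕ) (θ : Fin m → Form V 1)
    (Ω C : Fin m → Fin m → Form V 2) (j l : Fin m) (f : U →L[ℝ] V) :
    (fieldFormOf n θ Ω C j l).compContinuousLinearMap f =
      fieldFormOf n (fun i => (θ i).compContinuousLinearMap f)
        (fun i j => (Ω i j).compContinuousLinearMap f)
        (fun i j => (C i j).compContinuousLinearMap f) j l := by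
  simp only [fieldFormOf, form_sum_comp, wedge_comp, sparlingForm_comp, wedgeTwo_comp]
  refine Finset.sum_congr rfl fun I _ => Finset.sum_congr rfl fun K _ => ?_
  congr 2
  ext1 a
  induction a using Fin.cases <;> rfl

/-- The maps `F` and `G` into the jet coordinates pull the canonical forms back to the same forms
near `w`. -/
structure SameCanonicalForms (F G : W → J m) (w : W) : Prop where
  left : ∀ᶠ x in 𝓝 w, ContDiffAt ℝ ∞ F x ∧ IsUnit (F x).2.1
  right : ∀ᶠ x in 𝓝 w, ContDiffAt ℝ ∞ G x ∧ IsUnit (G x).2.1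
  theta : ∀ᶠ x in 𝓝 w, ∀ i, pullback F (theta i) x = pullback G (theta i) x
  omega : ∀ᶠ x in 𝓝 w, ∀ i j, pullback F (omega i j) x = pullback G (omega i j) x

theorem SameCanonicalForms.eventually {F G : W → J m} {w : W} (h : SameCanonicalForms F G w) :
    ∀ᶠ x in 𝓝 w, SameCanonicalForms F G x := by
  filter_upwards [h.left.eventually_nhds, h.right.eventually_nhds, h.theta.eventually_nhds,
    h.omega.eventually_nhds] with x h1 h2 h3 h4 using ⟨h1, h2, h3, h4⟩

theorem extDeriv_pullback_of_contDiffAt {k : ℕ} {α : J m → Form (J m) k} {F : W → J m} {w : W}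
    (hα : ContDiffAt ℝ ∞ α (F w)) (hF : ContDiffAt ℝ ∞ F w) :
    extDeriv (pullback F α) w = pullback F (extDeriv α) w :=
  extDeriv_pullback (hα.differentiableAt (by simp)) (r := 2) (hF.of_le (by norm_cast))
    (by simp)

theorem pullback_curv (i j : Fin m) {F : W → J m} {w : W} (hF : ContDiffAt ℝ ∞ F w)
    (hu : IsUnit (F w).2.1) :
    pullback F (curv i j) w = extDeriv (pullback F (omega i j)) w +
      ∑ k, wedge (pullback F (omega i k) w) (pullback F (omega k j) w) := by
  rw [extDeriv_pullback_of_contDiffAt (contDiffAt_omega i j hu) hF]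
  simp only [pullback, curv, form_add_comp, form_sum_comp, wedge_comp]

/-- The pulled back curvature is computed from the pulled back connection by the structure equation.
The exterior derivative needs the equality of the connections on a neighbourhood, which is why
`SameCanonicalForms` is a local condition. -/
theorem SameCanonicalForms.pullback_curv {F G : W → J m} {w : W} (h : SameCanonicalForms F G w)
    (i j : Fin m) : pullback F (curv i j) w = pullback G (curv i j) w := by
  have hF := h.left.self_of_nhds
  have hG := h.right.self_of_nhds
  rw [Lovelock.pullback_curv i j hF.1 hF.2, Lovelock.pullback_curv i j hG.1 hG.2]
  have hω := h.omega.self_of_nhds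
  have hd : extDeriv (pullback F (Lovelock.omega i j)) w =
      extDeriv (pullback G (Lovelock.omega i j)) w :=
    Filter.EventuallyEq.extDeriv_eq (h.omega.mono fun x hx => hx i j)
  rw [hd]
  congr 1
  exact Finset.sum_congr rfl fun k _ => by rw [hω i k, hω k j]

theorem SameCanonicalForms.pullback_curvUp {F G : W → J m} {w : W}
    (h : SameCanonicalForms F G w) (i j : Fin m) :
    pullback F (curvUp i j) w = pullback G (curvUp i j) w := by
  have h1 : ∀ F : W → J m, pullback F (curvUp i j) w =
      ∑ l, eta m j l • pullback F (curv i l) w := fun F => by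
    simp only [pullback, curvUp, form_sum_comp, form_smul_comp]
  rw [h1, h1]
  exact Finset.sum_congr rfl fun l _ => by rw [h.pullback_curv]

theorem pullback_lagrangian (n : ℕ) (F : W → J m) (w : W) :
    pullback F (lagrangian n) w = lagForm (n + 1) (fun i => pullback F (theta i) w)
      fun i j => pullback F (curvUp i j) w := by
  rw [pullback, lagrangian_eq_lagForm, lagForm_comp]
  rfl

theorem SameCanonicalForms.pullback_lagrangian {F G : W → J m} {w : W}
    (h : SameCanonicalForms F G w) (n : ℕ) :
    pullback F (lagrangian n) w = pullback G (lagrangian n) w := by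
  have hθ := h.theta.self_of_nhds
  simp only [Lovelock.pullback_lagrangian, h.pullback_curvUp, hθ]

theorem SameCanonicalForms.pullback_fieldForm {F G : W → J m} {w : W}
    (h : SameCanonicalForms F G w) (n : ℕ) (j l : Fin m) :
    pullback F (fieldForm n j l) w = pullback G (fieldForm n j l) w := by
  have h1 : ∀ F : W → J m, pullback F (fieldForm n j l) w =
      fieldFormOf n (fun i => pullback F (Lovelock.theta i) w)
        (fun i j => pullback F (curvUp i j) w) (fun i j => pullback F (curv i j) w) j l :=
    fun F => by
      rw [pullback, fieldForm_eq_fieldFormOf, fieldFormOf_comp]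
      rfl
  have hθ := h.theta.self_of_nhds
  simp only [h1, h.pullback_curvUp, h.pullback_curv, hθ]

theorem SameCanonicalForms.pullback_equationForm {F G : W → J m} {w : W}
    (h : SameCanonicalForms F G w) (n : ℕ) (k i : Fin m) :
    pullback F (equationForm n k i) w = pullback G (equationForm n k i) w := by
  have h1 : ∀ F : W → J m, pullback F (equationForm n k i) w =
      (∑ l : Fin m, eta m k l • pullback F (fieldForm n i l) w)
        - (1 / (2 * ((n : ℝ) + 1)) * (if k = i then 1 else 0)) •
            ∑ j : Fin m, ∑ l : Fin m, eta m j l • pullback F (fieldForm n j l) w := fun F => by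
    have hs : ∀ (a b : Form (J m) ((m - (n + 1 + (n + 1))) + 2 * (n + 1))) (f : W →L[ℝ] J m),
        (a - b).compContinuousLinearMap f =
          a.compContinuousLinearMap f - b.compContinuousLinearMap f := fun _ _ _ => rfl
    simp only [pullback, equationForm, hs, form_smul_comp, form_sum_comp]
  rw [h1, h1]
  simp only [h.pullback_fieldForm]

/-- Since `d` commutes with pullback, equality of the pulled back Lagrangians near the point
suffices. -/
theorem SameCanonicalForms.pullback_extDeriv_lagrangian {F G : W → J m} {w : W}
    (h : SameCanonicalForms F G w) (n : ℕ) :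
    pullback F (extDeriv (lagrangian n)) w = pullback G (extDeriv (lagrangian n)) w := by
  have hF := h.left.self_of_nhds
  have hG := h.right.self_of_nhds
  rw [← extDeriv_pullback_of_contDiffAt (contDiffAt_lagrangian n hF.2) hF.1,
    ← extDeriv_pullback_of_contDiffAt (contDiffAt_lagrangian n hG.2) hG.1]
  exact Filter.EventuallyEq.extDeriv_eq (h.eventually.mono fun x hx => hx.pullback_lagrangian n)

/-- The inhomogeneous term `B` of the connection cancels the derivative of the Jacobian in the
transformed frame. -/
theorem gauge_identity {R : Type*} [Ring R] {A B p u P Q : R} (hA : IsUnit A) (hp : IsUnit p)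
    (h : Q * A = A * P - B) :
    Ring.inverse (A * p) * (B * p + A * u + Q * (A * p)) = Ring.inverse p * (u + P * p) := by
  have : B * p + A * u + Q * (A * p) = A * (u + P * p) := by
    rw [← mul_assoc Q, h]
    noncomm_ring
  rw [this, inverse_mul_of_isUnit hA hp, mul_assoc, ← mul_assoc _ A, Ring.inverse_mul_cancel _ hA,
    one_mul]

theorem canonicalForms_transform {p q u v : J m} {A B : E m →L[ℝ] E m} (hA : IsUnit A)
    (hp : IsUnit p.2.1) (he : q.2.1 = A * p.2.1) (h1 : v.1 = A u.1)
    (h2 : v.2.1 = B * p.2.1 + A * u.2.1) (h3 : q.2.2 v.1 * A = A * p.2.2 u.1 - B) :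
    Ring.inverse p.2.1 u.1 = Ring.inverse q.2.1 v.1 ∧ omegaEnd p u = omegaEnd q v := by
  constructor
  · rw [he, h1, inverse_mul_of_isUnit hA hp]
    have : Ring.inverse A * A = 1 := Ring.inverse_mul_cancel _ hA
    exact congrArg _ (congrArg (fun T : E m →L[ℝ] E m => T u.1) this).symm
  · rw [omegaEnd, omegaEnd, he, h2]
    exact (gauge_identity hA hp h3).symm

/-- `A` plays the role of the Jacobian of a coordinate change and `B x v` of its derivative along
`v`; the hypotheses are the transformation laws of base point, frame and connection. It is applied
to normal coordinates and to changes of chart. -/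
theorem sameCanonicalForms_of_transform {F G : W → J m} {w : W} (A : W → (E m →L[ℝ] E m))
    (B : W → W → (E m →L[ℝ] E m))
    (hF : ∀ᶠ x in 𝓝 w, ContDiffAt ℝ ∞ F x ∧ IsUnit (F x).2.1)
    (hG : ∀ᶠ x in 𝓝 w, ContDiffAt ℝ ∞ G x)
    (h : ∀ᶠ x in 𝓝 w, IsUnit (A x) ∧ (G x).2.1 = A x * (F x).2.1 ∧ ∀ v,
      (fderiv ℝ G x v).1 = A x (fderiv ℝ F x v).1 ∧
      (fderiv ℝ G x v).2.1 = B x v * (F x).2.1 + A x * (fderiv ℝ F x v).2.1 ∧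
      (G x).2.2 (fderiv ℝ G x v).1 * A x = A x * (F x).2.2 (fderiv ℝ F x v).1 - B x v) :
    SameCanonicalForms F G w := by
  refine ⟨hF, ?_, ?_, ?_⟩
  · filter_upwards [hF, hG, h] with x h1 h2 h3
    exact ⟨h2, by rw [h3.2.1]; exact h3.1.mul h1.2⟩
  · filter_upwards [hF, h] with x h1 h2 i
    ext v
    obtain ⟨a, b, c⟩ := h2.2.2 (v 0)
    exact congrArg (coordFn i) (canonicalForms_transform h2.1 h1.2 h2.2.1 a b c).1
  · filter_upwards [hF, h] with x h1 h2 i j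
    ext v
    obtain ⟨a, b, c⟩ := h2.2.2 (v 0)
    exact congrArg (entry i j) (canonicalForms_transform h2.1 h1.2 h2.2.1 a b c).2

/-- The hypothesis says `M = -η Mᵀ η`; multiplication by `η` on the right, with `η² = 1`, gives
skewness with respect to `η`. -/
theorem metric_matrix {M : Matrix (Fin m) (Fin m) ℝ}
    (h : ∀ i j, M i j + ∑ p, ∑ l, eta m j p * eta m l i * M p l = 0) :
    M * eta m + eta m * M.transpose = 0 := by
  have h1 : M = -(eta m * M * eta m).transpose := by
    ext i j
    rw [Matrix.neg_apply, Matrix.transpose_apply, Matrix.mul_apply]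
    have e : ∑ l, (eta m * M) j l * eta m l i = ∑ p, ∑ l, eta m j p * eta m l i * M p l := by
      rw [Finset.sum_comm]
      refine Finset.sum_congr rfl fun l _ => ?_
      rw [Matrix.mul_apply, Finset.sum_mul]
      exact Finset.sum_congr rfl fun p _ => by ring
    rw [e]
    linarith [h i j]
  have h2 : M = -(eta m * M.transpose * eta m) := by
    rw [Matrix.transpose_mul, Matrix.transpose_mul, eta_transpose, ← mul_assoc] at h1
    exact h1
  have h3 : M * eta m = -(eta m * M.transpose) := by
    conv_lhs => rw [h2]
    rw [neg_mul, mul_assoc, eta_mul_eta, mul_one]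
  rw [h3, neg_add_cancel]

theorem metric_of_pullback_omegaP {f : W → J m} {w : W}
    (h : ∀ i j, pullback f (omegaP i j) w = 0) (u : W) :
    mat (omegaEnd (f w) (fderiv ℝ f w u)) * eta m +
      eta m * (mat (omegaEnd (f w) (fderiv ℝ f w u))).transpose = 0 := by
  refine metric_matrix fun i j => ?_
  have h1 := congrArg (fun α : Form W 1 => α fun _ => u) (h i j)
  have h2 : ((omegaP i j (f w)) fun _ : Fin 1 => fderiv ℝ f w u) = 0 := h1
  rw [omegaP, ContinuousAlternatingMap.smul_apply, ContinuousAlternatingMap.add_apply,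
    ContinuousAlternatingMap.sum_apply] at h2
  simp only [ContinuousAlternatingMap.sum_apply, ContinuousAlternatingMap.smul_apply, omega_apply,
    smul_eq_mul] at h2
  simp only [mat_apply]
  linarith

end Naturality

/-! ### Normal gauge -/

section NormalGauge

variable {m : ℕ}

/-- The jacobian of the change of coordinates that makes the symmetric connection coefficients
`Γ₀` vanish at `z₀`. -/
def normalJacobian (Γ₀ : E m →L[ℝ] E m →L[ℝ] E m) (z₀ z : E m) : E m →L[ℝ] E m :=
  1 + Γ₀ (z - z₀)

/-- The change of coordinates that makes the symmetric connection coefficients `Γ₀` vanish at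
`z₀`. -/
def normalCoord (Γ₀ : E m →L[ℝ] E m →L[ℝ] E m) (z₀ z : E m) : E m :=
  (z - z₀) + (1 / 2 : ℝ) • Γ₀ (z - z₀) (z - z₀)

theorem hasFDerivAt_normalCoord {V : Type*} [NormedAddCommGroup V] [NormedSpace ℝ V]
    {Γ₀ : V →L[ℝ] V →L[ℝ] V} (h : ∀ v w, Γ₀ v w = Γ₀ w v)
    (z₀ z : V) : HasFDerivAt (fun z => (z - z₀) + (1 / 2 : ℝ) • Γ₀ (z - z₀) (z - z₀))
      (ContinuousLinearMap.id ℝ V + Γ₀ (z - z₀)) z := by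
  have h1 : HasFDerivAt (fun z : V => z - z₀) (ContinuousLinearMap.id ℝ V) z :=
    (hasFDerivAt_id z).sub_const z₀
  have h2 := (Γ₀.hasFDerivAt.comp z h1).clm_apply h1
  refine (h1.add (h2.const_smul (1 / 2 : ℝ))).congr_fderiv ?_
  ext v
  change v + (1 / 2 : ℝ) • (Γ₀ (z - z₀) v + Γ₀ v (z - z₀)) = v + Γ₀ (z - z₀) v
  rw [h v (z - z₀), ← two_smul ℝ, smul_smul]
  norm_num

theorem contDiff_normalJacobian (Γ₀ : E m →L[ℝ] E m →L[ℝ] E m) (z₀ : E m) :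
    ContDiff ℝ ∞ (normalJacobian Γ₀ z₀) :=
  contDiff_const.add (Γ₀.contDiff.comp (contDiff_id.sub contDiff_const))

theorem contDiff_normalCoord (Γ₀ : E m →L[ℝ] E m →L[ℝ] E m) (z₀ : E m) :
    ContDiff ℝ ∞ (normalCoord Γ₀ z₀) := by
  have h : ContDiff ℝ ∞ fun z : E m => z - z₀ := contDiff_id.sub contDiff_const
  exact h.add (((Γ₀.contDiff.comp h).clm_apply h).const_smul (1 / 2 : ℝ))

/-- Transformed connection coefficients. -/
def gaugeGamma {V : Type*} [NormedAddCommGroup V] [NormedSpace ℝ V] (A Ai : V →L[ℝ] V)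
    (Γ Γ₀ : V →L[ℝ] V →L[ℝ] V) : V →L[ℝ] V →L[ℝ] V :=
  (ContinuousLinearMap.compL ℝ V V V A).comp
      (((ContinuousLinearMap.compL ℝ V V V).flip Ai).comp (Γ.comp Ai)) -
    ((ContinuousLinearMap.compL ℝ V V V).flip Ai).comp (Γ₀.comp Ai)

theorem gaugeGamma_apply {V : Type*} [NormedAddCommGroup V] [NormedSpace ℝ V] (A Ai : V →L[ℝ] V)
    (Γ Γ₀ : V →L[ℝ] V →L[ℝ] V) (h : Ai * A = 1) (u : V) :
    gaugeGamma A Ai Γ Γ₀ (A u) * A = A * Γ u - Γ₀ u := by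
  have h' : ∀ v, Ai (A v) = v := fun v => congrArg (fun T : V →L[ℝ] V => T v) h
  ext v
  simp [gaugeGamma, h']

theorem contDiffAt_gaugeGamma {V W : Type*} [NormedAddCommGroup V] [NormedSpace ℝ V]
    [NormedAddCommGroup W] [NormedSpace ℝ W] {A Ai : W → V →L[ℝ] V} {Γ : W → V →L[ℝ] V →L[ℝ] V}
    {Γ₀ : V →L[ℝ] V →L[ℝ] V} {x : W} {p : WithTop ℕ∞} (hA : ContDiffAt ℝ p A x)
    (hAi : ContDiffAt ℝ p Ai x) (hΓ : ContDiffAt ℝ p Γ x) :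
    ContDiffAt ℝ p (fun x => gaugeGamma (A x) (Ai x) (Γ x) Γ₀) x := by
  have hfl : ContDiffAt ℝ p (fun x => (ContinuousLinearMap.compL ℝ V V V).flip (Ai x)) x :=
    (ContinuousLinearMap.contDiff _).contDiffAt.comp x hAi
  have hco : ContDiffAt ℝ p (fun x => ContinuousLinearMap.compL ℝ V V V (A x)) x :=
    (ContinuousLinearMap.contDiff _).contDiffAt.comp x hA
  exact (hco.clm_comp (hfl.clm_comp (hΓ.clm_comp hAi))).sub
    (hfl.clm_comp (contDiffAt_const.clm_comp hAi))

theorem contDiffAt_snd_snd {A B C W : Type*} [NormedAddCommGroup A] [NormedSpace ℝ A]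
    [NormedAddCommGroup B] [NormedSpace ℝ B] [NormedAddCommGroup C] [NormedSpace ℝ C]
    [NormedAddCommGroup W] [NormedSpace ℝ W] {p : WithTop ℕ∞} {F : W → A × B × C} {x : W}
    (h : ContDiffAt ℝ p F x) : ContDiffAt ℝ p (fun x => (F x).2.2) x :=
  h.snd.snd

theorem contDiffAt_gamma {W : Type*} [NormedAddCommGroup W] [NormedSpace ℝ W] {p : WithTop ℕ∞}
    {F : W → J m} {x : W} (h : ContDiffAt ℝ p F x) : ContDiffAt ℝ p (fun x => (F x).2.2) x :=
  contDiffAt_snd_snd (A := E m) (B := E m →L[ℝ] E m) (C := E m →L[ℝ] E m →L[ℝ] E m) h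

/-- The variation `Σ + t Z` of a map into the jet coordinates. -/
def addLine (f : E m → J m) (Z : J m) (x : ℝ × E m) : J m := f x.2 + x.1 • Z

/-- The transformation of `addLine f Z` to normal coordinates. -/
def normalLine (f : E m → J m) (Z : J m) (z₀ : E m) (x : ℝ × E m) : J m :=
  (normalCoord (f z₀).2.2 z₀ x.2,
    normalJacobian (f z₀).2.2 z₀ x.2 * (addLine f Z x).2.1,
    gaugeGamma (normalJacobian (f z₀).2.2 z₀ x.2)
      (Ring.inverse (normalJacobian (f z₀).2.2 z₀ x.2)) (addLine f Z x).2.2 (f z₀).2.2)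

theorem hasFDerivAt_addLine {f : E m → J m} {Z : J m} {x : ℝ × E m}
    (hf : DifferentiableAt ℝ f x.2) :
    HasFDerivAt (addLine f Z) ((fderiv ℝ f x.2).comp (ContinuousLinearMap.snd ℝ ℝ (E m)) +
      (ContinuousLinearMap.fst ℝ ℝ (E m)).smulRight Z) x :=
  (hf.hasFDerivAt.comp x hasFDerivAt_snd).add (hasFDerivAt_fst.smul_const Z)

theorem normalJacobian_self (Γ₀ : E m →L[ℝ] E m →L[ℝ] E m) (z₀ : E m) :
    normalJacobian Γ₀ z₀ z₀ = 1 := by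
  have : Γ₀ (z₀ - z₀) = 0 := by rw [sub_self]; exact map_zero Γ₀
  rw [normalJacobian, this]
  exact add_zero _

theorem normalLine_gamma_eq_zero (f : E m → J m) (Z : J m) (z₀ : E m) :
    (normalLine f Z z₀ (0, z₀)).2.2 = 0 := by
  change gaugeGamma (normalJacobian (f z₀).2.2 z₀ z₀)
    (Ring.inverse (normalJacobian (f z₀).2.2 z₀ z₀)) (addLine f Z (0, z₀)).2.2 (f z₀).2.2 = 0
  rw [normalJacobian_self, Ring.inverse_one]
  have : (addLine f Z (0, z₀)).2.2 = (f z₀).2.2 := by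
    rw [addLine, zero_smul, add_zero]
  rw [this]
  ext u v
  simp [gaugeGamma]

/-- Symmetry of `Γ₀` makes `1 + Γ₀(z - z₀)` the Jacobian of an actual map, the quadratic
`normalCoord`. Verticality of `Z` keeps the base point of `Σ + tZ` independent of `t`. -/
theorem sameCanonicalForms_normalLine {f : E m → J m} {z₀ : E m}
    (hf : ∀ᶠ z in 𝓝 z₀, ContDiffAt ℝ ∞ f z ∧ IsUnit (f z).2.1 ∧ (f z).1 = z)
    (hsym : ∀ v w, (f z₀).2.2 v w = (f z₀).2.2 w v) {Z : J m} (hZ : Z.1 = 0) :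
    SameCanonicalForms (addLine f Z) (normalLine f Z z₀) (0, z₀) := by
  set Γ₀ := (f z₀).2.2 with hΓ₀
  have hsnd : Tendsto (fun x : ℝ × E m => x.2) (𝓝 (0, z₀)) (𝓝 z₀) := continuous_snd.tendsto _
  have hf' := hsnd.eventually hf.eventually_nhds
  have hadd : ∀ x : ℝ × E m, ContDiffAt ℝ ∞ f x.2 → ContDiffAt ℝ ∞ (addLine f Z) x := fun x hx =>
    (hx.comp x contDiffAt_snd).add (contDiffAt_fst.smul contDiffAt_const)
  have hunitF : ∀ᶠ x : ℝ × E m in 𝓝 (0, z₀), IsUnit (addLine f Z x).2.1 := by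
    have hc : ContinuousAt (fun x => de m (addLine f Z x)) (0, z₀) :=
      (de m).continuous.continuousAt.comp (hadd (0, z₀) hf.self_of_nhds.1).continuousAt
    refine hc.eventually_mem (Units.isOpen.mem_nhds ?_)
    have : addLine f Z (0, z₀) = f z₀ := by rw [addLine, zero_smul, add_zero]
    change IsUnit (addLine f Z (0, z₀)).2.1
    rw [this]
    exact hf.self_of_nhds.2.1
  have hunitA : ∀ᶠ x : ℝ × E m in 𝓝 (0, z₀), IsUnit (normalJacobian Γ₀ z₀ x.2) := by
    have hc : ContinuousAt (fun x : ℝ × E m => normalJacobian Γ₀ z₀ x.2) (0, z₀) :=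
      ((contDiff_normalJacobian Γ₀ z₀).continuous.comp continuous_snd).continuousAt
    refine hc.eventually_mem (Units.isOpen.mem_nhds ?_)
    change IsUnit (normalJacobian Γ₀ z₀ z₀)
    rw [normalJacobian_self]
    exact isUnit_one
  have hA : ∀ x : ℝ × E m, ContDiffAt ℝ ∞ (fun x : ℝ × E m => normalJacobian Γ₀ z₀ x.2) x :=
    fun x => (contDiff_normalJacobian Γ₀ z₀).contDiffAt.comp x contDiffAt_snd
  have h1 : ∀ x : ℝ × E m, ContDiffAt ℝ ∞ (fun x : ℝ × E m => normalCoord Γ₀ z₀ x.2) x :=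
    fun x => (contDiff_normalCoord Γ₀ z₀).contDiffAt.comp x contDiffAt_snd
  have h2 : ∀ x : ℝ × E m, ContDiffAt ℝ ∞ f x.2 →
      ContDiffAt ℝ ∞ (fun x => normalJacobian Γ₀ z₀ x.2 * (addLine f Z x).2.1) x := fun x hx =>
    (hA x).clm_comp ((de m).contDiff.contDiffAt.comp x (hadd x hx))
  have h3 : ∀ x : ℝ × E m, ContDiffAt ℝ ∞ f x.2 → IsUnit (normalJacobian Γ₀ z₀ x.2) →
      ContDiffAt ℝ ∞ (fun x => gaugeGamma (normalJacobian Γ₀ z₀ x.2)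
        (Ring.inverse (normalJacobian Γ₀ z₀ x.2)) (addLine f Z x).2.2 Γ₀) x := by
    intro x hx hu
    have hAi : ContDiffAt ℝ ∞ (fun x : ℝ × E m => Ring.inverse (normalJacobian Γ₀ z₀ x.2)) x := by
      obtain ⟨u, hu⟩ := hu
      have hi : ContDiffAt ℝ ∞ Ring.inverse (normalJacobian Γ₀ z₀ x.2) := by
        rw [← hu]; exact contDiffAt_ringInverse ℝ u
      exact ContDiffAt.comp (g := Ring.inverse)
        (f := fun x : ℝ × E m => normalJacobian Γ₀ z₀ x.2) x hi (hA x)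
    exact contDiffAt_gaugeGamma (V := E m) (hA x) hAi (contDiffAt_gamma (hadd x hx))
  refine sameCanonicalForms_of_transform (fun x => normalJacobian Γ₀ z₀ x.2)
    (fun _ v => Γ₀ v.2) ?_ ?_ ?_
  · filter_upwards [hf', hunitF] with x hx hu using ⟨hadd x hx.self_of_nhds.1, hu⟩
  · filter_upwards [hf', hunitA] with x hx hu
    exact (h1 x).prodMk ((h2 x hx.self_of_nhds.1).prodMk (h3 x hx.self_of_nhds.1 hu))
  · filter_upwards [hf', hunitA] with x hx hu
    refine ⟨hu, rfl, fun v => ?_⟩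
    have hfx := hx.self_of_nhds.1
    have hd : DifferentiableAt ℝ f x.2 := hfx.differentiableAt (by simp)
    have hF := hasFDerivAt_addLine (Z := Z) hd
    have hF1 : (fderiv ℝ (addLine f Z) x v).1 = v.2 := by
      have e1 : HasFDerivAt (fun z => dx m (f z)) ((dx m).comp (fderiv ℝ f x.2)) x.2 :=
        (dx m).hasFDerivAt.comp x.2 hd.hasFDerivAt
      have e2 : HasFDerivAt (fun z => dx m (f z)) (ContinuousLinearMap.id ℝ (E m)) x.2 :=
        (hasFDerivAt_id x.2).congr_of_eventuallyEq (hx.mono fun z hz => hz.2.2)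
      have e3 := congrArg (fun T : E m →L[ℝ] E m => T v.2) (e1.unique e2)
      rw [hF.fderiv]
      change (fderiv ℝ f x.2 v.2).1 + v.1 • Z.1 = v.2
      rw [hZ, smul_zero, add_zero]
      exact e3
    have hG : HasFDerivAt (normalLine f Z z₀) (fderiv ℝ (normalLine f Z z₀) x) x :=
      (((h1 x).prodMk ((h2 x hfx).prodMk (h3 x hfx hu))).differentiableAt (by simp)).hasFDerivAt
    have hG1 : (fderiv ℝ (normalLine f Z z₀) x v).1 = normalJacobian Γ₀ z₀ x.2 v.2 := by
      have e1 : HasFDerivAt (fun x => dx m (normalLine f Z z₀ x))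
        ((dx m).comp (fderiv ℝ (normalLine f Z z₀) x)) x := (dx m).hasFDerivAt.comp x hG
      have e2 := (hasFDerivAt_normalCoord hsym z₀ x.2).comp x
        (hasFDerivAt_snd (𝕜 := ℝ) (E := ℝ) (F := E m))
      exact congrArg (fun T : ℝ × E m →L[ℝ] E m => T v) (e1.unique e2)
    have hG2 : (fderiv ℝ (normalLine f Z z₀) x v).2.1 = Γ₀ v.2 * (addLine f Z x).2.1 +
        normalJacobian Γ₀ z₀ x.2 * (fderiv ℝ (addLine f Z) x v).2.1 := by
      have e1 : HasFDerivAt (fun x => de m (normalLine f Z z₀ x))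
        ((de m).comp (fderiv ℝ (normalLine f Z z₀) x)) x := (de m).hasFDerivAt.comp x hG
      have e2 : HasFDerivAt (fun x : ℝ × E m => normalJacobian Γ₀ z₀ x.2)
          (Γ₀.comp (ContinuousLinearMap.snd ℝ ℝ (E m))) x :=
        (Γ₀.hasFDerivAt.comp x (hasFDerivAt_snd.sub_const z₀)).const_add 1
      have e3 : HasFDerivAt (fun x => de m (addLine f Z x))
        ((de m).comp (fderiv ℝ (addLine f Z) x)) x :=
        (de m).hasFDerivAt.comp x hF.differentiableAt.hasFDerivAt
      have e4 := congrArg (fun T : ℝ × E m →L[ℝ] (E m →L[ℝ] E m) => T v)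
        (e1.unique (e2.clm_comp e3))
      refine Eq.trans e4 ?_
      exact add_comm _ _
    refine ⟨by rw [hG1, hF1], hG2, ?_⟩
    rw [hG1, hF1]
    exact gaugeGamma_apply _ _ _ _ (Ring.inverse_mul_cancel _ hu) v.2

/-- The field equations imply that the contraction of `d λ_L` with vertical vectors pulls back to
zero. -/
theorem contract_extDeriv_lagrangian_eq_zero {n : ℕ} (hr : n + 1 + (n + 1) ≤ m) {f : E m → J m}
    {z₀ : E m} (hf : ∀ᶠ z in 𝓝 z₀, ContDiffAt ℝ ∞ f z ∧ IsUnit (f z).2.1 ∧ (f z).1 = z)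
    (hsym : ∀ v w, (f z₀).2.2 v w = (f z₀).2.2 w v)
    (hmetric : ∀ i j, pullback f (omegaP i j) z₀ = 0)
    (heq : ∀ k i, pullback f (equationForm n k i) z₀ = 0) {Z : J m} (hZ : Z.1 = 0) :
    ((extDeriv (lagrangian n) (f z₀)).curryLeft Z).compContinuousLinearMap (fderiv ℝ f z₀) = 0 := by
  have hS := sameCanonicalForms_normalLine hf hsym hZ
  -- At `w₀ = (0, z₀)` the derivative of `F` sends `∂_t` to `Z` and spatial vectors to the tangent
  -- vectors of the section, so `dλ_L(Z, …)` can be evaluated through the gauge-fixed map `G`.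
  set F := addLine f Z with hFdef
  set G := normalLine f Z z₀ with hGdef
  set w₀ : ℝ × E m := (0, z₀) with hw₀
  have hF0 : F w₀ = f z₀ := by rw [hFdef, addLine, zero_smul, add_zero]
  have hfd : DifferentiableAt ℝ f z₀ := hf.self_of_nhds.1.differentiableAt (by simp)
  have hDF : fderiv ℝ F w₀ = (fderiv ℝ f z₀).comp (ContinuousLinearMap.snd ℝ ℝ (E m)) +
      (ContinuousLinearMap.fst ℝ ℝ (E m)).smulRight Z := (hasFDerivAt_addLine hfd).fderiv
  have hDF1 : fderiv ℝ F w₀ (1, 0) = Z := by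
    rw [hDF]
    change fderiv ℝ f z₀ 0 + (1 : ℝ) • Z = Z
    rw [map_zero, zero_add, one_smul]
  have hDF2 : ∀ u, fderiv ℝ F w₀ (0, u) = fderiv ℝ f z₀ u := fun u => by
    rw [hDF]
    change fderiv ℝ f z₀ u + (0 : ℝ) • Z = _
    rw [zero_smul, add_zero]
  have hΓ : (G w₀).2.2 = 0 := normalLine_gamma_eq_zero f Z z₀
  have hGu : IsUnit (G w₀).2.1 := hS.right.self_of_nhds.2
  have hω : ∀ v, omegaEnd (F w₀) (fderiv ℝ F w₀ v) = omegaEnd (G w₀) (fderiv ℝ G w₀ v) := by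
    intro v
    refine eq_of_mat_eq ?_
    ext i j
    exact congrArg (fun α : Form (ℝ × E m) 1 => α fun _ => v) (hS.omega.self_of_nhds i j)
  have hωG : ∀ v : J m, omegaEnd (G w₀) v = Ring.inverse (G w₀).2.1 * v.2.1 := by
    intro v
    rw [omegaEnd, hΓ]
    congr 1
    change v.2.1 + (0 : E m →L[ℝ] E m) * _ = _
    rw [zero_mul, add_zero]
  -- With `Γ = 0` the matrix `X` is the value of `ω`, which is the same for `F` and `G`; metricity
  -- makes `Xη + ηXᵀ` vanish.
  have hhor : ∀ u, fderiv ℝ (lagrangian n) (G w₀) (fderiv ℝ G w₀ (0, u)) = 0 := by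
    intro u
    rw [fderiv_lagrangian hr hGu hΓ, ← hωG, ← hω, hF0, hDF2, metric_of_pullback_omegaP hmetric]
    simp
  have heqG : ∀ k i (u : Fin ((m - (n + 1 + (n + 1))) + 2 * (n + 1)) → E m),
      equationForm n k i (G w₀) (fun a => fderiv ℝ G w₀ (0, u a)) = 0 := by
    intro k i u
    have h1 := congrArg (fun α : Form (ℝ × E m) _ => α fun a => (0, u a))
      (hS.pullback_equationForm n k i)
    have h2 : equationForm n k i (F w₀) (fun a => fderiv ℝ F w₀ (0, u a)) =
      equationForm n k i (G w₀) (fun a => fderiv ℝ G w₀ (0, u a)) := h1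
    rw [← h2, hF0]
    simp only [hDF2]
    exact congrArg (fun α : Form (E m) _ => α u) (heq k i)
  ext u
  have h1 := congrArg (fun α : Form (ℝ × E m) _ => α (Fin.cons (1, 0) fun a => (0, u a)))
    (hS.pullback_extDeriv_lagrangian n)
  have h2 : extDeriv (lagrangian n) (F w₀) (fun a => fderiv ℝ F w₀
      ((Fin.cons (1, 0) fun a => (0, u a) : Fin _ → ℝ × E m) a)) =
    extDeriv (lagrangian n) (G w₀) (fun a => fderiv ℝ G w₀
      ((Fin.cons (1, 0) fun a => (0, u a) : Fin _ → ℝ × E m) a)) := h1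
  have h3 : (fun a => fderiv ℝ F w₀ ((Fin.cons (1, 0) fun a => (0, u a) : Fin _ → ℝ × E m) a)) =
      Fin.cons Z fun a => fderiv ℝ f z₀ (u a) := by
    funext a
    induction a using Fin.cases with
    | zero => exact hDF1
    | succ a => exact hDF2 (u a)
  rw [h3, hF0] at h2
  change extDeriv (lagrangian n) (f z₀) (Fin.cons Z fun a => fderiv ℝ f z₀ (u a)) = 0
  -- Of the alternating sum only the derivative in the direction `∂_t` survives; it is a combination
  -- of equation forms on spatial vectors.
  rw [h2, extDeriv, ContinuousAlternatingMap.alternatizeUncurryFin_apply, Fin.sum_univ_succ]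
  have h4 : ∀ a, fderiv ℝ G w₀ ((Fin.cons (1, 0) fun a => (0, u a) :
      Fin _ → ℝ × E m) (Fin.succ a)) = fderiv ℝ G w₀ (0, u a) := fun a => rfl
  have h6 : ∀ v, (0 : Form (J m) ((m - (n + 1 + (n + 1))) + 2 * (n + 1))) v = 0 := fun _ => rfl
  simp only [h4, hhor, h6, smul_zero, Finset.sum_const_zero,
    add_zero]
  have h5 : Fin.removeNth 0 (fun a => fderiv ℝ G w₀
      ((Fin.cons (1, 0) fun a => (0, u a) : Fin _ → ℝ × E m) a)) =
      fun a => fderiv ℝ G w₀ (0, u a) := by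
    funext a
    rfl
  rw [h5, fderiv_lagrangian hr hGu hΓ]
  simp only [ContinuousAlternatingMap.smul_apply, ContinuousAlternatingMap.sum_apply, heqG,
    smul_zero, Finset.sum_const_zero]

end NormalGauge

/-! ### Coordinate expressions of jets and sections -/

section Charts

variable {m : ℕ} {M : Type*} [TopologicalSpace M] [ChartedSpace (E m) M]

theorem frameRep_apply (φ : Chart m M) (s : (y : M) → Frame (m := m) y) {x : M}
    (hx : x ∈ φ.1.source) : frameRep φ s (φ.1 x) = frameCoord φ (s x) := by
  rw [frameRep, φ.1.left_inv hx]

theorem Jet.exists_localFrame {x : M} (j : Jet (m := m) x) : ∃ L : LocalFrame (m := m) x,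
    j.frame = L.frame x ∧
      ∀ φ : Chart m M, x ∈ φ.1.source → j.deriv φ = fderiv ℝ (frameRep φ L.frame) (φ.1 x) := by
  obtain ⟨L, rfl⟩ := Quotient.exists_rep j
  exact ⟨L, rfl, fun φ hx => if_pos hx⟩

theorem LocalFrame.contDiffAt_frameRep {x : M} (L : LocalFrame (m := m) x) (φ : Chart m M)
    (hx : x ∈ φ.1.source) : ContDiffAt ℝ ∞ (frameRep φ L.frame) (φ.1 x) := by
  refine (L.smooth φ).contDiffAt
    ((φ.1.symm.isOpen_inter_preimage L.isOpen_dom).mem_nhds ⟨φ.1.map_source hx, ?_⟩)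
  change φ.1.symm (φ.1 x) ∈ L.dom
  rw [φ.1.left_inv hx]
  exact L.mem_dom

/-- The transition map between two charts. -/
def transition (φ ψ : Chart m M) (z : E m) : E m := ψ.1 (φ.1.symm z)

/-- The domain of the transition map between two charts. -/
def overlap (φ ψ : Chart m M) : Set (E m) := φ.1.target ∩ φ.1.symm ⁻¹' ψ.1.source

theorem isOpen_overlap (φ ψ : Chart m M) : IsOpen (overlap φ ψ) :=
  φ.1.symm.isOpen_inter_preimage ψ.1.open_source

theorem mem_overlap (φ ψ : Chart m M) {x : M} (hx : x ∈ φ.1.source) (hx' : x ∈ ψ.1.source) :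
    φ.1 x ∈ overlap φ ψ := by
  refine ⟨φ.1.map_source hx, ?_⟩
  rw [mem_preimage, φ.1.left_inv hx]
  exact hx'

theorem transition_mem_overlap (φ ψ : Chart m M) {z : E m} (hz : z ∈ overlap φ ψ) :
    transition φ ψ z ∈ overlap ψ φ :=
  mem_overlap ψ φ hz.2 (φ.1.map_target hz.1)

theorem symm_transition (φ ψ : Chart m M) {z : E m} (hz : z ∈ overlap φ ψ) :
    ψ.1.symm (transition φ ψ z) = φ.1.symm z := ψ.1.left_inv hz.2

theorem transition_transition (φ ψ : Chart m M) {z : E m} (hz : z ∈ overlap φ ψ) :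
    transition ψ φ (transition φ ψ z) = z := by
  rw [transition, symm_transition φ ψ hz, φ.1.right_inv hz.1]

theorem chart_mdifferentiable (φ : Chart m M) :
    φ.1.MDifferentiable (𝓡 m) (𝓡 m) :=
  ⟨(contMDiffOn_of_mem_maximalAtlas φ.2).mdifferentiableOn (by simp),
    (contMDiffOn_symm_of_mem_maximalAtlas φ.2).mdifferentiableOn (by simp)⟩

theorem isUnit_frameCoord [IsManifold (𝓡 m) ∞ M] (φ : Chart m M) {x : M} (hx : x ∈ φ.1.source)
    (u : Frame (m := m) x) :
    IsUnit (frameCoord φ u) := by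
  let e : E m ≃L[ℝ] E m := u.trans ((chart_mdifferentiable φ).mfderiv hx)
  have he : frameCoord φ u = (e : E m →L[ℝ] E m) := rfl
  rw [he]
  exact ⟨⟨e, e.symm, by ext v; simp, by ext v; simp⟩, rfl⟩

theorem contDiffOn_transition (φ ψ : Chart m M) :
    ContDiffOn ℝ ∞ (transition φ ψ) (overlap φ ψ) := by
  rw [← contMDiffOn_iff_contDiffOn]
  exact (contMDiffOn_of_mem_maximalAtlas ψ.2).comp
    ((contMDiffOn_symm_of_mem_maximalAtlas φ.2).mono inter_subset_left) fun z hz => hz.2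

theorem contDiffAt_transition (φ ψ : Chart m M) {z : E m} (hz : z ∈ overlap φ ψ) :
    ContDiffAt ℝ ∞ (transition φ ψ) z :=
  (contDiffOn_transition φ ψ).contDiffAt ((isOpen_overlap φ ψ).mem_nhds hz)

theorem frameCoord_transition (φ ψ : Chart m M) {x : M} (hx : x ∈ φ.1.source)
    (hx' : x ∈ ψ.1.source) (u : Frame (m := m) x) :
    frameCoord ψ u = fderiv ℝ (transition φ ψ) (φ.1 x) * frameCoord φ u := by
  have h1 : HasMFDerivAt (𝓡 m) (𝓡 m) φ.1 x (mfderiv (𝓡 m) (𝓡 m) φ.1 x) :=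
    ((chart_mdifferentiable φ).mdifferentiableAt hx).hasMFDerivAt
  have h2 : HasFDerivAt (transition φ ψ) (fderiv ℝ (transition φ ψ) (φ.1 x)) (φ.1 x) :=
    ((contDiffAt_transition φ ψ (mem_overlap φ ψ hx hx')).differentiableAt (by simp)).hasFDerivAt
  have h3 := (h2.hasMFDerivAt).comp x h1
  have h4 : HasMFDerivAt (𝓡 m) (𝓡 m) ψ.1 x
      ((fderiv ℝ (transition φ ψ) (φ.1 x)).comp (mfderiv (𝓡 m) (𝓡 m) φ.1 x)) := by
    refine h3.congr_of_eventuallyEq ?_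
    filter_upwards [φ.1.open_source.mem_nhds hx] with y hy
    exact (congrArg ψ.1 (φ.1.left_inv hy)).symm
  refine ContinuousLinearMap.ext fun v => ?_
  exact congrArg (fun T : E m →L[ℝ] E m => T (u v)) h4.mfderiv

theorem isUnit_fderiv_transition (φ ψ : Chart m M) {z : E m} (hz : z ∈ overlap φ ψ) :
    IsUnit (fderiv ℝ (transition φ ψ) z) := by
  have h : ∀ (φ ψ : Chart m M) {z : E m}, z ∈ overlap φ ψ →
      fderiv ℝ (transition ψ φ) (transition φ ψ z) * fderiv ℝ (transition φ ψ) z = 1 := by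
    intro φ ψ z hz
    have h1 := ((contDiffAt_transition φ ψ hz).differentiableAt (by simp)).hasFDerivAt
    have h2 := ((contDiffAt_transition ψ φ
      (transition_mem_overlap φ ψ hz)).differentiableAt (by simp)).hasFDerivAt
    refine (h2.comp z h1).unique ((hasFDerivAt_id z).congr_of_eventuallyEq ?_)
    filter_upwards [(isOpen_overlap φ ψ).mem_nhds hz] with y hy using transition_transition φ ψ hy
  have h' := h ψ φ (transition_mem_overlap φ ψ hz)
  rw [transition_transition φ ψ hz] at h'
  exact ⟨⟨_, _, h', h φ ψ hz⟩, rfl⟩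

/-- Both sides arise by differentiating `e' ∘ χ = Dχ · e`, where `χ` is the transition map and `e`,
`e'` represent a local frame field inducing the jet. -/
theorem Jet.deriv_transition (φ ψ : Chart m M) {x : M} (hx : x ∈ φ.1.source)
    (hx' : x ∈ ψ.1.source) (j : Jet (m := m) x) (v : E m) :
    j.deriv ψ (fderiv ℝ (transition φ ψ) (φ.1 x) v) =
      fderiv ℝ (fderiv ℝ (transition φ ψ)) (φ.1 x) v * frameCoord φ j.frame +
        fderiv ℝ (transition φ ψ) (φ.1 x) * j.deriv φ v := by
  obtain ⟨L, hL, hd⟩ := j.exists_localFrame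
  rw [hd φ hx, hd ψ hx', hL, ← frameRep_apply φ L.frame hx]
  have hz := mem_overlap φ ψ hx hx'
  have hχ := contDiffAt_transition φ ψ hz
  have h1 : HasFDerivAt (frameRep φ L.frame) (fderiv ℝ (frameRep φ L.frame) (φ.1 x)) (φ.1 x) :=
    ((L.contDiffAt_frameRep φ hx).differentiableAt (by simp)).hasFDerivAt
  have h2 : HasFDerivAt (frameRep ψ L.frame) (fderiv ℝ (frameRep ψ L.frame) (ψ.1 x)) (ψ.1 x) :=
    ((L.contDiffAt_frameRep ψ hx').differentiableAt (by simp)).hasFDerivAt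
  have h3 : HasFDerivAt (fderiv ℝ (transition φ ψ))
      (fderiv ℝ (fderiv ℝ (transition φ ψ)) (φ.1 x)) (φ.1 x) :=
    (((hχ.fderiv_right (m := ∞) (by simp))).differentiableAt (by simp)).hasFDerivAt
  have hψ : ψ.1 x = transition φ ψ (φ.1 x) := by rw [transition, φ.1.left_inv hx]
  rw [hψ] at h2 ⊢
  have h4 := h2.comp (φ.1 x) (hχ.differentiableAt (by simp)).hasFDerivAt
  have h5 := h3.clm_comp h1
  have h6 : frameRep ψ L.frame ∘ transition φ ψ =ᶠ[𝓝 (φ.1 x)]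
      fun z => (fderiv ℝ (transition φ ψ) z).comp (frameRep φ L.frame z) := by
    filter_upwards [(isOpen_overlap φ ψ).mem_nhds hz] with z hz
    have h := frameCoord_transition φ ψ (φ.1.map_target hz.1) hz.2 (L.frame (φ.1.symm z))
    rw [φ.1.right_inv hz.1] at h
    refine Eq.trans ?_ h
    exact frameRep_apply ψ L.frame hz.2
  have h7 := congrArg (fun T : E m →L[ℝ] (E m →L[ℝ] E m) => T v)
    ((h4.congr_of_eventuallyEq h6.symm).unique h5)
  refine Eq.trans h7 ?_
  exact add_comm _ _

theorem Jet.coord_gamma (φ : Chart m M) {x : M} (j : Jet (m := m) x) (v : E m) :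
    (j.coord φ).2.2 v = -(j.deriv φ v * Ring.inverse (frameCoord φ j.frame)) := rfl

theorem Jet.coord_gamma_transition [IsManifold (𝓡 m) ∞ M] (φ ψ : Chart m M) {x : M}
    (hx : x ∈ φ.1.source)
    (hx' : x ∈ ψ.1.source) (j : Jet (m := m) x) (v : E m) :
    (j.coord ψ).2.2 (fderiv ℝ (transition φ ψ) (φ.1 x) v) * fderiv ℝ (transition φ ψ) (φ.1 x) =
      fderiv ℝ (transition φ ψ) (φ.1 x) * (j.coord φ).2.2 v -
        fderiv ℝ (fderiv ℝ (transition φ ψ)) (φ.1 x) v := by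
  have hring : ∀ {R : Type} [Ring R] (A e e' d B D : R), IsUnit A → IsUnit e → e' = A * e →
      d = B * e + A * D →
      -(d * Ring.inverse e') * A = A * -(D * Ring.inverse e) - B := by
    rintro R _ A e e' d B D ⟨A, rfl⟩ ⟨e, rfl⟩ rfl rfl
    rw [← Units.val_mul, Ring.inverse_unit, Ring.inverse_unit, mul_inv_rev]
    simp [add_mul, mul_assoc, sub_eq_add_neg, add_comm]
  rw [Jet.coord_gamma, Jet.coord_gamma]
  exact hring _ _ _ _ _ _ (isUnit_fderiv_transition φ ψ (mem_overlap φ ψ hx hx'))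
    (isUnit_frameCoord φ hx j.frame) (frameCoord_transition φ ψ hx hx' j.frame)
    (j.deriv_transition φ ψ hx hx' v)

theorem T0.coord_mem [IsManifold (𝓡 m) ∞ M] (φ : Chart m M) {x : M} (hx : x ∈ φ.1.source)
    (q : T0 (m := m) x) :
    q.1.coord φ ∈ T0Coord m := by
  refine ⟨isUnit_frameCoord φ hx _, fun v w => ?_⟩
  rw [Jet.coord_gamma, Jet.coord_gamma]
  exact congrArg (fun u : E m => -u) (q.2 φ hx v w)

theorem T0Section.rep_mem [IsManifold (𝓡 m) ∞ M] (s : T0Section m M) (φ : Chart m M) {z : E m}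
    (hz : z ∈ φ.1.target) :
    s.rep φ z ∈ T0Coord m :=
  T0.coord_mem φ (φ.1.map_target hz) (s.toFun (φ.1.symm z))

theorem T0Section.rep_fst (s : T0Section m M) (φ : Chart m M) {z : E m} (hz : z ∈ φ.1.target) :
    (s.rep φ z).1 = z := φ.1.right_inv hz

theorem T0Section.contDiffAt_rep (s : T0Section m M) (φ : Chart m M) {z : E m}
    (hz : z ∈ φ.1.target) : ContDiffAt ℝ ∞ (s.rep φ) z :=
  (s.smooth φ).contDiffAt (φ.1.open_target.mem_nhds hz)

theorem T0Section.eventually_rep [IsManifold (𝓡 m) ∞ M] (s : T0Section m M) (φ : Chart m M)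
    {z : E m}
    (hz : z ∈ φ.1.target) :
    ∀ᶠ z in 𝓝 z, ContDiffAt ℝ ∞ (s.rep φ) z ∧ IsUnit (s.rep φ z).2.1 ∧ (s.rep φ z).1 = z := by
  filter_upwards [φ.1.open_target.mem_nhds hz] with z hz
    using ⟨s.contDiffAt_rep φ hz, (s.rep_mem φ hz).1, s.rep_fst φ hz⟩

theorem T0Section.rep_transition_eq (s : T0Section m M) (φ ψ : Chart m M) {z : E m}
    (hz : z ∈ overlap φ ψ) :
    s.rep ψ (transition φ ψ z) = (s.toFun (φ.1.symm z)).1.coord ψ := by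
  change ((s.toFun (ψ.1.symm (transition φ ψ z))).1.coord ψ) = _
  rw [symm_transition φ ψ hz]

theorem T0Section.rep_frame_transition (s : T0Section m M) (φ ψ : Chart m M) {z : E m}
    (hz : z ∈ overlap φ ψ) :
    (s.rep ψ (transition φ ψ z)).2.1 = fderiv ℝ (transition φ ψ) z * (s.rep φ z).2.1 := by
  rw [s.rep_transition_eq φ ψ hz]
  have h := frameCoord_transition φ ψ (φ.1.map_target hz.1) hz.2 (s.toFun (φ.1.symm z)).1.frame
  rw [φ.1.right_inv hz.1] at h
  exact h

theorem T0Section.rep_gamma_transition [IsManifold (𝓡 m) ∞ M] (s : T0Section m M) (φ ψ : Chart m M)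
    {z : E m}
    (hz : z ∈ overlap φ ψ) (v : E m) :
    (s.rep ψ (transition φ ψ z)).2.2 (fderiv ℝ (transition φ ψ) z v) *
        fderiv ℝ (transition φ ψ) z =
      fderiv ℝ (transition φ ψ) z * (s.rep φ z).2.2 v -
        fderiv ℝ (fderiv ℝ (transition φ ψ)) z v := by
  rw [s.rep_transition_eq φ ψ hz]
  have h := (s.toFun (φ.1.symm z)).1.coord_gamma_transition φ ψ (φ.1.map_target hz.1) hz.2 v
  rw [φ.1.right_inv hz.1] at h
  exact h

/-- The field equations in coordinates. -/
theorem T0Section.contract_extDeriv_lagrangian [IsManifold (𝓡 m) ∞ M] {n : ℕ}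
    (hr : n + 1 + (n + 1) ≤ m)
    {s : T0Section m M} (hmetric : s.Metric) (heq : s.LovelockEquations n) (φ : Chart m M)
    {z : E m} (hz : z ∈ φ.1.target) {Z : J m} (hZ : Z.1 = 0) :
    ((extDeriv (lagrangian n) (s.rep φ z)).curryLeft Z).compContinuousLinearMap
      (fderiv ℝ (s.rep φ) z) = 0 :=
  contract_extDeriv_lagrangian_eq_zero hr (s.eventually_rep φ hz) (s.rep_mem φ hz).2
    (fun i j => hmetric i j φ z hz) (fun k i => heq k i φ z hz) hZ

end Charts

/-! ### Forms on `ℝ × V` -/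

section ProductForms

variable {V : Type*} [NormedAddCommGroup V] [NormedSpace ℝ V] {N : ℕ}

/-- The vectors `∂_t, v₁, …, v_N` with `v_i` left out. -/
def omitVec (v : Fin N → V) (i : Fin N) : Fin N → ℝ × V :=
  i.succ.removeNth (Fin.cons (1, 0) fun a => (0, v a) : Fin (N + 1) → ℝ × V)

/-- The value of `l ∧ ι_{∂_t} Λ` on `v₁, …, v_N`. -/
def fluxForm (Λ : Form (ℝ × V) N) (l : V →L[ℝ] ℝ) (v : Fin N → V) : ℝ :=
  ∑ i : Fin N, (-1) ^ (i : ℕ) * (l (v i) * Λ (omitVec v i))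

theorem fluxForm_comp {U : Type*} [NormedAddCommGroup U] [NormedSpace ℝ U] (Λ : Form (ℝ × V) N)
    (l : V →L[ℝ] ℝ) (A : U →L[ℝ] V) (v : Fin N → U) :
    fluxForm (Λ.compContinuousLinearMap ((ContinuousLinearMap.id ℝ ℝ).prodMap A)) (l.comp A) v =
      fluxForm Λ l fun a => A (v a) := by
  refine Finset.sum_congr rfl fun i _ => ?_
  congr 2
  change Λ _ = Λ _
  congr 1
  funext b
  simp only [omitVec, Fin.removeNth]
  generalize i.succ.succAbove b = c
  induction c using Fin.cases <;> simp

theorem fluxForm_sum {ι : Type*} (s : Finset ι) (Λ : Form (ℝ × V) N) (l : ι → V →L[ℝ] ℝ)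
    (v : Fin N → V) : fluxForm Λ (∑ j ∈ s, l j) v = ∑ j ∈ s, fluxForm Λ (l j) v := by
  simp only [fluxForm, _root_.sum_apply, Finset.sum_mul, Finset.mul_sum]
  exact Finset.sum_comm

/-- On spatial vectors the expression is `-ι_{∂_t}(l ∧ Λ)`, because `l` annihilates `∂_t`.
Alternation is what yields the determinant rule in top degree. -/
theorem exists_alternatingMap_fluxForm (Λ : Form (ℝ × V) N) (l : V →L[ℝ] ℝ) :
    ∃ f : V [⋀^Fin N]→ₗ[ℝ] ℝ, ∀ v, f v = fluxForm Λ l v := by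
  let g : (ℝ × V) →L[ℝ] Form (ℝ × V) N := (l.comp (ContinuousLinearMap.snd ℝ ℝ V)).smulRight Λ
  let h : Form V N := (-(ContinuousAlternatingMap.alternatizeUncurryFin g).curryLeft
    (1, 0)).compContinuousLinearMap (ContinuousLinearMap.inr ℝ ℝ V)
  refine ⟨h.toAlternatingMap, fun v => ?_⟩
  change -(ContinuousAlternatingMap.alternatizeUncurryFin g
    (Fin.cons (1, 0) fun a => (0, v a))) = _
  rw [ContinuousAlternatingMap.alternatizeUncurryFin_apply, Fin.sum_univ_succ, fluxForm, neg_add,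
    ← Finset.sum_neg_distrib]
  have h0 : g (1, 0) = 0 := by simp [g]
  have h1 : ∀ i : Fin N, g (0, v i) (omitVec v i) = l (v i) * Λ (omitVec v i) := fun i => rfl
  have h2 : (0 : Form (ℝ × V) N) (Fin.removeNth 0 (Fin.cons (1, 0) fun a => (0, v a) :
      Fin (N + 1) → ℝ × V)) = 0 := rfl
  simp only [Fin.cons_zero, h0, h2, smul_zero, neg_zero, zero_add, Fin.cons_succ]
  refine Finset.sum_congr rfl fun i _ => ?_
  rw [← h1, omitVec, Fin.val_succ, pow_succ]
  simp

theorem fluxForm_comp_basis (Λ : Form (ℝ × V) N) (l : V →L[ℝ] ℝ) (b : Module.Basis (Fin N) ℝ V)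
    (A : V →L[ℝ] V) :
    fluxForm (Λ.compContinuousLinearMap ((ContinuousLinearMap.id ℝ ℝ).prodMap A)) (l.comp A) b =
      A.det * fluxForm Λ l b := by
  obtain ⟨f, hf⟩ := exists_alternatingMap_fluxForm Λ l
  rw [fluxForm_comp, ← hf, ← hf, f.eq_smul_basis_det b]
  have := b.det_comp (A : V →ₗ[ℝ] V) b
  simp only [AlternatingMap.smul_apply, smul_eq_mul]
  rw [b.det_self, mul_one, mul_comm, ← mul_one (ContinuousLinearMap.det A), ← b.det_self]
  exact congrArg (· * f b) this

/-- The directions are constant, so no bracket terms occur. A vanishing left side expresses the time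
derivative as a spatial divergence. -/
theorem extDeriv_apply_cons {Λ : ℝ × V → Form (ℝ × V) N} {w : ℝ × V}
    (h : DifferentiableAt ℝ Λ w) (v : Fin N → V) :
    extDeriv Λ w (Fin.cons (1, 0) fun a => (0, v a)) =
      fderiv ℝ (fun p => Λ p fun a => (0, v a)) w (1, 0) -
        ∑ i : Fin N, (-1) ^ (i : ℕ) * fderiv ℝ (fun p => Λ p (omitVec v i)) w (0, v i) := by
  rw [extDeriv_apply h, Fin.sum_univ_succ, sub_eq_add_neg, ← Finset.sum_neg_distrib]
  congr 1
  · simp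
  · refine Finset.sum_congr rfl fun i _ => ?_
    rw [Fin.val_succ, pow_succ, Fin.cons_succ]
    simp [omitVec]

theorem contDiffAt_compContinuousLinearMap_apply {U W : Type*} [NormedAddCommGroup U]
    [NormedSpace ℝ U] [NormedAddCommGroup W] [NormedSpace ℝ W] {k : ℕ} {p : WithTop ℕ∞}
    {α : W → Form V k} {g : W → U →L[ℝ] V} {x : W} (hα : ContDiffAt ℝ p α x)
    (hg : ContDiffAt ℝ p g x) (v : Fin k → U) :
    ContDiffAt ℝ p (fun x => (α x).compContinuousLinearMap (g x) v) x := by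
  have h1 : ContDiffAt ℝ p (fun x => (α x).toContinuousMultilinearMap) x :=
    ContDiffAt.comp (g := ContinuousAlternatingMap.toContinuousMultilinearMapLI (𝕜 := ℝ) (E := V)
      (F := ℝ) (ι := Fin k)) x (LinearIsometry.contDiff _).contDiffAt hα
  have h2 : ContDiffAt ℝ p (fun x =>
      ContinuousMultilinearMap.compContinuousLinearMapContinuousMultilinear ℝ (fun _ : Fin k => U) (fun _ : Fin k => V) ℝ fun _ => g x) x :=
    (ContinuousMultilinearMap.contDiff _).contDiffAt.comp x (contDiffAt_pi.2 fun _ => hg)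
  have h3 := h2.clm_apply h1
  exact (ContinuousMultilinearMap.apply ℝ (fun _ : Fin k => U) ℝ v).contDiff.contDiffAt.comp x h3

end ProductForms

/-! ### Integrals over open sets of functions with compact support -/

section Integrals

variable {V : Type*} [NormedAddCommGroup V] [NormedSpace ℝ V] [MeasurableSpace V] [BorelSpace V]
  {μ : Measure V}

theorem integrableOn_of_eq_zero_off_compact {V : Type*} [NormedAddCommGroup V] [MeasurableSpace V]
    [BorelSpace V] {μ : Measure V} [IsFiniteMeasureOnCompacts μ] {U C : Set V}
    (hU : IsOpen U) (hC : IsCompact C)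
    {f : V → ℝ} (hf : ContinuousOn f C) (h0 : ∀ z ∈ U \ C, f z = 0) : IntegrableOn f U μ :=
  (hf.integrableOn_compact hC).of_forall_sdiff_eq_zero hU.measurableSet h0

/-- Extension by zero is `C¹` on the whole space because the support stays inside `C`, a compact
subset of `U`; then integration by parts against the constant function 1. -/
theorem setIntegral_fderiv_eq_zero [FiniteDimensional ℝ V] [μ.IsAddHaarMeasure] {U C : Set V}
    (hU : IsOpen U) (hC : IsCompact C) (hCU : C ⊆ U)
    {f : V → ℝ} (hf : ContDiffOn ℝ 1 f U) (h0 : ∀ z ∈ U \ C, f z = 0) (v : V) :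
    ∫ z in U, fderiv ℝ f z v ∂μ = 0 := by
  set g : V → ℝ := U.indicator f with hg
  have hgU : ∀ z ∈ U, g =ᶠ[𝓝 z] f := fun z hz => by
    filter_upwards [hU.mem_nhds hz] with y hy using indicator_of_mem hy f
  have hgC : ∀ z ∉ C, g =ᶠ[𝓝 z] fun _ => 0 := fun z hz => by
    filter_upwards [hC.isClosed.isOpen_compl.mem_nhds hz] with y hy
    by_cases hyU : y ∈ U
    · rw [hg, indicator_of_mem hyU, h0 y ⟨hyU, hy⟩]
    · rw [hg, indicator_of_notMem hyU]
  have hgd : ContDiff ℝ 1 g := by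
    rw [contDiff_iff_contDiffAt]
    intro z
    by_cases hz : z ∈ U
    · exact (hf.contDiffAt (hU.mem_nhds hz)).congr_of_eventuallyEq (hgU z hz)
    · exact contDiffAt_const.congr_of_eventuallyEq (hgC z fun h => hz (hCU h))
  have hsupp : HasCompactSupport g :=
    HasCompactSupport.intro hC fun z hz => (hgC z hz).self_of_nhds
  have hcont : Continuous fun z => fderiv ℝ g z v :=
    (hgd.continuous_fderiv one_ne_zero).clm_apply continuous_const
  have hint : Integrable (fun z => fderiv ℝ g z v) μ :=
    hcont.integrable_of_hasCompactSupport (hsupp.fderiv_apply ℝ v)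
  have h1 : ∫ z, fderiv ℝ g z v ∂μ = 0 := by
    have := integral_mul_fderiv_eq_neg_fderiv_mul_of_integrable (μ := μ) (f := g)
      (g := fun _ => (1 : ℝ)) (v := v) (by simpa using hint) (by simp)
      (by simpa using hgd.continuous.integrable_of_hasCompactSupport hsupp)
      (fun z _ => hgd.differentiable one_ne_zero z) (fun z _ => differentiableAt_const _)
    simpa using this
  rw [← h1, ← setIntegral_eq_integral_of_forall_compl_eq_zero (s := U)
    (f := fun z => fderiv ℝ g z v)]
  · exact setIntegral_congr_fun hU.measurableSet fun z hz => by
      rw [(hgU z hz).fderiv_eq]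
  · intro z hz
    rw [(hgC z fun h => hz (hCU h)).fderiv_eq]
    simp

theorem hasDerivAt_setIntegral_compact [IsFiniteMeasureOnCompacts μ] {ε : ℝ} (hε : 0 < ε)
    {U C : Set V} (hU : IsOpen U) (hC : IsCompact C) (hCU : C ⊆ U) {g : ℝ × V → ℝ} {c : V → ℝ}
    (hg : ContDiffOn ℝ 1 g (Ioo (-ε) ε ×ˢ U)) (hc : ContinuousOn c C) :
    HasDerivAt (fun t => ∫ z in C, c z * g (t, z) ∂μ)
      (∫ z in C, c z * fderiv ℝ g (0, z) (1, 0) ∂μ) 0 := by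
  have hopen : IsOpen (Ioo (-ε) ε ×ˢ U) := isOpen_Ioo.prod hU
  have hsub : ∀ t ∈ Icc (-(ε / 2)) (ε / 2), t ∈ Ioo (-ε) ε := fun t ht =>
    ⟨by linarith [ht.1], by linarith [ht.2]⟩
  have hgt : ∀ t ∈ Icc (-(ε / 2)) (ε / 2), ContinuousOn (fun z => c z * g (t, z)) C := fun t ht =>
    hc.mul (hg.continuousOn.comp (by fun_prop) fun z hz => ⟨hsub t ht, hCU hz⟩)
  have hd : ContinuousOn (fun p : ℝ × V => c p.2 * fderiv ℝ g p (1, 0))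
      (Icc (-(ε / 2)) (ε / 2) ×ˢ C) := by
    refine (hc.comp continuousOn_snd fun p hp => hp.2).mul ?_
    exact ((hg.continuousOn_fderiv_of_isOpen hopen le_rfl).mono fun p hp =>
      ⟨hsub _ hp.1, hCU hp.2⟩).clm_apply continuousOn_const
  -- Halving the time interval gives a compact set on which the continuous derivative is bounded;
  -- the constant bound is the dominating function.
  obtain ⟨B, hB⟩ := (isCompact_Icc.prod hC).exists_bound_of_continuousOn hd
  have hnhds : Icc (-(ε / 2)) (ε / 2) ∈ 𝓝 (0 : ℝ) := Icc_mem_nhds (by linarith) (by linarith)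
  have h0 : (0 : ℝ) ∈ Icc (-(ε / 2)) (ε / 2) := mem_of_mem_nhds hnhds
  refine (hasDerivAt_integral_of_dominated_loc_of_deriv_le (bound := fun _ => B)
    (F' := fun t z => c z * fderiv ℝ g (t, z) (1, 0)) hnhds ?_ ?_ ?_ ?_ ?_ ?_).2
  · filter_upwards [hnhds] with t ht
      using ((hgt t ht).integrableOn_compact hC).aestronglyMeasurable
  · exact (hgt 0 h0).integrableOn_compact hC
  · exact ((hd.comp (f := fun z => ((0 : ℝ), z)) (by fun_prop)
      fun z hz => ⟨h0, hz⟩).integrableOn_compact hC).aestronglyMeasurable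
  · filter_upwards [ae_restrict_mem hC.measurableSet] with z hz t ht using hB (t, z) ⟨ht, hz⟩
  · exact integrableOn_const hC.measure_lt_top.ne
  · filter_upwards [ae_restrict_mem hC.measurableSet] with z hz t ht
    have h1 : HasFDerivAt g (fderiv ℝ g (t, z)) (t, z) :=
      ((hg.contDiffAt (hopen.mem_nhds ⟨hsub t ht, hCU hz⟩)).differentiableAt
        one_ne_zero).hasFDerivAt
    have h2 : HasDerivAt (fun s : ℝ => (s, z)) ((1 : ℝ), (0 : V)) t :=
      (hasDerivAt_id t).prodMk (hasDerivAt_const t z)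
    exact (h1.comp_hasDerivAt t h2).const_mul (c z)

end Integrals

/-! ### Signs of nonvanishing functions -/

theorem sign_eq_of_continuousOn {s : Set ℝ} (hs : IsPreconnected s) {f : ℝ → ℝ}
    (hf : ContinuousOn f s) (h0 : ∀ t ∈ s, f t ≠ 0) {a b : ℝ} (ha : a ∈ s) (hb : b ∈ s) :
    Real.sign (f a) = Real.sign (f b) := by
  have key : ∀ a ∈ s, ∀ b ∈ s, f a < 0 → 0 < f b → False := fun a ha b hb h1 h2 => by
    obtain ⟨t, ht, h⟩ := hs.intermediate_value ha hb hf ⟨h1.le, h2.le⟩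
    exact h0 t ht h
  rcases lt_or_gt_of_ne (h0 a ha) with h1 | h1 <;> rcases lt_or_gt_of_ne (h0 b hb) with h2 | h2
  · rw [Real.sign_of_neg h1, Real.sign_of_neg h2]
  · exact (key a ha b hb h1 h2).elim
  · exact (key b hb a ha h2 h1).elim
  · rw [Real.sign_of_pos h1, Real.sign_of_pos h2]

theorem eventually_sign_eq {X : Type*} [TopologicalSpace X] {f : X → ℝ} {x : X}
    (hf : ContinuousAt f x) (h0 : f x ≠ 0) : ∀ᶠ y in 𝓝 x, Real.sign (f y) = Real.sign (f x) := by
  rcases lt_or_gt_of_ne h0 with h | h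
  · filter_upwards [hf.eventually_lt continuousAt_const h] with y hy
    rw [Real.sign_of_neg hy, Real.sign_of_neg h]
  · filter_upwards [continuousAt_const.eventually_lt hf h] with y hy
    rw [Real.sign_of_pos hy, Real.sign_of_pos h]

/-- With `a` a Jacobian and `b` a frame determinant, this turns the signed factor in the
transformation of forms into the absolute value needed for a change of variables. -/
theorem sign_mul_self_eq_abs (a b : ℝ) (ha : a ≠ 0) :
    Real.sign b * a = |a| * Real.sign (a * b) := by
  rcases lt_or_gt_of_ne ha with h | h
  · rcases lt_trichotomy b 0 with h' | rfl | h'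
    · rw [Real.sign_of_neg h', Real.sign_of_pos (mul_pos_of_neg_of_neg h h'), abs_of_neg h]; ring
    · simp
    · rw [Real.sign_of_pos h', Real.sign_of_neg (mul_neg_of_neg_of_pos h h'), abs_of_neg h]; ring
  · rcases lt_trichotomy b 0 with h' | rfl | h'
    · rw [Real.sign_of_neg h', Real.sign_of_neg (mul_neg_of_pos_of_neg h h'), abs_of_pos h]; ring
    · simp
    · rw [Real.sign_of_pos h', Real.sign_of_pos (mul_pos h h'), abs_of_pos h]; ring

/-! ### Variations of sections -/

section Variations

variable {m : ℕ} {M : Type*} [TopologicalSpace M] [ChartedSpace (E m) M]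

/-- The coordinate expression of a family of sections, as a function of time and position. -/
def varRep (S : ℝ → T0Section m M) (φ : Chart m M) (p : ℝ × E m) : J m := (S p.1).rep φ p.2

/-- The pullback of the Lovelock Lagrangian along a family of sections, as a form on `ℝ × ℝ^m`. -/
def varLag (n : ℕ) (S : ℝ → T0Section m M) (φ : Chart m M) :
    (p : ℝ × E m) → Form (ℝ × E m) ((m - (n + 1 + (n + 1))) + 2 * (n + 1)) :=
  pullback (varRep S φ) (lagrangian n)

/-- Smooth families of sections. -/
def SmoothFamily (ε : ℝ) (S : ℝ → T0Section m M) : Prop :=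
  ∀ φ : Chart m M, ContDiffOn ℝ ∞ (varRep S φ) (Ioo (-ε) ε ×ˢ φ.1.target)

variable {ε : ℝ} {S : ℝ → T0Section m M}

theorem SmoothFamily.contDiffAt (hS : SmoothFamily ε S) (φ : Chart m M) {p : ℝ × E m}
    (hp : p ∈ Ioo (-ε) ε ×ˢ φ.1.target) : ContDiffAt ℝ ∞ (varRep S φ) p :=
  (hS φ).contDiffAt ((isOpen_Ioo.prod φ.1.open_target).mem_nhds hp)

theorem SmoothFamily.fderiv_fst (hS : SmoothFamily ε S) (φ : Chart m M) {p : ℝ × E m}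
    (hp : p ∈ Ioo (-ε) ε ×ˢ φ.1.target) (v : ℝ × E m) :
    (fderiv ℝ (varRep S φ) p v).1 = v.2 := by
  have h1 : HasFDerivAt (fun p => dx m (varRep S φ p)) ((dx m).comp (fderiv ℝ (varRep S φ) p)) p :=
    (dx m).hasFDerivAt.comp p ((hS.contDiffAt φ hp).differentiableAt (by simp)).hasFDerivAt
  have h2 : HasFDerivAt (fun p => dx m (varRep S φ p)) (ContinuousLinearMap.snd ℝ ℝ (E m)) p := by
    refine hasFDerivAt_snd.congr_of_eventuallyEq ?_
    filter_upwards [(isOpen_Ioo.prod φ.1.open_target).mem_nhds hp] with q hq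
      using (S q.1).rep_fst φ hq.2
  exact congrArg (fun T : ℝ × E m →L[ℝ] E m => T v) (h1.unique h2)

theorem SmoothFamily.fderiv_rep (hS : SmoothFamily ε S) (φ : Chart m M) {t : ℝ} {z : E m}
    (hp : (t, z) ∈ Ioo (-ε) ε ×ˢ φ.1.target) (v : E m) :
    fderiv ℝ ((S t).rep φ) z v = fderiv ℝ (varRep S φ) (t, z) (0, v) := by
  have h1 := ((hS.contDiffAt φ hp).differentiableAt (by simp)).hasFDerivAt.comp z
    (hasFDerivAt_prodMk_right (𝕜 := ℝ) t z)
  exact congrArg (fun T : E m →L[ℝ] J m => T v) h1.fderiv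

theorem SmoothFamily.pullback_rep (hS : SmoothFamily ε S) (n : ℕ) (φ : Chart m M) {t : ℝ} {z : E m}
    (hp : (t, z) ∈ Ioo (-ε) ε ×ˢ φ.1.target)
    (v : Fin ((m - (n + 1 + (n + 1))) + 2 * (n + 1)) → E m) :
    pullback ((S t).rep φ) (lagrangian n) z v = varLag n S φ (t, z) fun a => (0, v a) := by
  change lagrangian n (varRep S φ (t, z)) (fun a => fderiv ℝ ((S t).rep φ) z (v a)) =
    lagrangian n (varRep S φ (t, z)) (fun a => fderiv ℝ (varRep S φ) (t, z) (0, v a))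
  simp only [hS.fderiv_rep φ hp]

/-- The point is held fixed while `t` varies, so no neighbourhood in `M` is needed and boundary
points of `K` cause no difficulty. -/
theorem SmoothFamily.fderiv_time_eq_zero (hS : SmoothFamily ε S) {K : Set M}
    (hoff : ∀ t ∈ Ioo (-ε) ε, ∀ x ∉ K, (S t).toFun x = (S 0).toFun x) (φ : Chart m M)
    {t : ℝ} {z : E m} (hp : (t, z) ∈ Ioo (-ε) ε ×ˢ φ.1.target) (hz : φ.1.symm z ∉ K) :
    fderiv ℝ (varRep S φ) (t, z) (1, 0) = 0 := by
  have h1 := ((hS.contDiffAt φ hp).differentiableAt (by simp)).hasFDerivAt.comp t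
    (hasFDerivAt_prodMk_left (𝕜 := ℝ) t z)
  have h2 : HasFDerivAt (varRep S φ ∘ fun t => (t, z)) (0 : ℝ →L[ℝ] J m) t := by
    refine (hasFDerivAt_const (varRep S φ (0, z)) t).congr_of_eventuallyEq ?_
    filter_upwards [isOpen_Ioo.mem_nhds hp.1] with u hu
    exact congrArg (fun q : T0 (m := m) (φ.1.symm z) => q.1.coord φ) (hoff u hu _ hz)
  exact congrArg (fun T : ℝ →L[ℝ] J m => T 1) (h1.unique h2)

theorem SmoothFamily.varLag_omitVec_eq_zero (hS : SmoothFamily ε S) {K : Set M}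
    (hoff : ∀ t ∈ Ioo (-ε) ε, ∀ x ∉ K, (S t).toFun x = (S 0).toFun x) (n : ℕ) (φ : Chart m M)
    {t : ℝ} {z : E m} (hp : (t, z) ∈ Ioo (-ε) ε ×ˢ φ.1.target) (hz : φ.1.symm z ∉ K)
    (v : Fin ((m - (n + 1 + (n + 1))) + 2 * (n + 1)) → E m)
    (i : Fin ((m - (n + 1 + (n + 1))) + 2 * (n + 1))) :
    varLag n S φ (t, z) (omitVec v i) = 0 := by
  -- Omitting a spatial vector leaves `∂_t` in slot 0, and its image vanishes.
  refine ContinuousAlternatingMap.map_coord_zero (lagrangian n (varRep S φ (t, z)))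
    (⟨0, i.pos⟩ : Fin ((m - (n + 1 + (n + 1))) + 2 * (n + 1))) ?_
  exact hS.fderiv_time_eq_zero hoff φ hp hz

variable [IsManifold (𝓡 m) ∞ M]

theorem SmoothFamily.contDiffAt_varLag_apply (hS : SmoothFamily ε S) (n : ℕ) (φ : Chart m M)
    {p : ℝ × E m} (hp : p ∈ Ioo (-ε) ε ×ˢ φ.1.target)
    (v : Fin ((m - (n + 1 + (n + 1))) + 2 * (n + 1)) → ℝ × E m) :
    ContDiffAt ℝ ∞ (fun p => varLag n S φ p v) p := by
  have h := hS.contDiffAt φ hp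
  exact contDiffAt_compContinuousLinearMap_apply
    ((contDiffAt_lagrangian n ((S p.1).rep_mem φ hp.2).1).comp p h)
    (h.fderiv_right (m := ∞) (by simp)) v

theorem SmoothFamily.differentiableAt_varLag (hS : SmoothFamily ε S) (n : ℕ) (φ : Chart m M)
    {p : ℝ × E m} (hp : p ∈ Ioo (-ε) ε ×ˢ φ.1.target) : DifferentiableAt ℝ (varLag n S φ) p := by
  have h := hS.contDiffAt φ hp
  have h1 : DifferentiableAt ℝ (fun p => lagrangian n (varRep S φ p)) p :=
    (ContDiffAt.comp (g := lagrangian n) p (contDiffAt_lagrangian n ((S p.1).rep_mem φ hp.2).1)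
      h).differentiableAt (by simp)
  have h2 : DifferentiableAt ℝ (fderiv ℝ (varRep S φ)) p :=
    (h.fderiv_right (m := ∞) (by simp)).differentiableAt (by simp)
  exact (h1.hasFDerivAt.continuousAlternatingMapCompContinuousLinearMap
    h2.hasFDerivAt).differentiableAt

/-- All sections in the family lie over the same base points, so the velocity `∂_t Σ_t` is vertical
and the field equations apply to it. -/
theorem SmoothFamily.extDeriv_varLag (hS : SmoothFamily ε S) {n : ℕ} (hr : n + 1 + (n + 1) ≤ m)
    (hε : 0 < ε) (hmetric : (S 0).Metric) (heq : (S 0).LovelockEquations n) (φ : Chart m M)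
    {z : E m} (hz : z ∈ φ.1.target)
    (v : Fin ((m - (n + 1 + (n + 1))) + 2 * (n + 1)) → E m) :
    extDeriv (varLag n S φ) (0, z) (Fin.cons (1, 0) fun a => (0, v a)) = 0 := by
  have hp : ((0 : ℝ), z) ∈ Ioo (-ε) ε ×ˢ φ.1.target := ⟨⟨by linarith, hε⟩, hz⟩
  rw [varLag, extDeriv_pullback_of_contDiffAt (F := varRep S φ) (w := (0, z))
    (contDiffAt_lagrangian n ((S 0).rep_mem φ hz).1) (hS.contDiffAt φ hp)]
  have h := congrArg (fun α : Form (E m) _ => α v)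
    (T0Section.contract_extDeriv_lagrangian hr hmetric heq φ hz
      (hS.fderiv_fst φ hp (1, 0)))
  refine Eq.trans ?_ h
  change extDeriv (lagrangian n) (varRep S φ (0, z)) _ =
    extDeriv (lagrangian n) (varRep S φ (0, z)) _
  congr 1
  funext a
  induction a using Fin.cases with
  | zero => rfl
  | succ a => exact (hS.fderiv_rep φ hp (v a)).symm

theorem SmoothFamily.sameCanonicalForms_transition (hS : SmoothFamily ε S) (φ ψ : Chart m M)
    {p : ℝ × E m} (hp : p ∈ Ioo (-ε) ε ×ˢ overlap φ ψ) :
    SameCanonicalForms (varRep S φ) (fun p => varRep S ψ (p.1, transition φ ψ p.2)) p := by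
  have hmem : ∀ᶠ q in 𝓝 p, q ∈ Ioo (-ε) ε ×ˢ overlap φ ψ :=
    (isOpen_Ioo.prod (isOpen_overlap φ ψ)).mem_nhds hp
  have h1 : ∀ q ∈ Ioo (-ε) ε ×ˢ overlap φ ψ, ContDiffAt ℝ ∞ (varRep S φ) q := fun q hq =>
    hS.contDiffAt φ ⟨hq.1, hq.2.1⟩
  have hχ : ∀ q ∈ Ioo (-ε) ε ×ˢ overlap φ ψ,
      ContDiffAt ℝ ∞ (fun p : ℝ × E m => (p.1, transition φ ψ p.2)) q := fun q hq =>
    contDiffAt_fst.prodMk ((contDiffAt_transition φ ψ hq.2).comp q contDiffAt_snd)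
  have hmap : ∀ q ∈ Ioo (-ε) ε ×ˢ overlap φ ψ,
      (q.1, transition φ ψ q.2) ∈ Ioo (-ε) ε ×ˢ ψ.1.target := fun q hq =>
    ⟨hq.1, (transition_mem_overlap φ ψ hq.2).1⟩
  have h2 : ∀ q ∈ Ioo (-ε) ε ×ˢ overlap φ ψ,
      ContDiffAt ℝ ∞ (fun p => varRep S ψ (p.1, transition φ ψ p.2)) q := fun q hq =>
    ContDiffAt.comp (g := varRep S ψ) q (hS.contDiffAt ψ (hmap q hq)) (hχ q hq)
  refine sameCanonicalForms_of_transform (fun q => fderiv ℝ (transition φ ψ) q.2)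
    (fun q v => fderiv ℝ (fderiv ℝ (transition φ ψ)) q.2 v.2) ?_ ?_ ?_
  · filter_upwards [hmem] with q hq using ⟨h1 q hq, ((S q.1).rep_mem φ hq.2.1).1⟩
  · filter_upwards [hmem] with q hq using h2 q hq
  · filter_upwards [hmem, eventually_eventually_nhds.2 hmem] with q hq hq'
    have hd2 := ((h2 q hq).differentiableAt (by simp)).hasFDerivAt
    have hd1 := ((h1 q hq).differentiableAt (by simp)).hasFDerivAt
    have hfst : ∀ v, (fderiv ℝ (fun p => varRep S ψ (p.1, transition φ ψ p.2)) q v).1 =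
        fderiv ℝ (transition φ ψ) q.2 v.2 := by
      intro v
      have e1 := (dx m).hasFDerivAt.comp q hd2
      have e2 : HasFDerivAt (fun p : ℝ × E m => transition φ ψ p.2)
          ((fderiv ℝ (transition φ ψ) q.2).comp (ContinuousLinearMap.snd ℝ ℝ (E m))) q :=
        ((contDiffAt_transition φ ψ hq.2).differentiableAt (by simp)).hasFDerivAt.comp q
          hasFDerivAt_snd
      have e3 := e2.congr_of_eventuallyEq
        (f₁ := (dx m) ∘ fun p : ℝ × E m => varRep S ψ (p.1, transition φ ψ p.2))
        (hq'.mono fun y hy => (S y.1).rep_fst ψ (hmap y hy).2)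
      exact congrArg (fun T : ℝ × E m →L[ℝ] E m => T v) (e1.unique e3)
    have hframe : ∀ v, (fderiv ℝ (fun p => varRep S ψ (p.1, transition φ ψ p.2)) q v).2.1 =
        fderiv ℝ (fderiv ℝ (transition φ ψ)) q.2 v.2 * (varRep S φ q).2.1 +
          fderiv ℝ (transition φ ψ) q.2 * (fderiv ℝ (varRep S φ) q v).2.1 := by
      intro v
      have e1 := (de m).hasFDerivAt.comp q hd2
      have e2 : HasFDerivAt (fun p : ℝ × E m => fderiv ℝ (transition φ ψ) p.2)
          ((fderiv ℝ (fderiv ℝ (transition φ ψ)) q.2).comp (ContinuousLinearMap.snd ℝ ℝ (E m)))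
          q :=
        (((contDiffAt_transition φ ψ hq.2).fderiv_right (m := ∞) (by simp)).differentiableAt
          (by simp)).hasFDerivAt.comp q hasFDerivAt_snd
      have e3 := (e2.clm_comp ((de m).hasFDerivAt.comp q hd1)).congr_of_eventuallyEq
        (f₁ := (de m) ∘ fun p : ℝ × E m => varRep S ψ (p.1, transition φ ψ p.2))
        (hq'.mono fun y hy => (S y.1).rep_frame_transition φ ψ hy.2)
      refine (congrArg (fun T : ℝ × E m →L[ℝ] (E m →L[ℝ] E m) => T v) (e1.unique e3)).trans ?_
      exact add_comm _ _
    have hfst' := hS.fderiv_fst φ ⟨hq.1, hq.2.1⟩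
    refine ⟨isUnit_fderiv_transition φ ψ hq.2, (S q.1).rep_frame_transition φ ψ hq.2,
      fun v => ⟨?_, hframe v, ?_⟩⟩
    · rw [hfst, hfst']
    · rw [hfst, hfst']
      exact (S q.1).rep_gamma_transition φ ψ hq.2 v.2

/-- Equality of the canonical forms on `ℝ × ℝ^m` is needed, since the `∂_t` components of `Λ` must
transform too. The chart change does not involve time, whence the block form `id × Dχ`. -/
theorem SmoothFamily.varLag_transition (hS : SmoothFamily ε S) (n : ℕ) (φ ψ : Chart m M)
    {t : ℝ} {z : E m} (hp : (t, z) ∈ Ioo (-ε) ε ×ˢ overlap φ ψ) :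
    varLag n S φ (t, z) = (varLag n S ψ (t, transition φ ψ z)).compContinuousLinearMap
      ((ContinuousLinearMap.id ℝ ℝ).prodMap (fderiv ℝ (transition φ ψ) z)) := by
  rw [varLag, (hS.sameCanonicalForms_transition φ ψ hp).pullback_lagrangian n]
  have h1 : HasFDerivAt (fun p : ℝ × E m => (p.1, transition φ ψ p.2))
      ((ContinuousLinearMap.id ℝ ℝ).prodMap (fderiv ℝ (transition φ ψ) z)) (t, z) :=
    hasFDerivAt_fst.prodMk
      (((contDiffAt_transition φ ψ hp.2).differentiableAt (by simp)).hasFDerivAt.comp (t, z)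
        hasFDerivAt_snd)
  have h2 := ((hS.contDiffAt ψ (p := (t, transition φ ψ z))
    ⟨hp.1, (transition_mem_overlap φ ψ hp.2).1⟩).differentiableAt (by simp)).hasFDerivAt
  have h3 := (h2.comp (t, z) h1).fderiv
  change (lagrangian n (varRep S ψ (t, transition φ ψ z))).compContinuousLinearMap
    (fderiv ℝ (varRep S ψ ∘ fun p => (p.1, transition φ ψ p.2)) (t, z)) = _
  rw [h3]
  rfl

end Variations

/-! ### The first variation of the action -/

section FirstVariation

variable {m : ℕ} {M : Type*} [TopologicalSpace M] [ChartedSpace (E m) M]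

theorem clm_det_mul (A B : E m →L[ℝ] E m) : (A * B).det = A.det * B.det :=
  LinearMap.det_comp (A : E m →ₗ[ℝ] E m) B

theorem det_ne_zero_of_isUnit {A : E m →L[ℝ] E m} (h : IsUnit A) : A.det ≠ 0 := by
  obtain ⟨u, rfl⟩ := h
  intro h0
  have h1 := clm_det_mul (u : E m →L[ℝ] E m) (↑u⁻¹)
  rw [u.mul_inv, h0, zero_mul] at h1
  have h2 : (1 : E m →L[ℝ] E m).det = 1 := LinearMap.det_id
  rw [h2] at h1
  exact one_ne_zero h1

/-- The degree of `λ_L` equals `m` only propositionally, so the coordinate frame is indexed by a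
`Fin k` with `k = m`. -/
theorem exists_basis_coordFrame {k : ℕ} (hk : k = m) :
    ∃ b : Module.Basis (Fin k) ℝ (E m), ⇑b = coordFrame m k := by
  subst hk
  refine ⟨(EuclideanSpace.basisFun (Fin k) ℝ).toBasis, ?_⟩
  funext a
  ext i
  simp [coordFrame, EuclideanSpace.basisFun_apply, Fin.ext_iff]

variable (ρ : SmoothPartitionOfUnity (Chart m M) (𝓡 m) M univ)

/-- The functions of a partition of unity in the coordinates of a chart. -/
def partitionRep (α φ : Chart m M) (z : E m) : ℝ := ρ α (φ.1.symm z)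

theorem contDiffOn_partitionRep (α φ : Chart m M) :
    ContDiffOn ℝ ∞ (partitionRep ρ α φ) φ.1.target := by
  rw [← contMDiffOn_iff_contDiffOn]
  exact (ρ α).contMDiff.comp_contMDiffOn (contMDiffOn_symm_of_mem_maximalAtlas φ.2)

theorem contDiffAt_partitionRep (α φ : Chart m M) {z : E m} (hz : z ∈ φ.1.target) :
    ContDiffAt ℝ ∞ (partitionRep ρ α φ) z :=
  (contDiffOn_partitionRep ρ α φ).contDiffAt (φ.1.open_target.mem_nhds hz)

theorem fderiv_partitionRep_transition (α φ ψ : Chart m M) {z : E m} (hz : z ∈ overlap φ ψ) :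
    fderiv ℝ (partitionRep ρ α φ) z =
      (fderiv ℝ (partitionRep ρ α ψ) (transition φ ψ z)).comp (fderiv ℝ (transition φ ψ) z) := by
  have h1 := ((contDiffAt_partitionRep ρ α ψ
    (transition_mem_overlap φ ψ hz).1).differentiableAt (by simp)).hasFDerivAt.comp z
    ((contDiffAt_transition φ ψ hz).differentiableAt (by simp)).hasFDerivAt
  refine (h1.congr_of_eventuallyEq ?_).fderiv
  filter_upwards [(isOpen_overlap φ ψ).mem_nhds hz] with y hy
  exact congrArg (ρ α) (symm_transition φ ψ hy).symm

/-- The sign of the frame of a section in the coordinates of a chart. -/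
def frameSign (s : T0Section m M) (φ : Chart m M) (z : E m) : ℝ := Real.sign (s.rep φ z).2.1.det

theorem continuousAt_frameDet {W : Type*} [TopologicalSpace W] {F : W → J m} {w : W}
    (hF : ContinuousAt F w) : ContinuousAt (fun w => (F w).2.1.det) w :=
  ContinuousLinearMap.continuous_det.continuousAt.comp ((de m).continuous.continuousAt.comp hF)

/-- The density `± dρ_α ∧ ι_{∂_t} Λ` of the boundary terms of the first variation. -/
def fluxDensity (n : ℕ) (S : ℝ → T0Section m M) (α φ : Chart m M) (z : E m) : ℝ :=
  frameSign (S 0) φ z *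
    fluxForm (varLag n S φ (0, z)) (fderiv ℝ (partitionRep ρ α φ) z) (coordFrame m _)

variable {ε : ℝ} {S : ℝ → T0Section m M}

theorem SmoothFamily.fluxDensity_eq_zero_of_notMem (hS : SmoothFamily ε S) (hε : 0 < ε)
    {K : Set M} (hoff : ∀ t ∈ Ioo (-ε) ε, ∀ x ∉ K, (S t).toFun x = (S 0).toFun x) (n : ℕ)
    (α φ : Chart m M) {z : E m} (hz : z ∈ φ.1.target) (hzK : φ.1.symm z ∉ K) :
    fluxDensity ρ n S α φ z = 0 := by
  have h : ∀ i, varLag n S φ (0, z) (omitVec (coordFrame m _) i) = 0 :=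
    hS.varLag_omitVec_eq_zero hoff n φ ⟨⟨by linarith, hε⟩, hz⟩ hzK _
  simp [fluxDensity, fluxForm, h]

theorem eventually_notMem_tsupport {α φ : Chart m M} {z : E m} (hz : z ∈ φ.1.target)
    (h : φ.1.symm z ∉ tsupport (ρ α)) : ∀ᶠ y in 𝓝 z, φ.1.symm y ∉ tsupport (ρ α) :=
  (φ.1.continuousAt_symm hz).eventually_mem ((isClosed_tsupport _).isOpen_compl.mem_nhds h)

theorem fderiv_partitionRep_eq_zero {α φ : Chart m M} {z : E m} (hz : z ∈ φ.1.target)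
    (h : φ.1.symm z ∉ tsupport (ρ α)) : fderiv ℝ (partitionRep ρ α φ) z = 0 := by
  have : partitionRep ρ α φ =ᶠ[𝓝 z] fun _ => 0 :=
    (eventually_notMem_tsupport ρ hz h).mono fun y hy =>
      image_eq_zero_of_notMem_tsupport (f := ρ α) hy
  rw [this.fderiv_eq]
  simp

theorem fluxDensity_eq_zero_of_notMem_tsupport (n : ℕ) {α φ : Chart m M} {z : E m}
    (hz : z ∈ φ.1.target) (h : φ.1.symm z ∉ tsupport (ρ α)) : fluxDensity ρ n S α φ z = 0 := by
  simp [fluxDensity, fluxForm, fderiv_partitionRep_eq_zero ρ hz h]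

variable [IsManifold (𝓡 m) ∞ M]

theorem eventually_frameSign_eq (s : T0Section m M) (φ : Chart m M) {z : E m}
    (hz : z ∈ φ.1.target) : ∀ᶠ y in 𝓝 z, frameSign s φ y = frameSign s φ z :=
  eventually_sign_eq (continuousAt_frameDet (s.contDiffAt_rep φ hz).continuousAt)
    (det_ne_zero_of_isUnit (s.rep_mem φ hz).1)

/-- The frame determinant is continuous and never zero over the time interval, so every `Σ_t`
induces the same orientation. -/
theorem SmoothFamily.sign_eq (hS : SmoothFamily ε S) (φ : Chart m M) {t : ℝ} {z : E m}
    (ht : t ∈ Ioo (-ε) ε) (hz : z ∈ φ.1.target) :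
    Real.sign ((S t).rep φ z).2.1.det = frameSign (S 0) φ z := by
  have hc : ContinuousOn (fun t => (varRep S φ (t, z)).2.1.det) (Ioo (-ε) ε) := fun u hu =>
    (continuousAt_frameDet (F := fun t => varRep S φ (t, z))
      (ContinuousAt.comp (g := varRep S φ) (hS.contDiffAt φ (p := (u, z)) ⟨hu, hz⟩).continuousAt
        (by fun_prop))).continuousWithinAt
  have h0 : (0 : ℝ) ∈ Ioo (-ε) ε := by constructor <;> linarith [ht.1, ht.2]
  exact sign_eq_of_continuousOn isPreconnected_Ioo hc
    (fun u _ => det_ne_zero_of_isUnit ((S u).rep_mem φ hz).1) ht h0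

/-- The top-degree form contributes the Jacobian determinant and the frame sign contributes its
sign. The product is a density, so it can be integrated without a choice of orientation. -/
theorem SmoothFamily.fluxDensity_transition (hS : SmoothFamily ε S) (hε : 0 < ε) {n : ℕ}
    (hr : n + 1 + (n + 1) ≤ m) (α φ ψ : Chart m M) {z : E m} (hz : z ∈ overlap φ ψ) :
    fluxDensity ρ n S α φ z = |(fderiv ℝ (transition φ ψ) z).det| •
      fluxDensity ρ n S α ψ (transition φ ψ z) := by
  obtain ⟨b, hb⟩ := exists_basis_coordFrame (m := m)
    (k := (m - (n + 1 + (n + 1))) + 2 * (n + 1)) (by omega)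
  rw [fluxDensity, fluxDensity, ← hb, hS.varLag_transition n φ ψ ⟨⟨by linarith, hε⟩, hz⟩,
    fderiv_partitionRep_transition ρ α φ ψ hz, fluxForm_comp_basis, ← mul_assoc, smul_eq_mul,
    ← mul_assoc]
  congr 1
  rw [frameSign, frameSign, (S 0).rep_frame_transition φ ψ hz, clm_det_mul]
  exact sign_mul_self_eq_abs _ _ (det_ne_zero_of_isUnit (isUnit_fderiv_transition φ ψ hz))

theorem SmoothFamily.continuousOn_fluxDensity (hS : SmoothFamily ε S) (hε : 0 < ε) (n : ℕ)
    (α φ : Chart m M) : ContinuousOn (fluxDensity ρ n S α φ) φ.1.target := by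
  intro z hz
  refine ContinuousAt.continuousWithinAt (ContinuousAt.mul ?_ ?_)
  · exact (continuousAt_const (y := frameSign (S 0) φ z)).congr
      ((eventually_frameSign_eq (S 0) φ hz).mono fun y hy => hy.symm)
  · refine tendsto_finsetSum _ fun i _ => ?_
    refine ContinuousAt.mul continuousAt_const (ContinuousAt.mul ?_ ?_)
    · exact (((contDiffAt_partitionRep ρ α φ hz).fderiv_right (m := ∞)
        (by simp)).continuousAt).clm_apply continuousAt_const
    · exact ContinuousAt.comp (f := fun z : E m => ((0 : ℝ), z))
        (hS.contDiffAt_varLag_apply n φ (p := (0, z)) ⟨⟨by linarith, hε⟩, hz⟩ _).continuousAt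
        (by fun_prop)

end FirstVariation

/-! ### Stationarity of the action -/

section Stationarity

variable {m : ℕ} {M : Type*} [TopologicalSpace M] [ChartedSpace (E m) M]
  {ρ : SmoothPartitionOfUnity (Chart m M) (𝓡 m) M univ} {K : Set M}
  {ε : ℝ} {S : ℝ → T0Section m M}

variable (ρ K) in
/-- The part of `K` in the support of `ρ_φ`, in the coordinates of `φ`. -/
def coordSupport (φ : Chart m M) : Set (E m) := φ.1 '' (tsupport (ρ φ) ∩ K)

theorem coordSupport_subset (hρ : ρ.IsSubordinate fun φ => φ.1.source) (φ : Chart m M) :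
    coordSupport ρ K φ ⊆ φ.1.target := by
  rintro _ ⟨x, hx, rfl⟩
  exact φ.1.map_source (hρ φ hx.1)

theorem isCompact_coordSupport (hρ : ρ.IsSubordinate fun φ => φ.1.source) (hK : IsCompact K)
    (φ : Chart m M) : IsCompact (coordSupport ρ K φ) :=
  (hK.inter_left (isClosed_tsupport _)).image_of_continuousOn
    (φ.1.continuousOn.mono fun _ hx => hρ φ hx.1)

theorem notMem_of_notMem_coordSupport {φ : Chart m M} {z : E m} (hz : z ∈ φ.1.target)
    (h : z ∉ coordSupport ρ K φ) : φ.1.symm z ∉ tsupport (ρ φ) ∨ φ.1.symm z ∉ K := by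
  by_contra! h'
  exact h ⟨φ.1.symm z, h', φ.1.right_inv hz⟩

theorem SmoothFamily.fluxDensity_eq_zero_off (hS : SmoothFamily ε S) (hε : 0 < ε)
    (hoff : ∀ t ∈ Ioo (-ε) ε, ∀ x ∉ K, (S t).toFun x = (S 0).toFun x) (n : ℕ) (φ : Chart m M) :
    ∀ z ∈ φ.1.target \ coordSupport ρ K φ, fluxDensity ρ n S φ φ z = 0 := by
  intro z hz
  rcases notMem_of_notMem_coordSupport hz.1 hz.2 with h | h
  · exact fluxDensity_eq_zero_of_notMem_tsupport ρ n hz.1 h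
  · exact hS.fluxDensity_eq_zero_of_notMem ρ hε hoff n φ φ hz.1 h

variable (ρ) in
/-- The components of `ρ_φ ι_{∂_t} Λ`, up to sign. -/
def fluxComponent (n : ℕ) (S : ℝ → T0Section m M) (φ : Chart m M)
    (i : Fin ((m - (n + 1 + (n + 1))) + 2 * (n + 1))) (z : E m) : ℝ :=
  frameSign (S 0) φ z * (partitionRep ρ φ φ z *
    ((-1) ^ (i : ℕ) * varLag n S φ (0, z) (omitVec (coordFrame m _) i)))

theorem SmoothFamily.fluxComponent_eq_zero_off (hS : SmoothFamily ε S) (hε : 0 < ε)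
    (hoff : ∀ t ∈ Ioo (-ε) ε, ∀ x ∉ K, (S t).toFun x = (S 0).toFun x) (n : ℕ) (φ : Chart m M)
    (i : Fin ((m - (n + 1 + (n + 1))) + 2 * (n + 1))) :
    ∀ z ∈ φ.1.target \ coordSupport ρ K φ, fluxComponent ρ n S φ i z = 0 := by
  intro z hz
  rcases notMem_of_notMem_coordSupport hz.1 hz.2 with h | h
  · have : partitionRep ρ φ φ z = 0 := image_eq_zero_of_notMem_tsupport (f := ρ φ) h
    simp [fluxComponent, this]
  · have := hS.varLag_omitVec_eq_zero hoff n φ (t := 0) ⟨⟨by linarith, hε⟩, hz.1⟩ h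
      (coordFrame m _) i
    simp [fluxComponent, this]

variable [IsManifold (𝓡 m) ∞ M]

theorem SmoothFamily.integrableOn_fluxDensity (hS : SmoothFamily ε S) (hε : 0 < ε)
    (hoff : ∀ t ∈ Ioo (-ε) ε, ∀ x ∉ K, (S t).toFun x = (S 0).toFun x) (n : ℕ)
    (hρ : ρ.IsSubordinate fun φ => φ.1.source) (hK : IsCompact K) (φ : Chart m M) :
    IntegrableOn (fluxDensity ρ n S φ φ) φ.1.target :=
  integrableOn_of_eq_zero_off_compact φ.1.open_target (isCompact_coordSupport hρ hK φ)
    ((hS.continuousOn_fluxDensity ρ hε n φ φ).mono (coordSupport_subset hρ φ))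
    (hS.fluxDensity_eq_zero_off hε hoff n φ)

theorem SmoothFamily.contDiffAt_slice (hS : SmoothFamily ε S) (hε : 0 < ε) (n : ℕ)
    (φ : Chart m M) {z : E m} (hz : z ∈ φ.1.target)
    (v : Fin ((m - (n + 1 + (n + 1))) + 2 * (n + 1)) → ℝ × E m) :
    ContDiffAt ℝ ∞ (fun z => varLag n S φ (0, z) v) z :=
  ContDiffAt.comp (g := fun p => varLag n S φ p v) (f := fun z : E m => ((0 : ℝ), z)) z
    (hS.contDiffAt_varLag_apply n φ (p := (0, z)) ⟨⟨by linarith, hε⟩, hz⟩ v)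
    (contDiffAt_const.prodMk contDiffAt_id)

theorem SmoothFamily.fderiv_slice (hS : SmoothFamily ε S) (hε : 0 < ε) (n : ℕ)
    (φ : Chart m M) {z : E m} (hz : z ∈ φ.1.target)
    (v : Fin ((m - (n + 1 + (n + 1))) + 2 * (n + 1)) → ℝ × E m) (u : E m) :
    fderiv ℝ (fun z => varLag n S φ (0, z) v) z u =
      fderiv ℝ (fun p => varLag n S φ p v) (0, z) (0, u) := by
  have h1 := ((hS.contDiffAt_varLag_apply n φ (p := (0, z)) ⟨⟨by linarith, hε⟩, hz⟩
    v).differentiableAt (by simp)).hasFDerivAt.comp z (hasFDerivAt_prodMk_right (𝕜 := ℝ) 0 z)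
  exact congrArg (fun T : E m →L[ℝ] ℝ => T u) h1.fderiv

/-- The frame sign is locally constant and passes through derivatives as a scalar. -/
theorem SmoothFamily.eventually_fluxComponent (n : ℕ) (φ : Chart m M) {z : E m}
    (hz : z ∈ φ.1.target) (i : Fin ((m - (n + 1 + (n + 1))) + 2 * (n + 1))) :
    fluxComponent ρ n S φ i =ᶠ[𝓝 z] fun y => frameSign (S 0) φ z * (partitionRep ρ φ φ y *
      ((-1) ^ (i : ℕ) * varLag n S φ (0, y) (omitVec (coordFrame m _) i))) :=
  (eventually_frameSign_eq (S 0) φ hz).mono fun y hy => by rw [fluxComponent, hy]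

theorem SmoothFamily.contDiffOn_fluxComponent (hS : SmoothFamily ε S) (hε : 0 < ε) (n : ℕ)
    (φ : Chart m M) (i : Fin ((m - (n + 1 + (n + 1))) + 2 * (n + 1))) :
    ContDiffOn ℝ 1 (fluxComponent ρ n S φ i) φ.1.target := by
  intro z hz
  refine ContDiffAt.contDiffWithinAt (ContDiffAt.of_le ?_ (n := ∞) (by norm_cast))
  refine ContDiffAt.congr_of_eventuallyEq ?_ (SmoothFamily.eventually_fluxComponent n φ hz i)
  exact contDiffAt_const.mul ((contDiffAt_partitionRep ρ φ φ hz).mul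
    (contDiffAt_const.mul (hS.contDiffAt_slice hε n φ hz _)))

/-- The time derivative of the density of the action is a divergence up to the boundary terms. -/
theorem SmoothFamily.time_deriv_eq (hS : SmoothFamily ε S) (hε : 0 < ε) {n : ℕ}
    (hr : n + 1 + (n + 1) ≤ m) (hmetric : (S 0).Metric) (heq : (S 0).LovelockEquations n)
    (φ : Chart m M) {z : E m} (hz : z ∈ φ.1.target) :
    frameSign (S 0) φ z * partitionRep ρ φ φ z *
        fderiv ℝ (fun p => varLag n S φ p fun a => (0, coordFrame m _ a)) (0, z) (1, 0) =
      ∑ i, fderiv ℝ (fluxComponent ρ n S φ i) z (coordFrame m _ i) - fluxDensity ρ n S φ φ z := by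
  have hp : ((0 : ℝ), z) ∈ Ioo (-ε) ε ×ˢ φ.1.target := ⟨⟨by linarith, hε⟩, hz⟩
  have h1 := extDeriv_apply_cons (hS.differentiableAt_varLag n φ hp) (coordFrame m _)
  rw [hS.extDeriv_varLag hr hε hmetric heq φ hz] at h1
  -- As `dΛ(∂_t, …) = 0`, the time derivative is the divergence of `ι_{∂_t} Λ`; moving `ρ_φ` inside
  -- that divergence produces the flux density as the error.
  rw [sub_eq_zero.1 h1.symm, fluxDensity, fluxForm, Finset.mul_sum, Finset.mul_sum,
    ← Finset.sum_sub_distrib]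
  refine Finset.sum_congr rfl fun i _ => ?_
  rw [← hS.fderiv_slice hε n φ hz, (SmoothFamily.eventually_fluxComponent n φ hz i).fderiv_eq]
  have d1 := ((contDiffAt_partitionRep ρ φ φ hz).differentiableAt (by simp)).hasFDerivAt
  have d2 := ((hS.contDiffAt_slice hε n φ hz
    (omitVec (coordFrame m _) i)).differentiableAt (by simp)).hasFDerivAt
  rw [((d1.fun_mul (d2.const_mul ((-1) ^ (i : ℕ)))).const_mul (frameSign (S 0) φ z)).fderiv]
  simp only [_root_.smul_apply, _root_.add_apply, smul_eq_mul]
  ring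

theorem SmoothFamily.hasDerivAt_chartIntegral [T2Space M] (hS : SmoothFamily ε S) (hε : 0 < ε)
    {n : ℕ} (hr : n + 1 + (n + 1) ≤ m) (hmetric : (S 0).Metric) (heq : (S 0).LovelockEquations n)
    (hK : IsCompact K) (hoff : ∀ t ∈ Ioo (-ε) ε, ∀ x ∉ K, (S t).toFun x = (S 0).toFun x)
    (hρ : ρ.IsSubordinate fun φ => φ.1.source) (φ : Chart m M) :
    HasDerivAt (fun t => ∫ z in φ.1.target ∩ φ.1.symm ⁻¹' K,
        ρ φ (φ.1.symm z) * Real.sign ((S t).rep φ z).2.1.det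
          * pullback ((S t).rep φ) (lagrangian n) z (coordFrame m _))
      (-∫ z in φ.1.target, fluxDensity ρ n S φ φ z) 0 := by
  have hC := isCompact_coordSupport (K := K) hρ hK φ
  have hCU := coordSupport_subset (K := K) hρ φ
  have hU := φ.1.open_target
  set c : E m → ℝ := fun z => frameSign (S 0) φ z * partitionRep ρ φ φ z with hc_def
  set g : ℝ × E m → ℝ := fun p => varLag n S φ p fun a => (0, coordFrame m _ a) with hg_def
  have hc : ContinuousOn c (coordSupport ρ K φ) := fun z hz =>
    (ContinuousAt.mul ((continuousAt_const (y := frameSign (S 0) φ z)).congr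
      ((eventually_frameSign_eq (S 0) φ (hCU hz)).mono fun y hy => hy.symm))
      (contDiffAt_partitionRep ρ φ φ (hCU hz)).continuousAt).continuousWithinAt
  have hg : ContDiffOn ℝ 1 g (Ioo (-ε) ε ×ˢ φ.1.target) := fun p hp =>
    ((hS.contDiffAt_varLag_apply n φ hp _).of_le (by norm_cast)).contDiffWithinAt
  have h1 := hasDerivAt_setIntegral_compact (μ := volume) hε hU hC hCU hg hc
  have hmeas : MeasurableSet (φ.1.target ∩ φ.1.symm ⁻¹' K) := by
    have : φ.1.target ∩ φ.1.symm ⁻¹' K = φ.1.target \ (φ.1.target ∩ φ.1.symm ⁻¹' Kᶜ) := by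
      ext z; simp
    rw [this]
    exact hU.measurableSet.diff
      (φ.1.symm.isOpen_inter_preimage hK.isClosed.isOpen_compl).measurableSet
  have hsub : coordSupport ρ K φ ⊆ φ.1.target ∩ φ.1.symm ⁻¹' K := by
    rintro _ ⟨x, hx, rfl⟩
    refine ⟨φ.1.map_source (hρ φ hx.1), ?_⟩
    rw [mem_preimage, φ.1.left_inv (hρ φ hx.1)]
    exact hx.2
  -- The integrand vanishes off the support of `ρ_φ`, so the domain may be replaced by a compact
  -- subset of the chart that does not depend on `t`.
  have h2 : ∀ t ∈ Ioo (-ε) ε, ∫ z in φ.1.target ∩ φ.1.symm ⁻¹' K,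
        ρ φ (φ.1.symm z) * Real.sign ((S t).rep φ z).2.1.det
          * pullback ((S t).rep φ) (lagrangian n) z (coordFrame m _) =
      ∫ z in coordSupport ρ K φ, c z * g (t, z) := by
    intro t ht
    rw [setIntegral_eq_of_subset_of_forall_sdiff_eq_zero hmeas hsub]
    · refine setIntegral_congr_fun hC.measurableSet fun z hz => ?_
      change ρ φ (φ.1.symm z) * _ * _ = frameSign (S 0) φ z * ρ φ (φ.1.symm z) * _
      rw [hS.sign_eq φ ht (hCU hz), hS.pullback_rep n φ ⟨ht, hCU hz⟩, mul_comm (ρ φ _)]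
    · intro z hz
      rcases notMem_of_notMem_coordSupport hz.1.1 hz.2 with h | h
      · rw [image_eq_zero_of_notMem_tsupport (f := ρ φ) h, zero_mul, zero_mul]
      · exact (h hz.1.2).elim
  have h3 : ∫ z in coordSupport ρ K φ, c z * fderiv ℝ g (0, z) (1, 0) =
      -∫ z in φ.1.target, fluxDensity ρ n S φ φ z := by
    have hcont : ∀ i, ContinuousOn (fun z => fderiv ℝ (fluxComponent ρ n S φ i) z
        (coordFrame m _ i)) φ.1.target := fun i =>
      ((hS.contDiffOn_fluxComponent hε n φ i).continuousOn_fderiv_of_isOpen hU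
        le_rfl).clm_apply continuousOn_const
    have hzero : ∀ i, ∀ z ∈ φ.1.target \ coordSupport ρ K φ,
        fderiv ℝ (fluxComponent ρ n S φ i) z (coordFrame m _ i) = 0 := by
      intro i z hz
      have : fluxComponent ρ n S φ i =ᶠ[𝓝 z] fun _ => 0 := by
        filter_upwards [(hU.sdiff hC.isClosed).mem_nhds hz]
          with y hy using hS.fluxComponent_eq_zero_off hε hoff n φ i y hy
      rw [this.fderiv_eq]
      simp
    have hint : ∀ i, IntegrableOn (fun z => fderiv ℝ (fluxComponent ρ n S φ i) z
        (coordFrame m _ i)) φ.1.target := fun i =>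
      integrableOn_of_eq_zero_off_compact hU hC ((hcont i).mono hCU) (hzero i)
    have hpt : ∀ z ∈ φ.1.target, c z * fderiv ℝ g (0, z) (1, 0) =
        ∑ i, fderiv ℝ (fluxComponent ρ n S φ i) z (coordFrame m _ i) -
          fluxDensity ρ n S φ φ z := fun z hz => hS.time_deriv_eq hε hr hmetric heq φ hz
    -- The integral is spread back over the open chart domain, where each divergence term is the
    -- derivative of a function supported in a compact set and integrates to zero.
    rw [← setIntegral_eq_of_subset_of_forall_sdiff_eq_zero hU.measurableSet hCU,
      setIntegral_congr_fun hU.measurableSet hpt, integral_sub,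
      integral_finsetSum _ fun i _ => hint i, Finset.sum_eq_zero, zero_sub]
    · exact fun i _ => setIntegral_fderiv_eq_zero hU hC hCU (hS.contDiffOn_fluxComponent hε n φ i)
        (hS.fluxComponent_eq_zero_off hε hoff n φ i) _
    · exact integrable_finsetSum _ fun i _ => hint i
    · exact hS.integrableOn_fluxDensity hε hoff n hρ hK φ
    · intro z hz
      rw [hpt z hz.1, hS.fluxDensity_eq_zero_off hε hoff n φ z hz,
        Finset.sum_eq_zero fun i _ => hzero i z hz, sub_zero]
  rw [← h3]
  refine h1.congr_of_eventuallyEq ?_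
  filter_upwards [isOpen_Ioo.mem_nhds (show (0 : ℝ) ∈ Ioo (-ε) ε from ⟨by linarith, hε⟩)]
    with t ht using h2 t ht

end Stationarity

/-! ### Cancellation of the boundary terms -/

section Cancellation

variable {m : ℕ} {M : Type*} [TopologicalSpace M] [ChartedSpace (E m) M]
  {ρ : SmoothPartitionOfUnity (Chart m M) (𝓡 m) M univ} {K : Set M}
  {ε : ℝ} {S : ℝ → T0Section m M}

/-- Local finiteness leaves only finitely many functions whose supports meet the compact set `K`. -/
theorem exists_finset_partition (ρ : SmoothPartitionOfUnity (Chart m M) (𝓡 m) M univ)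
    (hK : IsCompact K) : ∃ Φ : Finset (Chart m M), (∀ φ ∉ Φ, ∀ x ∈ K, x ∉ tsupport (ρ φ)) ∧
      ∀ x ∈ K, ∑ φ ∈ Φ, ρ φ x = 1 := by
  have hfin := ρ.locallyFinite.closure.finite_nonempty_inter_compact hK
  have h1 : ∀ φ ∉ hfin.toFinset, ∀ x ∈ K, x ∉ tsupport (ρ φ) := fun φ hφ x hx h =>
    hφ (hfin.mem_toFinset.2 ⟨x, h, hx⟩)
  refine ⟨hfin.toFinset, h1, fun x hx => ?_⟩
  rw [← ρ.sum_eq_one (mem_univ x)]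
  refine (finsum_eq_sum_of_support_subset _ fun φ hφ => ?_).symm
  by_contra h
  exact hφ (image_eq_zero_of_notMem_tsupport (h1 φ h x hx))

theorem setIntegral_overlap (φ ψ : Chart m M) (g : E m → ℝ) :
    ∫ y in overlap ψ φ, g y =
      ∫ z in overlap φ ψ, |(fderiv ℝ (transition φ ψ) z).det| • g (transition φ ψ z) := by
  have himage : transition φ ψ '' overlap φ ψ = overlap ψ φ := by
    apply Subset.antisymm
    · rintro _ ⟨z, hz, rfl⟩
      exact transition_mem_overlap φ ψ hz
    · exact fun y hy => ⟨transition ψ φ y, transition_mem_overlap ψ φ hy,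
        transition_transition ψ φ hy⟩
  rw [← himage]
  refine integral_image_eq_integral_abs_det_fderiv_smul volume
    (isOpen_overlap φ ψ).measurableSet (fun z hz =>
      ((contDiffAt_transition φ ψ hz).differentiableAt (by simp)).hasFDerivAt.hasFDerivWithinAt)
    (fun z hz z' hz' h => ?_) g
  rw [← transition_transition φ ψ hz, ← transition_transition φ ψ hz', h]

theorem setIntegral_target_eq_overlap (φ ψ : Chart m M) {g : E m → ℝ}
    (h : ∀ z ∈ φ.1.target, φ.1.symm z ∉ ψ.1.source → g z = 0) :
    ∫ z in φ.1.target, g z = ∫ z in overlap φ ψ, g z :=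
  setIntegral_eq_of_subset_of_forall_sdiff_eq_zero φ.1.open_target.measurableSet
    inter_subset_left fun z hz => h z hz.1 fun h' => hz.2 ⟨hz.1, h'⟩

variable [IsManifold (𝓡 m) ∞ M]

/-- Both integrals live on the overlap of the charts: on one side `ρ_ψ` vanishes outside the domain
of `ψ`, on the other `dρ_φ` vanishes outside that of `φ`. -/
theorem SmoothFamily.setIntegral_fluxDensity_transition (hS : SmoothFamily ε S) (hε : 0 < ε)
    {n : ℕ} (hr : n + 1 + (n + 1) ≤ m) (hρ : ρ.IsSubordinate fun φ => φ.1.source)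
    (φ ψ : Chart m M) :
    ∫ z in φ.1.target, partitionRep ρ ψ φ z * fluxDensity ρ n S φ φ z =
      ∫ y in ψ.1.target, partitionRep ρ ψ ψ y * fluxDensity ρ n S φ ψ y := by
  rw [setIntegral_target_eq_overlap φ ψ, setIntegral_target_eq_overlap ψ φ,
    setIntegral_overlap φ ψ]
  · refine setIntegral_congr_fun (isOpen_overlap φ ψ).measurableSet fun z hz => ?_
    have h1 : partitionRep ρ ψ ψ (transition φ ψ z) = partitionRep ρ ψ φ z :=
      congrArg (ρ ψ) (symm_transition φ ψ hz)
    change partitionRep ρ ψ φ z * fluxDensity ρ n S φ φ z =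
      |(fderiv ℝ (transition φ ψ) z).det| • (partitionRep ρ ψ ψ (transition φ ψ z) *
        fluxDensity ρ n S φ ψ (transition φ ψ z))
    rw [h1, hS.fluxDensity_transition ρ hε hr φ φ ψ hz, smul_eq_mul, smul_eq_mul]
    ring
  · intro y hy h
    rw [fluxDensity_eq_zero_of_notMem_tsupport ρ n hy fun h' => h (hρ φ h'), mul_zero]
  · intro z hz h
    have : partitionRep ρ ψ φ z = 0 :=
      image_eq_zero_of_notMem_tsupport (f := ρ ψ) fun h' => h (hρ ψ h')
    rw [this, zero_mul]

/-- In the interior of `K` the functions `ρ_φ` with `φ ∈ Φ` sum to 1, so their differentials cancel.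
At every other point `ι_{∂_t} Λ` vanishes. -/
theorem SmoothFamily.sum_fluxDensity_eq_zero (hS : SmoothFamily ε S) (hε : 0 < ε) {n : ℕ}
    (hoff : ∀ t ∈ Ioo (-ε) ε, ∀ x ∉ K, (S t).toFun x = (S 0).toFun x) {Φ : Finset (Chart m M)}
    (hΦ : ∀ x ∈ K, ∑ φ ∈ Φ, ρ φ x = 1) (ψ : Chart m M) {y : E m} (hy : y ∈ ψ.1.target) :
    ∑ φ ∈ Φ, fluxDensity ρ n S φ ψ y = 0 := by
  simp only [fluxDensity]
  rw [← Finset.mul_sum, ← fluxForm_sum]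
  by_cases h : ∀ᶠ z in 𝓝 y, ψ.1.symm z ∈ K
  · have h1 : HasFDerivAt (fun z => ∑ φ ∈ Φ, partitionRep ρ φ ψ z)
        (∑ φ ∈ Φ, fderiv ℝ (partitionRep ρ φ ψ) y) y :=
      HasFDerivAt.fun_sum fun φ _ =>
        ((contDiffAt_partitionRep ρ φ ψ hy).differentiableAt (by simp)).hasFDerivAt
    have h2 : HasFDerivAt (fun z => ∑ φ ∈ Φ, partitionRep ρ φ ψ z) (0 : E m →L[ℝ] ℝ) y :=
      (hasFDerivAt_const (1 : ℝ) y).congr_of_eventuallyEq (h.mono fun z hz => hΦ _ hz)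
    rw [h1.unique h2]
    simp [fluxForm]
  -- A nonzero component would stay nonzero nearby by continuity. It vanishes off `K`, so a whole
  -- neighbourhood would lie in `K`.
  · have h1 : ∀ i, varLag n S ψ (0, y) (omitVec (coordFrame m _) i) = 0 := by
      intro i
      by_contra h0
      have hc := (hS.contDiffAt_slice hε n ψ hy (omitVec (coordFrame m _) i)).continuousAt
      refine h ?_
      filter_upwards [hc.eventually_ne h0, ψ.1.open_target.mem_nhds hy] with z hz hzt
      by_contra hzK
      exact hz (hS.varLag_omitVec_eq_zero hoff n ψ ⟨⟨by linarith, hε⟩, hzt⟩ hzK _ i)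
    simp [fluxForm, h1]

/-- Insert `1 = ∑ ρ_ψ` on `K`, move each term from chart `φ` to chart `ψ`, and exchange the sums.
For fixed `ψ` the sum over `φ` vanishes pointwise. -/
theorem SmoothFamily.sum_setIntegral_fluxDensity_eq_zero [T2Space M] (hS : SmoothFamily ε S)
    (hε : 0 < ε) {n : ℕ} (hr : n + 1 + (n + 1) ≤ m) (hK : IsCompact K)
    (hoff : ∀ t ∈ Ioo (-ε) ε, ∀ x ∉ K, (S t).toFun x = (S 0).toFun x)
    (hρ : ρ.IsSubordinate fun φ => φ.1.source) {Φ : Finset (Chart m M)}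
    (hΦ : ∀ x ∈ K, ∑ φ ∈ Φ, ρ φ x = 1) :
    ∑ φ ∈ Φ, ∫ z in φ.1.target, fluxDensity ρ n S φ φ z = 0 := by
  have hcont : ∀ φ ψ : Chart m M, ContinuousOn (partitionRep ρ ψ φ) φ.1.target := fun φ ψ =>
    (contDiffOn_partitionRep ρ ψ φ).continuousOn
  have hint1 : ∀ φ ψ : Chart m M,
      IntegrableOn (fun z => partitionRep ρ ψ φ z * fluxDensity ρ n S φ φ z) φ.1.target := by
    refine fun φ ψ => integrableOn_of_eq_zero_off_compact φ.1.open_target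
      (isCompact_coordSupport hρ hK φ) (((hcont φ ψ).mul
        (hS.continuousOn_fluxDensity ρ hε n φ φ)).mono (coordSupport_subset hρ φ)) fun z hz => ?_
    rw [hS.fluxDensity_eq_zero_off hε hoff n φ z hz, mul_zero]
  have hint2 : ∀ φ ψ : Chart m M,
      IntegrableOn (fun y => partitionRep ρ ψ ψ y * fluxDensity ρ n S φ ψ y) ψ.1.target := by
    refine fun φ ψ => integrableOn_of_eq_zero_off_compact ψ.1.open_target
      (isCompact_coordSupport hρ hK ψ) (((hcont ψ ψ).mul
        (hS.continuousOn_fluxDensity ρ hε n φ ψ)).mono (coordSupport_subset hρ ψ)) fun z hz => ?_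
    rcases notMem_of_notMem_coordSupport hz.1 hz.2 with h | h
    · have : partitionRep ρ ψ ψ z = 0 := image_eq_zero_of_notMem_tsupport (f := ρ ψ) h
      rw [this, zero_mul]
    · rw [hS.fluxDensity_eq_zero_of_notMem ρ hε hoff n φ ψ hz.1 h, mul_zero]
  have h1 : ∀ φ : Chart m M, ∫ z in φ.1.target, fluxDensity ρ n S φ φ z =
      ∑ ψ ∈ Φ, ∫ z in φ.1.target, partitionRep ρ ψ φ z * fluxDensity ρ n S φ φ z := by
    intro φ
    rw [← integral_finsetSum _ fun ψ _ => hint1 φ ψ]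
    refine setIntegral_congr_fun φ.1.open_target.measurableSet fun z hz => ?_
    change fluxDensity ρ n S φ φ z = ∑ ψ ∈ Φ, partitionRep ρ ψ φ z * fluxDensity ρ n S φ φ z
    by_cases h : φ.1.symm z ∈ K
    · rw [← Finset.sum_mul]
      exact (one_mul (fluxDensity ρ n S φ φ z) ▸ congrArg (· * fluxDensity ρ n S φ φ z)
        (hΦ _ h)).symm
    · simp [hS.fluxDensity_eq_zero_of_notMem ρ hε hoff n φ φ hz h]
  rw [Finset.sum_congr rfl fun φ _ => (h1 φ).trans (Finset.sum_congr rfl fun ψ _ =>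
    hS.setIntegral_fluxDensity_transition hε hr hρ φ ψ), Finset.sum_comm]
  refine Finset.sum_eq_zero fun ψ _ => ?_
  rw [← integral_finsetSum _ fun φ _ => hint2 φ ψ]
  refine setIntegral_eq_zero_of_forall_eq_zero fun y hy => ?_
  rw [← Finset.mul_sum, hS.sum_fluxDensity_eq_zero hε hoff hΦ ψ hy, mul_zero]

/-- The action is stationary at solutions of the field equations. -/
theorem SmoothFamily.hasDerivAt_action [T2Space M] (hS : SmoothFamily ε S) (hε : 0 < ε)
    {n : ℕ} (hr : n + 1 + (n + 1) ≤ m) (hmetric : (S 0).Metric) (heq : (S 0).LovelockEquations n)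
    (hK : IsCompact K) (hoff : ∀ t ∈ Ioo (-ε) ε, ∀ x ∉ K, (S t).toFun x = (S 0).toFun x)
    (hρ : ρ.IsSubordinate fun φ => φ.1.source) :
    HasDerivAt (fun t => (S t).action n ρ K) 0 0 := by
  obtain ⟨Φ, h1, h2⟩ := exists_finset_partition ρ hK
  have h3 : ∀ t, (S t).action n ρ K = ∑ φ ∈ Φ, ∫ z in φ.1.target ∩ φ.1.symm ⁻¹' K,
      ρ φ (φ.1.symm z) * Real.sign ((S t).rep φ z).2.1.det
        * pullback ((S t).rep φ) (lagrangian n) z (coordFrame m _) := by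
    intro t
    -- A chart outside `Φ` contributes zero, since its partition function vanishes on `K`; the
    -- finite set of charts serves all `t` at once.
    refine finsum_eq_sum_of_support_subset _ fun φ hφ => ?_
    by_contra h
    refine hφ (setIntegral_eq_zero_of_forall_eq_zero fun z hz => ?_)
    rw [image_eq_zero_of_notMem_tsupport (h1 φ h _ hz.2), zero_mul, zero_mul]
  simp only [h3]
  have h4 := HasDerivAt.fun_sum (u := Φ) fun φ _ =>
    hS.hasDerivAt_chartIntegral hε hr hmetric heq hK hoff hρ φ
  rwa [Finset.sum_neg_distrib, hS.sum_setIntegral_fluxDensity_eq_zero hε hr hK hoff hρ h2,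
    neg_zero] at h4

end Cancellation

end Lovelock

end

/-! ### The main theorem -/

theorem mainTheorem2 {m : ℕ} {M : Type*} [TopologicalSpace M]
    [ChartedSpace (EuclideanSpace ℝ (Fin m)) M]
    [IsManifold (𝓡 m) ∞ M] [T2Space M] [SigmaCompactSpace M] [ConnectedSpace M]
    (n : ℕ) (hn : n + 1 < m / 2) (s : Lovelock.T0Section m M)
    (hmetric : s.Metric) (heq : s.LovelockEquations n) :
    (∀ (φ : Lovelock.Chart m M) (Z : Lovelock.J m → Lovelock.J m),
      (∀ q ∈ Lovelock.T0Coord m, Z q ∈ Lovelock.verticalT0 m) →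
      ∀ z ∈ φ.1.target,
        Lovelock.pullback (s.rep φ)
          (Lovelock.contract Z (extDeriv (Lovelock.lagrangian n))) z = 0) ∧
    s.IsExtremal n := by
  have hr : n + 1 + (n + 1) ≤ m := by omega
  refine ⟨fun φ Z hZ z hz => ?_, hmetric, fun ε S K hε h0 hK hS _ hoff ρ hρ => ?_⟩
  · exact Lovelock.T0Section.contract_extDeriv_lagrangian hr hmetric heq φ hz
      (hZ _ (s.rep_mem φ hz)).1
  · subst h0
    exact Lovelock.SmoothFamily.hasDerivAt_action (ε := ε) hS hε hr hmetric heq hK hoff hρ
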